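/- Let $\gamma\in(1,3)$, $\mu\in(0,1)$, $\delta=1/\mu$ and $T>0$. Consider the vacuum free-boundary Euler equations $$\rho_t+(\rho u)_x=0,\qquad (\rho u)_t+(\rho u^2+p)_x=0,\qquad p=\tfrac{\gamma-1}{\gamma}\rho^\gamma,\qquad x>b(t),$$ with $\rho>0$ for $x>b(t)$, $\rho(t,b(t))=0$, $\dot b(t)=u(t,b(t))$, $b(-T)=0$, and initial data $\rho_0,u_0$ at time $-T$ with $\rho_0>0$ on $(0,\infty)$, $\rho_0(0)=0$. Let $h=\rho^{\gamma-1}$ be the specific enthalpy. Then there is a continuum family of solutions, namely pairwise distinct $(\rho,u)=(\rho_c,u_c)$, $c\in(0,\infty)$, defined for all $t\in\mathbb R$, whose initial velocity satisfies $$u_c(-T,x)=-\tfrac{2}{(\gamma+1)T}\,x+c\,x^{\frac1{1-\mu}}+o\big(x^{\frac1{1-\mu}}\big)\quad(x\to0^+),$$ and for each $c$ there are $-\infty<y_B<y_D<0$ such that $(\rho,u)$ is continuous on $\{x\ge b(t)\}$ and solves this problem (the Euler equations in the weak sense, tested with compactly supported $C^1$ functions on $\mathbb R^2$ that need not vanish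 on the boundary) for the boundary $$b(t)=0\ (t<0),\qquad b(t)=y_B\,t^{1/\mu}\ (t\ge0).$$ Moreover: 1. The solution is self-similar: for $t<0$, $x\ge 0$ and $y=x/(-t)^\delta$, $$u=-\delta(-t)^{\delta-1}yU(y),\quad h=\delta^2(-t)^{2(\delta-1)}y^2\tfrac{H(y)}{\gamma-1}$$ with some profiles $U\ge0$, $H\ge0$ on $[0,\infty)$; for $t>0$, $x\ge b(t)$, $x\neq0$ and $y=x/t^\delta$, $$u=\delta t^{\delta-1}yU(y),\quad h=\delta^2t^{2(\delta-1)}y^2\tfrac{H(y)}{\gamma-1}$$ with some (other) profiles satisfying $H\ge0$, $U>0$ for $y_B\le y<0$, $U<0$ for $y>0$, and $H=(U-1)^2$ at $y=y_D$ (so $x=y_Dt^\delta$ is a sonic curve). 2. $\rho$ and $u$ are smooth in the regions $\{x>0,\ t\in\mathbb R\}$, $\{x>y_Dt^\delta,\ t>0\}$ and $\{y_Bt^\delta<x<y_Dt^\delta,\ t>0\}$, where the Euler equations hold classically; they are only Lipschitz across the sonic curve $x=y_Dt^\delta$, $t>0$: each is Lipschitz near every point of the curve, and $\rho_x$ and $u_x$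 have one-sided limits from the two sides that are different (a weak discontinuity). 3. $\rho$ and $u$ are Hölder continuous up to the singular point $(0,0)$: each is Hölder continuous, with some exponent in $(0,1]$, on every bounded part of $\{x\ge b(t)\}$, which contains a neighbourhood of $(0,0)$ in this set. 4. The physical vacuum condition $0<h_x(t,b(t))<\infty$ holds for every $t>0$ (derivative from the fluid side). -/

import Mathlib

open Set Filter Topology MeasureTheory
open scoped NNReal ContDiff

noncomputable section

/-- The `γ`-law `p = A ρ ^ γ`, with the normalization `A γ / (γ - 1) = 1`. -/
def pressure (γ r : ℝ) : ℝ := (γ - 1) / γ * r ^ γ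

/-- The specific enthalpy `h = ρ ^ (γ - 1)`. -/
def enthalpy (γ : ℝ) (ρ : ℝ → ℝ → ℝ) (t x : ℝ) : ℝ := ρ t x ^ (γ - 1)

/-- The space-time region `{(t, x) : b t < x}` occupied by the fluid. Points are `(t, x)`. -/
def fluidDomain (b : ℝ → ℝ) : Set (ℝ × ℝ) := {p | b p.1 < p.2}

/-- The fluid region together with its vacuum boundary. -/
def closedFluidDomain (b : ℝ → ℝ) : Set (ℝ × ℝ) := {p | b p.1 ≤ p.2}

/-- The Euler equations in conservation form, in the weak sense on the moving domain. The test
functions need not vanish on the vacuum boundary. -/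
def WeakEuler (γ : ℝ) (b : ℝ → ℝ) (ρ u : ℝ → ℝ → ℝ) : Prop :=
  ∀ φ : ℝ × ℝ → ℝ, ContDiff ℝ 1 φ → HasCompactSupport φ →
    (∫ p in fluidDomain b,
      (ρ p.1 p.2 * fderiv ℝ φ p (1, 0) + ρ p.1 p.2 * u p.1 p.2 * fderiv ℝ φ p (0, 1))) = 0 ∧
    (∫ p in fluidDomain b,
      (ρ p.1 p.2 * u p.1 p.2 * fderiv ℝ φ p (1, 0) +
        (ρ p.1 p.2 * u p.1 p.2 ^ 2 + pressure γ (ρ p.1 p.2)) * fderiv ℝ φ p (0, 1))) = 0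

/-- The Euler equations in conservation form, pointwise at `(t, x)`. -/
def EulerAt (γ : ℝ) (ρ u : ℝ → ℝ → ℝ) (t x : ℝ) : Prop :=
  deriv (fun s => ρ s x) t + deriv (fun z => ρ t z * u t z) x = 0 ∧
  deriv (fun s => ρ s x * u s x) t +
    deriv (fun z => ρ t z * u t z ^ 2 + pressure γ (ρ t z)) x = 0

/-- `(ρ, u)` solves the vacuum free boundary Euler problem with left vacuum boundary `b` and with
data `(ρ₀, u₀)` at the initial time `-T`. The solution lives for all `t ∈ ℝ`; the values of `ρ` and
`u` outside `{b t ≤ x}` play no role. -/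
structure SolvesVacuumEuler (γ T : ℝ) (ρ₀ u₀ : ℝ → ℝ) (b : ℝ → ℝ) (ρ u : ℝ → ℝ → ℝ) :
    Prop where
  continuousOn_density : ContinuousOn (fun p : ℝ × ℝ => ρ p.1 p.2) (closedFluidDomain b)
  continuousOn_velocity : ContinuousOn (fun p : ℝ × ℝ => u p.1 p.2) (closedFluidDomain b)
  euler : WeakEuler γ b ρ u
  density_pos : ∀ t x, b t < x → 0 < ρ t x
  density_boundary : ∀ t, ρ t (b t) = 0
  kinematic : ∀ t, HasDerivAt b (u t (b t)) t
  initial_boundary : b (-T) = 0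
  initial_density : ∀ x, 0 < x → ρ (-T) x = ρ₀ x
  initial_velocity : ∀ x, 0 < x → u (-T) x = u₀ x
  initial_density_pos : ∀ x, 0 < x → 0 < ρ₀ x
  initial_density_zero : ρ₀ 0 = 0

/-- The boundary `b t = 0` for `t < 0` and `b t = yB t ^ (1 / μ)` for `t ≥ 0`. -/
def waitingBoundary (μ yB t : ℝ) : ℝ := if t < 0 then 0 else yB * t ^ (1 / μ)

/-- Self-similar form for `t < 0` with `y = x / (-t) ^ δ`, and profiles `U, H ≥ 0`. -/
def SelfSimilarBefore (γ δ : ℝ) (ρ u : ℝ → ℝ → ℝ) : Prop :=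
  ∃ U H : ℝ → ℝ, (∀ y, 0 ≤ y → 0 ≤ U y ∧ 0 ≤ H y) ∧
    ∀ t x y, t < 0 → 0 ≤ x → y = x / (-t) ^ δ →
      u t x = -δ * (-t) ^ (δ - 1) * y * U y ∧
      enthalpy γ ρ t x = δ ^ 2 * (-t) ^ (2 * (δ - 1)) * y ^ 2 * (H y / (γ - 1))

/-- Self-similar form for `t > 0` with `y = x / t ^ δ`, with `H ≥ 0`, `U > 0` for `y < 0`, `U < 0`
for `y > 0`, and with `y = yD` a sonic point: `H = (U - 1) ^ 2` there. The profile `U` is infinite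
at `y = 0` (only `y U` and `y ^ 2 H` have limits there), so that the formulas are stated for `x ≠ 0`;
the values at `x = 0` are then given by continuity. -/
def SelfSimilarAfter (γ δ yB yD : ℝ) (ρ u : ℝ → ℝ → ℝ) : Prop :=
  ∃ U H : ℝ → ℝ,
    (∀ y, yB ≤ y → y < 0 → 0 < U y ∧ 0 ≤ H y) ∧ (∀ y, 0 < y → U y < 0 ∧ 0 ≤ H y) ∧
    H yD = (U yD - 1) ^ 2 ∧
    ∀ t x y, 0 < t → yB * t ^ δ ≤ x → x ≠ 0 → y = x / t ^ δ →
      u t x = δ * t ^ (δ - 1) * y * U y ∧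
      enthalpy γ ρ t x = δ ^ 2 * t ^ (2 * (δ - 1)) * y ^ 2 * (H y / (γ - 1))

/-- The three open regions of regularity: `{x > 0}`, the region to the right of the curve
`x = yD t ^ δ`, and the region between the vacuum boundary and this curve. Their union is the fluid
region without the curve. -/
def regionPos : Set (ℝ × ℝ) := {p | 0 < p.2}

def regionRight (δ yD : ℝ) : Set (ℝ × ℝ) := {p | 0 < p.1 ∧ yD * p.1 ^ δ < p.2}

def regionLeft (δ yB yD : ℝ) : Set (ℝ × ℝ) :=
  {p | 0 < p.1 ∧ yB * p.1 ^ δ < p.2 ∧ p.2 < yD * p.1 ^ δ}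

/-- `f` is smooth in each of the three regions. -/
def SmoothInRegions (δ yB yD : ℝ) (f : ℝ → ℝ → ℝ) : Prop :=
  ContDiffOn ℝ ∞ (fun p : ℝ × ℝ => f p.1 p.2) regionPos ∧
  ContDiffOn ℝ ∞ (fun p : ℝ × ℝ => f p.1 p.2) (regionRight δ yD) ∧
  ContDiffOn ℝ ∞ (fun p : ℝ × ℝ => f p.1 p.2) (regionLeft δ yB yD)

/-- `f` is only Lipschitz across the curve `x = yD t ^ δ`, `t > 0` (a weak discontinuity): it is
Lipschitz near each point of the curve, while `∂f/∂x` has different limits from the two sides. -/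
def OnlyLipschitzAcross (δ yB yD : ℝ) (f : ℝ → ℝ → ℝ) : Prop :=
  ∀ t, 0 < t →
    (∃ C : ℝ≥0, ∃ V ∈ 𝓝 ((t, yD * t ^ δ) : ℝ × ℝ),
      LipschitzOnWith C (fun p : ℝ × ℝ => f p.1 p.2) V) ∧
    ∃ l r : ℝ, l ≠ r ∧
      Tendsto (fun p : ℝ × ℝ => deriv (f p.1) p.2)
        (𝓝[regionLeft δ yB yD] ((t, yD * t ^ δ) : ℝ × ℝ)) (𝓝 l) ∧
      Tendsto (fun p : ℝ × ℝ => deriv (f p.1) p.2)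
        (𝓝[regionRight δ yD] ((t, yD * t ^ δ) : ℝ × ℝ)) (𝓝 r)

/-- Hölder continuity on the bounded parts of the closed fluid region, the singular point `(0, 0)`
included, with one exponent. -/
def HolderUpToOrigin (b : ℝ → ℝ) (f : ℝ → ℝ → ℝ) : Prop :=
  ∃ α : ℝ≥0, 0 < α ∧ α ≤ 1 ∧ ∀ R : ℝ, 0 < R → ∃ C : ℝ≥0,
    HolderOnWith C α (fun p : ℝ × ℝ => f p.1 p.2)
      (closedFluidDomain b ∩ Metric.closedBall (0 : ℝ × ℝ) R)

/-- The physical vacuum condition at time `t`: `0 < ∂h/∂x (t, b t) < ∞`, where the derivative is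
taken from the fluid side. -/
def PhysicalVacuumAt (γ : ℝ) (b : ℝ → ℝ) (ρ : ℝ → ℝ → ℝ) (t : ℝ) : Prop :=
  ∃ d : ℝ, 0 < d ∧ HasDerivWithinAt (enthalpy γ ρ t) d (Ici (b t)) (b t)

/-- Expansion of the velocity at the initial time `-T` near the vacuum boundary, with coefficient `c`
of the second term. -/
def InitialExpansion (γ μ T c : ℝ) (u : ℝ → ℝ → ℝ) : Prop :=
  (fun x : ℝ => u (-T) x - (-(2 / ((γ + 1) * T)) * x + c * x ^ (1 / (1 - μ))))
    =o[𝓝[>] (0 : ℝ)] fun x : ℝ => x ^ (1 / (1 - μ))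

end

/-!
The solution is explicit. With `a = (γ + 1) / 4` and the Riemann variables `0 ≤ r ≤ ℓ` for which
`u = -(r + ℓ) / 2` and `h = (γ - 1) / 16 * (ℓ - r) ^ 2`, the Euler equations become the transport
equations `r_t = (a r + (1 - a) ℓ) r_x`, `ℓ_t = (a ℓ + (1 - a) r) ℓ_x`, and vacuum is `r = ℓ`. Put
`q = μ / (1 - μ)`, so that `1 / μ = 1 + 1 / q` and `1 / (1 - μ) = q + 1`.

To the right of the sonic curve, and for all `t < 0`, the flow is a simple wave: `r = 0`, and `ℓ`
solves `K ℓ ^ (q + 1) - a ℓ t = x`, which at `t = -T` is the required expansion of the initial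
velocity when `K = 2 c (a T) ^ (q + 2)`. The condition `d t ≤ K ℓ ^ q`, with a constant `d` for which
the wave has not yet broken, makes this relation coercive in `ℓ`
(`SimpleWaveConstants.coercive`), which gives existence, uniqueness and Hölder continuity up to the
singular point `(0, 0)`.

Between the vacuum boundary and the sonic curve the hodograph transform makes the problem linear:
self-similarity means that `t` is, up to a constant, `ℓ ^ q G (r / ℓ)`, and `G` has to solve a
hypergeometric equation. Its solution which is regular at the vacuum is Euler's integral
`∫ τ ^ (N - 1) (1 - τ) ^ (N - 1) (1 - τ + s τ) ^ q`, `N = a / (2 a - 1)`, whose positivity properties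
are evident (`exists_hodograph_profile`). In the parameter `s = r / ℓ ∈ [0, 1]` the position at time
`1` is strictly decreasing, with a critical point only at the vacuum `s = 1`, and this one is
nondegenerate (`exists_rarefactionParam`). Hence `1 - s` behaves like the square root of the distance
to the boundary: the Riemann variables are Hölder continuous with exponent `1 / 2`, and
`h ∼ (1 - s) ^ 2` is linear, which is the physical vacuum condition. At the sonic point `s = 0` the
constant `d` is chosen so that `ℓ_x` matches the simple wave, whereas `r_x` jumps from a nonzero
value to `0` (`exists_rarefactionProfile`, `exists_riemannFlow`).

The equations hold classically off two curves, and the fields `(ρ, ρ u)` and `(ρ u, ρ u ^ 2 + p)` are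
continuous, homogeneous for the dilations `(t, x) ↦ (s t, s ^ (1 / μ) x)`, and zero at the vacuum. A
continuous homogeneous field `(A, B)` with `A_t + B_x = 0` off these curves has an explicit potential
`ψ`, a multiple of `(1 / μ) x A - t B`, extended by zero. Apart from the half-line `x = 0`, `t ≤ 0`,
where the extended fields vanish, the two curves meet every line parallel to an axis in finitely many
points, so that `ψ_x = A` and `ψ_t = -B` hold everywhere, and the weak form follows by integration
by parts (`integral_homogeneous_eq_zero`).
-/

/-! ### Euler integrals of hypergeometric type -/

/-- The integrand `τ ^ α (1 - τ) ^ β (1 - τ + s τ) ^ p` of Euler's integral. -/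
noncomputable def eulerKernel (α β p s τ : ℝ) : ℝ :=
  τ ^ α * (1 - τ) ^ β * (1 - τ + s * τ) ^ p

/-- Euler's integral `∫₀¹ τ ^ α (1 - τ) ^ β (1 - τ + s τ) ^ p dτ`, a multiple of the hypergeometric
function `₂F₁(-p, α + 1; α + β + 2; 1 - s)`. -/
noncomputable def eulerIntegral (α β p s : ℝ) : ℝ :=
  ∫ τ in Ioo (0 : ℝ) 1, eulerKernel α β p s τ

lemma mixture_pos {s τ : ℝ} (hs : 0 ≤ s) (hτ : τ ∈ Ioo (0 : ℝ) 1) : 0 < 1 - τ + s * τ := by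
  have := mul_nonneg hs hτ.1.le
  linarith [hτ.2]

lemma mixture_pos' {s τ : ℝ} (hs : 0 < s) (hτ : τ ∈ Icc (0 : ℝ) 1) : 0 < 1 - τ + s * τ := by
  rcases hτ.1.eq_or_lt with h | h
  · simp [← h]
  · have := mul_pos hs h
    linarith [hτ.2]

lemma continuousOn_eulerKernel {α β : ℝ} (hα : 0 ≤ α) (hβ : 0 ≤ β) (p : ℝ) :
    ContinuousOn (fun z : ℝ × ℝ => eulerKernel α β p z.1 z.2) (Ioi 0 ×ˢ Icc 0 1) := by
  unfold eulerKernel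
  refine ContinuousOn.mul (ContinuousOn.mul ?_ ?_) ?_
  · exact (Real.continuous_rpow_const hα).comp_continuousOn continuousOn_snd
  · exact (Real.continuous_rpow_const hβ).comp_continuousOn (by fun_prop)
  · refine ContinuousOn.rpow_const (by fun_prop) fun z hz => Or.inl ?_
    exact (mixture_pos' hz.1 hz.2).ne'

lemma continuousOn_eulerKernel_right {α β : ℝ} (hα : 0 ≤ α) (hβ : 0 ≤ β) (p : ℝ) {s : ℝ}
    (hs : 0 < s) : ContinuousOn (eulerKernel α β p s) (Icc 0 1) :=
  (continuousOn_eulerKernel hα hβ p).comp (f := fun τ : ℝ => (s, τ)) (by fun_prop)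
    fun _ hτ => ⟨hs, hτ⟩

lemma measurable_eulerKernel (α β p s : ℝ) : Measurable (eulerKernel α β p s) := by
  unfold eulerKernel
  fun_prop

lemma integrableOn_eulerKernel_of_pos {α β : ℝ} (hα : 0 ≤ α) (hβ : 0 ≤ β) (p : ℝ) {s : ℝ}
    (hs : 0 < s) : IntegrableOn (eulerKernel α β p s) (Ioo 0 1) :=
  ((continuousOn_eulerKernel_right hα hβ p hs).integrableOn_Icc).mono_set Ioo_subset_Icc_self

lemma hasDerivAt_eulerKernel (α β p : ℝ) {s τ : ℝ} (hs : 0 < s) (hτ : τ ∈ Ioo (0 : ℝ) 1) :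
    HasDerivAt (fun s => eulerKernel α β p s τ) (p * eulerKernel (α + 1) β (p - 1) s τ) s := by
  have hX := mixture_pos hs.le hτ
  have h1 : HasDerivAt (fun s : ℝ => 1 - τ + s * τ) τ s := by
    simpa using ((hasDerivAt_id s).mul_const τ).const_add (1 - τ)
  have h2 := (h1.rpow_const (p := p) (Or.inl hX.ne')).const_mul (τ ^ α * (1 - τ) ^ β)
  unfold eulerKernel
  convert! h2 using 1
  rw [Real.rpow_add_one hτ.1.ne']
  ring

lemma hasDerivAt_eulerIntegral {α β : ℝ} (hα : 0 ≤ α) (hβ : 0 ≤ β) (p : ℝ) {s : ℝ}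
    (hs : 0 < s) :
    HasDerivAt (eulerIntegral α β p) (p * eulerIntegral (α + 1) β (p - 1) s) s := by
  have hcpt : IsCompact (Icc (s / 2) (2 * s) ×ˢ Icc (0 : ℝ) 1) := isCompact_Icc.prod isCompact_Icc
  obtain ⟨C, hC⟩ := hcpt.exists_bound_of_continuousOn
    (((continuousOn_eulerKernel (by linarith : 0 ≤ α + 1) hβ (p - 1)).const_smul p).mono
      (fun z hz => ⟨lt_of_lt_of_le (by positivity) hz.1.1, hz.2⟩))
  have hnhds : Icc (s / 2) (2 * s) ∈ 𝓝 s := Icc_mem_nhds (by linarith) (by linarith)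
  have key := hasDerivAt_integral_of_dominated_loc_of_deriv_le
    (μ := volume.restrict (Ioo (0 : ℝ) 1)) (F := eulerKernel α β p)
    (F' := fun s τ => p * eulerKernel (α + 1) β (p - 1) s τ) (x₀ := s) (bound := fun _ => C)
    hnhds (Eventually.of_forall fun s => (measurable_eulerKernel α β p s).aestronglyMeasurable)
    (integrableOn_eulerKernel_of_pos hα hβ p hs)
    ((measurable_eulerKernel _ _ _ _).const_mul p).aestronglyMeasurable
    ((ae_restrict_mem measurableSet_Ioo).mono fun τ hτ s' hs' =>
      hC (s', τ) ⟨hs', Ioo_subset_Icc_self hτ⟩)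
    (integrable_const C)
    ((ae_restrict_mem measurableSet_Ioo).mono fun τ hτ s' hs' =>
      hasDerivAt_eulerKernel α β p (lt_of_lt_of_le (by positivity) hs'.1) hτ)
  have h2 := key.2
  rw [integral_const_mul] at h2
  exact h2

lemma contDiffOn_eulerIntegral {α β : ℝ} (hα : 0 ≤ α) (hβ : 0 ≤ β) (p : ℝ) :
    ContDiffOn ℝ ∞ (eulerIntegral α β p) (Ioi 0) := by
  rw [contDiffOn_infty]
  intro n
  induction n generalizing α p with
  | zero =>
    exact contDiffOn_zero.2 fun s hs =>
      (hasDerivAt_eulerIntegral hα hβ p hs).continuousAt.continuousWithinAt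
  | succ n ih =>
    push_cast
    rw [contDiffOn_succ_iff_deriv_of_isOpen isOpen_Ioi]
    refine ⟨fun s hs => (hasDerivAt_eulerIntegral hα hβ p hs).differentiableAt.differentiableWithinAt,
      by simp, ?_⟩
    refine ((contDiffOn_const (c := p)).mul (ih (by linarith : 0 ≤ α + 1) (p - 1))).congr ?_
    intro s hs
    exact (hasDerivAt_eulerIntegral hα hβ p hs).deriv

/-- A majorant of the kernel which is uniform up to `s = 0`. -/
lemma norm_eulerKernel_le {α β p s τ : ℝ} (hα : 0 ≤ α) (hβ : 0 ≤ β) (hs : s ∈ Icc (0 : ℝ) 1)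
    (hτ : τ ∈ Ioo (0 : ℝ) 1) : ‖eulerKernel α β p s τ‖ ≤ 1 + (1 - τ) ^ (β + p) := by
  have hX := mixture_pos hs.1 hτ
  have h1τ : 0 < 1 - τ := by linarith [hτ.2]
  have hX1 : 1 - τ + s * τ ≤ 1 := by nlinarith [hs.2, hτ.1]
  have hτα : τ ^ α ≤ 1 := Real.rpow_le_one hτ.1.le hτ.2.le hα
  have hτβ : (1 - τ) ^ β ≤ 1 := Real.rpow_le_one h1τ.le (by linarith [hτ.1]) hβ
  have hp0 : 0 < (1 - τ + s * τ) ^ p := Real.rpow_pos_of_pos hX _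
  have ha0 : 0 < τ ^ α := Real.rpow_pos_of_pos hτ.1 _
  have hb0 : 0 < (1 - τ) ^ β := Real.rpow_pos_of_pos h1τ _
  unfold eulerKernel
  rw [Real.norm_of_nonneg (by positivity), Real.rpow_add h1τ]
  have hab : τ ^ α * (1 - τ) ^ β ≤ (1 - τ) ^ β := mul_le_of_le_one_left hb0.le hτα
  have hXp : (1 - τ + s * τ) ^ p ≤ 1 ∨ (1 - τ + s * τ) ^ p ≤ (1 - τ) ^ p := by
    rcases le_total 0 p with hp | hp
    · exact Or.inl (Real.rpow_le_one hX.le hX1 hp)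
    · exact Or.inr (Real.rpow_le_rpow_of_nonpos h1τ (by nlinarith [hs.1, hτ.1]) hp)
  have hpp : 0 < (1 - τ) ^ p := Real.rpow_pos_of_pos h1τ _
  rcases hXp with h | h
  · have : τ ^ α * (1 - τ) ^ β * (1 - τ + s * τ) ^ p ≤ 1 * 1 :=
      mul_le_mul (hab.trans hτβ) h hp0.le zero_le_one
    nlinarith [mul_pos hb0 hpp]
  · have := mul_le_mul hab h hp0.le hb0.le
    linarith

lemma integrableOn_majorant {κ : ℝ} (hκ : -1 < κ) :
    IntegrableOn (fun τ : ℝ => 1 + (1 - τ) ^ κ) (Ioo 0 1) := by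
  have h1 : IntervalIntegrable (fun τ : ℝ => (1 - τ) ^ κ) volume 0 1 := by
    have := (intervalIntegral.intervalIntegrable_rpow' (a := 1) (b := 0) hκ).comp_sub_left 1
    simpa using this
  have h2 : IntervalIntegrable (fun τ : ℝ => 1 + (1 - τ) ^ κ) volume 0 1 :=
    intervalIntegrable_const.add h1
  rw [intervalIntegrable_iff_integrableOn_Ioo_of_le zero_le_one] at h2
  exact h2

lemma integrableOn_eulerKernel {α β p s : ℝ} (hα : 0 ≤ α) (hβ : 0 ≤ β) (hp : -1 < β + p)
    (hs : s ∈ Icc (0 : ℝ) 1) : IntegrableOn (eulerKernel α β p s) (Ioo 0 1) :=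
  Integrable.mono' (integrableOn_majorant hp) (measurable_eulerKernel α β p s).aestronglyMeasurable
    ((ae_restrict_mem measurableSet_Ioo).mono fun _ hτ => norm_eulerKernel_le hα hβ hs hτ)

lemma continuousOn_eulerIntegral {α β p : ℝ} (hα : 0 ≤ α) (hβ : 0 ≤ β) (hp : -1 < β + p) :
    ContinuousOn (eulerIntegral α β p) (Icc 0 1) := by
  intro s hs
  refine continuousWithinAt_of_dominated (bound := fun τ => 1 + (1 - τ) ^ (β + p))
    (Eventually.of_forall fun s => (measurable_eulerKernel α β p s).aestronglyMeasurable)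
    (eventually_mem_nhdsWithin.mono fun s' hs' =>
      (ae_restrict_mem measurableSet_Ioo).mono fun _ hτ => norm_eulerKernel_le hα hβ hs' hτ)
    (integrableOn_majorant hp)
    ((ae_restrict_mem measurableSet_Ioo).mono fun τ hτ => ContinuousAt.continuousWithinAt ?_)
  unfold eulerKernel
  exact continuousAt_const.mul
    (ContinuousAt.rpow_const (by fun_prop) (Or.inl (mixture_pos hs.1 hτ).ne'))

lemma eulerIntegral_pos {α β p s : ℝ} (hα : 0 ≤ α) (hβ : 0 ≤ β) (hp : -1 < β + p)
    (hs : s ∈ Icc (0 : ℝ) 1) : 0 < eulerIntegral α β p s := by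
  have hint := integrableOn_eulerKernel hα hβ hp hs
  have hpos : ∀ τ ∈ Ioo (0 : ℝ) 1, 0 < eulerKernel α β p s τ := fun τ hτ => by
    have h1 : 0 < 1 - τ := by linarith [hτ.2]
    have := mixture_pos hs.1 hτ
    have h3 := hτ.1
    unfold eulerKernel
    positivity
  have := intervalIntegral.intervalIntegral_pos_of_pos_on
    ((intervalIntegrable_iff_integrableOn_Ioo_of_le zero_le_one).2 hint) hpos zero_lt_one
  rwa [intervalIntegral.integral_of_le zero_le_one, integral_Ioc_eq_integral_Ioo] at this

/-- Contiguity relation expressing the derivative of the homogeneous function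
`(r, ℓ) ↦ ℓ ^ p * eulerIntegral α β p (r / ℓ)` in the direction of `ℓ`. -/
lemma eulerIntegral_contiguous {α β p s : ℝ} (hα : 0 ≤ α) (hβ : 0 ≤ β) (hp : 0 < β + p)
    (hs : s ∈ Icc (0 : ℝ) 1) :
    eulerIntegral α β p s - s * eulerIntegral (α + 1) β (p - 1) s =
      eulerIntegral α (β + 1) (p - 1) s := by
  unfold eulerIntegral
  rw [← integral_const_mul, ← integral_sub (integrableOn_eulerKernel hα hβ (by linarith) hs)
    ((integrableOn_eulerKernel (by linarith : 0 ≤ α + 1) hβ (by linarith) hs).const_mul s)]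
  refine setIntegral_congr_fun measurableSet_Ioo fun τ hτ => ?_
  have hX := mixture_pos hs.1 hτ
  have h1τ : 0 < 1 - τ := by linarith [hτ.2]
  have e1 : (1 - τ + s * τ) ^ p = (1 - τ + s * τ) ^ (p - 1) * (1 - τ + s * τ) := by
    rw [← Real.rpow_add_one hX.ne', sub_add_cancel]
  simp only [eulerKernel]
  rw [Real.rpow_add_one hτ.1.ne', Real.rpow_add_one h1τ.ne', e1]
  ring

/-- The hypergeometric equation for Euler's integral: the integrand of the left-hand side is the
derivative of `τ ^ N (1 - τ) ^ N (1 - τ + s τ) ^ (q - 1)`. -/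
lemma eulerIntegral_hypergeometric {N q s : ℝ} (hN : 1 < N) (hs : 0 < s) :
    s * (1 - s) * (q - 1) * eulerIntegral (N + 1) (N - 1) (q - 2) s +
      ((1 - q - N) - s * (1 - q + N)) * eulerIntegral N (N - 1) (q - 1) s +
      N * eulerIntegral (N - 1) (N - 1) q s = 0 := by
  have i1 := (integrableOn_eulerKernel_of_pos (by linarith : 0 ≤ N + 1) (by linarith : 0 ≤ N - 1)
    (q - 2) hs).const_mul (s * (1 - s) * (q - 1))
  have i2 := (integrableOn_eulerKernel_of_pos (by linarith : 0 ≤ N) (by linarith : 0 ≤ N - 1)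
    (q - 1) hs).const_mul ((1 - q - N) - s * (1 - q + N))
  have i3 := (integrableOn_eulerKernel_of_pos (by linarith : 0 ≤ N - 1) (by linarith : 0 ≤ N - 1)
    q hs).const_mul N
  have i12 : IntegrableOn (fun τ => s * (1 - s) * (q - 1) * eulerKernel (N + 1) (N - 1) (q - 2) s τ +
      ((1 - q - N) - s * (1 - q + N)) * eulerKernel N (N - 1) (q - 1) s τ) (Ioo 0 1) := i1.add i2
  unfold eulerIntegral
  rw [← integral_const_mul, ← integral_const_mul, ← integral_const_mul, ← integral_add i1 i2,
    ← integral_add i12 i3, ← integral_Ioc_eq_integral_Ioo,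
    ← intervalIntegral.integral_of_le zero_le_one]
  have hcont : ContinuousOn (eulerKernel N N (q - 1) s) (Icc 0 1) :=
    continuousOn_eulerKernel_right (by linarith) (by linarith) _ hs
  rw [intervalIntegral.integral_eq_sub_of_hasDerivAt_of_le zero_le_one hcont]
  · simp [eulerKernel, Real.zero_rpow (by linarith : N ≠ 0)]
  · intro τ hτ
    have hX := mixture_pos hs.le hτ
    have h1τ : 0 < 1 - τ := by linarith [hτ.2]
    have d1 : HasDerivAt (fun τ : ℝ => τ ^ N) (N * τ ^ (N - 1)) τ := by
      simpa using (hasDerivAt_id τ).rpow_const (p := N) (Or.inl hτ.1.ne')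
    have d2 : HasDerivAt (fun τ : ℝ => (1 - τ) ^ N) (-1 * N * (1 - τ) ^ (N - 1)) τ := by
      simpa using ((hasDerivAt_id τ).const_sub 1).rpow_const (p := N) (Or.inl h1τ.ne')
    have d3 : HasDerivAt (fun τ : ℝ => (1 - τ + s * τ) ^ (q - 1))
        ((-1 + s) * (q - 1) * (1 - τ + s * τ) ^ (q - 1 - 1)) τ := by
      have : HasDerivAt (fun τ : ℝ => 1 - τ + s * τ) (-1 + s) τ := by
        simpa using ((hasDerivAt_id τ).const_sub 1).fun_add ((hasDerivAt_id τ).const_mul s)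
      exact this.rpow_const (Or.inl hX.ne')
    have d := (d1.mul d2).mul d3
    simp only [eulerKernel]
    convert! d using 1
    have e1 : τ ^ N = τ ^ (N - 1) * τ := by rw [← Real.rpow_add_one hτ.1.ne', sub_add_cancel]
    have e2 : (1 - τ) ^ N = (1 - τ) ^ (N - 1) * (1 - τ) := by
      rw [← Real.rpow_add_one h1τ.ne', sub_add_cancel]
    have e3 : (1 - τ + s * τ) ^ (q - 1) = (1 - τ + s * τ) ^ (q - 2) * (1 - τ + s * τ) := by
      rw [← Real.rpow_add_one hX.ne']; congr 1; ring
    have e4 : (1 - τ + s * τ) ^ q = (1 - τ + s * τ) ^ (q - 1) * (1 - τ + s * τ) := by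
      rw [← Real.rpow_add_one hX.ne', sub_add_cancel]
    have e5 : q - 1 - 1 = q - 2 := by ring
    simp only [Pi.mul_apply]
    rw [Real.rpow_add_one hτ.1.ne', e4, e3, e1, e2, e5]
    ring
  · rw [intervalIntegrable_iff_integrableOn_Ioo_of_le zero_le_one]
    exact i12.add i3

/-- Existence of the hodograph profile: in the hodograph plane the time is `ℓ ^ q G (r / ℓ)`, up to
a constant, where `G` is the solution of the hypergeometric equation which is regular at the vacuum
`r = ℓ`. The last clause is that equation, written as `∂x/∂r = λ₋ ∂t/∂r`. -/
theorem exists_hodograph_profile {a q : ℝ} (ha : 1 / 2 < a) (ha1 : a < 1) (hq : 0 < q) :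
    ∃ G G' : ℝ → ℝ, G 0 = 1 ∧ ContinuousOn G (Icc 0 1) ∧ ContinuousOn G' (Icc 0 1) ∧
      (∀ s ∈ Icc (0 : ℝ) 1, 0 < G s ∧ 0 < G' s ∧ 0 < G s - s * G' s / q) ∧
      ContDiffOn ℝ ∞ G (Ioo 0 1) ∧
      (∀ s ∈ Ioo (0 : ℝ) 1, HasDerivAt G (G' s) s) ∧
      ∀ s ∈ Ioo (0 : ℝ) 1,
        HasDerivAt (fun s => (a * s + 1 - a) * q * G s + (2 * a - 1) * (1 - s) * s * G' s)
          ((q + 1) * (a + (1 - a) * s) * G' s) s := by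
  have h2a : 0 < 2 * a - 1 := by linarith
  obtain ⟨N, hNdef⟩ : ∃ N, N = a / (2 * a - 1) := ⟨_, rfl⟩
  have hN : 1 < N := by rw [hNdef, lt_div_iff₀ h2a]; linarith
  have hNa : N * (2 * a - 1) = a := by rw [hNdef, div_mul_cancel₀ _ h2a.ne']
  have hN1 : 0 ≤ N - 1 := by linarith
  have hNp : 0 ≤ N := by linarith
  have h01 : (0 : ℝ) ∈ Icc (0 : ℝ) 1 := ⟨le_rfl, zero_le_one⟩
  set f := eulerIntegral (N - 1) (N - 1) q with hf
  set f' := fun s => q * eulerIntegral N (N - 1) (q - 1) s with hf'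
  have hf0 : 0 < f 0 := eulerIntegral_pos hN1 hN1 (by linarith) h01
  have hd : ∀ s, 0 < s → HasDerivAt f (f' s) s := fun s hs => by
    have := hasDerivAt_eulerIntegral hN1 hN1 q hs
    rwa [sub_add_cancel] at this
  have hd' : ∀ s, 0 < s →
      HasDerivAt f' (q * ((q - 1) * eulerIntegral (N + 1) (N - 1) (q - 2) s)) s := fun s hs => by
    have := (hasDerivAt_eulerIntegral hNp hN1 (q - 1) hs).const_mul q
    rwa [show q - 1 - 1 = q - 2 by ring] at this
  refine ⟨fun s => f s / f 0, fun s => f' s / f 0, div_self hf0.ne',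
    (continuousOn_eulerIntegral hN1 hN1 (by linarith)).div_const _,
    ((continuousOn_eulerIntegral hNp hN1 (by linarith)).const_smul q).div_const _, ?_,
    ((contDiffOn_eulerIntegral hN1 hN1 q).mono Ioo_subset_Ioi_self).div_const _,
    fun s hs => (hd s hs.1).div_const _, ?_⟩
  · intro s hs
    refine ⟨div_pos (eulerIntegral_pos hN1 hN1 (by linarith) hs) hf0,
      div_pos (mul_pos hq (eulerIntegral_pos hNp hN1 (by linarith) hs)) hf0, ?_⟩
    have h1 := eulerIntegral_contiguous hN1 hN1 (p := q) (by linarith) hs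
    rw [sub_add_cancel] at h1
    have h2 : f s / f 0 - s * (f' s / f 0) / q =
        eulerIntegral (N - 1) N (q - 1) s / f 0 := by
      rw [← h1]; simp only [hf', hf]; field_simp
    rw [h2]
    exact div_pos (eulerIntegral_pos hN1 hNp (by linarith) hs) hf0
  · intro s hs
    have hode := eulerIntegral_hypergeometric (q := q) hN hs.1
    have h1 : HasDerivAt (fun s : ℝ => (a * s + 1 - a) * q) (a * q) s := by
      have := ((((hasDerivAt_id s).const_mul a).add_const 1).sub_const a).mul_const q
      simpa using this
    have h2 : HasDerivAt (fun s : ℝ => (2 * a - 1) * (1 - s) * s)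
        ((2 * a - 1) * (-1) * s + (2 * a - 1) * (1 - s)) s := by
      have := (((hasDerivAt_id s).const_sub 1).const_mul (2 * a - 1)).fun_mul (hasDerivAt_id s)
      simpa using this
    have h3 := (h1.mul ((hd s hs.1).div_const (f 0))).add
      (h2.mul ((hd' s hs.1).div_const (f 0)))
    convert! h3 using 1
    simp only [hf']
    have hode' : (2 * a - 1) * (s * (1 - s) * (q - 1) *
        eulerIntegral (N + 1) (N - 1) (q - 2) s +
      ((1 - q - N) - s * (1 - q + N)) * eulerIntegral N (N - 1) (q - 1) s) + a * f s = 0 := by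
      have := congrArg (fun z => (2 * a - 1) * z) hode
      simp only [mul_zero] at this
      rw [← this, hf]
      linear_combination (-eulerIntegral (N - 1) (N - 1) q s) * hNa
    field_simp
    linear_combination -hode' - (1 + s) * eulerIntegral N (N - 1) (q - 1) s * hNa

/-! ### Calculus lemmas -/

/-- A left inverse of a smooth map is smooth at the image of each point at which the derivative of
the map is invertible. -/
lemma ContDiffAt.leftInverse {E F : Type*} [NormedAddCommGroup E] [NormedSpace ℝ E]
    [CompleteSpace E] [NormedAddCommGroup F] [NormedSpace ℝ F] {f : E → F} {g : F → E}
    {e : E ≃L[ℝ] F} {x : E} (hf : ContDiffAt ℝ ∞ f x) (hf' : HasFDerivAt f (e : E →L[ℝ] F) x)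
    (hg : ∀ᶠ z in 𝓝 x, g (f z) = z) : ContDiffAt ℝ ∞ g (f x) := by
  have hn : (∞ : WithTop ℕ∞) ≠ 0 := by simp
  set φ := hf.toOpenPartialHomeomorph f hf' hn with hφ
  have hx : x ∈ φ.source := hf.mem_toOpenPartialHomeomorph_source hf' hn
  have hφf : (φ : E → F) = f := rfl
  have hfx : f x ∈ φ.target := φ.map_source hx
  have hsymm : φ.symm (f x) = x := φ.left_inv hx
  refine (hf.to_localInverse hf' hn).congr_of_eventuallyEq ?_
  have h1 : Tendsto φ.symm (𝓝 (f x)) (𝓝 x) := by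
    have := φ.continuousAt_symm hfx
    rwa [ContinuousAt, hsymm] at this
  filter_upwards [h1.eventually hg, φ.open_target.mem_nhds hfx] with y hy hyt
  have : f (φ.symm y) = y := φ.right_inv hyt
  rw [this] at hy
  exact hy

lemma abs_sub_le_of_abs_deriv_le {f f' : ℝ → ℝ} {p q M : ℝ} (hf : ContinuousOn f (Icc p q))
    (hd : ∀ x ∈ Ioo p q, HasDerivAt f (f' x) x) (hM : ∀ x ∈ Ioo p q, |f' x| ≤ M) {x y : ℝ}
    (hx : x ∈ Icc p q) (hy : y ∈ Icc p q) : |f x - f y| ≤ M * |x - y| := by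
  wlog hxy : x < y generalizing x y
  · rcases (not_lt.1 hxy).eq_or_lt with h | h
    · simp [h]
    · rw [abs_sub_comm, abs_sub_comm x]
      exact this hy hx h
  have hsub : Ioo x y ⊆ Ioo p q := Ioo_subset_Ioo hx.1 hy.2
  obtain ⟨z, hz, hz'⟩ := exists_hasDerivAt_eq_slope f f' hxy
    (hf.mono (Icc_subset_Icc hx.1 hy.2)) fun z hz => hd z (hsub hz)
  have hyx : 0 < y - x := sub_pos.2 hxy
  have : f y - f x = f' z * (y - x) := by rw [hz']; field_simp
  rw [abs_sub_comm, this, abs_mul, abs_sub_comm x]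
  exact mul_le_mul_of_nonneg_right (hM z (hsub hz)) (abs_nonneg _)

lemma exists_lipschitz_of_deriv {f f' : ℝ → ℝ} {p q : ℝ} (hf : ContinuousOn f (Icc p q))
    (hd : ∀ x ∈ Ioo p q, HasDerivAt f (f' x) x) (hf' : ContinuousOn f' (Icc p q)) :
    ∃ M : ℝ, 0 ≤ M ∧ ∀ x ∈ Icc p q, ∀ y ∈ Icc p q, |f x - f y| ≤ M * |x - y| := by
  obtain ⟨M, hM⟩ := isCompact_Icc.exists_bound_of_continuousOn hf'
  refine ⟨max M 0, le_max_right _ _, fun x hx y hy => abs_sub_le_of_abs_deriv_le hf hd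
    (fun z hz => (hM z (Ioo_subset_Icc_self hz)).trans (le_max_left _ _)) hx hy⟩

/-! ### The flow between the vacuum boundary and the sonic curve -/

/-- The flow between the vacuum boundary and the sonic curve at time `1`, parametrized by the
quotient `s = r / ℓ ∈ [0, 1]` of the Riemann variables: the variable `ℓ = e s` and the position
`x = Y s`. The vacuum is at `s = 1`, where `Y' = -(1 - s) D` has a simple zero, and the sonic curve at
`s = 0`. The identities `charL` and `charR` are the transport equations of the Riemann variables. -/
structure IsRarefactionParam (a q ℓ₀ : ℝ) (e e' Y D : ℝ → ℝ) : Prop where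
  cont_e : ContinuousOn e (Icc 0 1)
  cont_e' : ContinuousOn e' (Icc 0 1)
  cont_Y : ContinuousOn Y (Icc 0 1)
  cont_D : ContinuousOn D (Icc 0 1)
  e_pos : ∀ s ∈ Icc (0 : ℝ) 1, 0 < e s
  D_pos : ∀ s ∈ Icc (0 : ℝ) 1, 0 < D s
  deriv_e : ∀ s ∈ Ioo (0 : ℝ) 1, HasDerivAt e (e' s) s
  deriv_Y : ∀ s ∈ Ioo (0 : ℝ) 1, HasDerivAt Y (-((1 - s) * D s)) s
  smooth_e : ContDiffOn ℝ ∞ e (Ioo 0 1)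
  smooth_Y : ContDiffOn ℝ ∞ Y (Ioo 0 1)
  charL : ∀ s ∈ Ioo (0 : ℝ) 1,
    e s / q * -((1 - s) * D s) = e' s * (a * e s + (1 - a) * (s * e s) + (1 + 1 / q) * Y s)
  charR : ∀ s ∈ Ioo (0 : ℝ) 1,
    s * e s / q * -((1 - s) * D s) =
      (e s + s * e' s) * (a * (s * e s) + (1 - a) * e s + (1 + 1 / q) * Y s)
  e_zero : e 0 = ℓ₀
  Y_zero : (1 + 1 / q) * Y 0 = -((1 - a) * ℓ₀)
  Y_one : (1 + 1 / q) * Y 1 = -e 1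
  slope_zero : e' 0 / -D 0 = 1 / (q * (2 * a - 1))

/-- The parametrization is `e = ℓ₀ G ^ (-1 / q)`, with `G` the hodograph profile; the position follows
from the equation of the characteristics. -/
theorem exists_rarefactionParam {a q ℓ₀ : ℝ} (ha : 1 / 2 < a) (ha1 : a < 1) (hq : 0 < q)
    (hℓ₀ : 0 < ℓ₀) : ∃ e e' Y D : ℝ → ℝ, IsRarefactionParam a q ℓ₀ e e' Y D := by
  obtain ⟨G, G', hG0, hGc, hG'c, hpos, hGs, hGd, hode⟩ := exists_hodograph_profile ha ha1 hq
  have h2a : 0 < 2 * a - 1 := by linarith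
  have h01 : (0 : ℝ) ∈ Icc (0 : ℝ) 1 := ⟨le_rfl, zero_le_one⟩
  have h11 : (1 : ℝ) ∈ Icc (0 : ℝ) 1 := ⟨zero_le_one, le_rfl⟩
  have hGne : ∀ s ∈ Icc (0 : ℝ) 1, G s ≠ 0 := fun s hs => (hpos s hs).1.ne'
  obtain ⟨e, he⟩ : ∃ e : ℝ → ℝ, e = fun s => ℓ₀ * G s ^ (-(1 / q)) := ⟨_, rfl⟩
  obtain ⟨X, hX⟩ : ∃ X : ℝ → ℝ,
    X = fun s => (a * s + 1 - a) * q * G s + (2 * a - 1) * (1 - s) * s * G' s := ⟨_, rfl⟩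
  have hec : ContinuousOn e (Icc 0 1) := by
    rw [he]
    exact continuousOn_const.mul (hGc.rpow_const fun s hs => Or.inl (hGne s hs))
  have hXc : ContinuousOn X (Icc 0 1) := by
    rw [hX]
    exact (ContinuousOn.mul (by fun_prop) hGc).add (ContinuousOn.mul (by fun_prop) hG'c)
  have hepos : ∀ s ∈ Icc (0 : ℝ) 1, 0 < e s := fun s hs => by
    rw [he]
    exact mul_pos hℓ₀ (Real.rpow_pos_of_pos (hpos s hs).1 _)
  have hed : ∀ s ∈ Ioo (0 : ℝ) 1, HasDerivAt e (-(e s * G' s / (q * G s))) s := fun s hs => by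
    have h1 := hpos s (Ioo_subset_Icc_self hs)
    have := ((hGd s hs).rpow_const (p := -(1 / q)) (Or.inl h1.1.ne')).const_mul ℓ₀
    rw [he]
    convert! this using 1
    rw [Real.rpow_sub_one h1.1.ne']
    have := h1.1.ne'
    field_simp
  have hes : ContDiffOn ℝ ∞ e (Ioo 0 1) := by
    rw [he]
    exact contDiffOn_const.mul (hGs.rpow_const_of_ne fun s hs => hGne s (Ioo_subset_Icc_self hs))
  have hG's : ContDiffOn ℝ ∞ G' (Ioo 0 1) :=
    ((contDiffOn_infty_iff_deriv_of_isOpen isOpen_Ioo).1 hGs).2.congr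
      fun s hs => (hGd s hs).deriv.symm
  have hXs : ContDiffOn ℝ ∞ X (Ioo 0 1) := by
    rw [hX]
    exact (ContDiffOn.mul (by fun_prop) hGs).add (ContDiffOn.mul (by fun_prop) hG's)
  have hXd : ∀ s ∈ Ioo (0 : ℝ) 1, HasDerivAt X ((q + 1) * (a + (1 - a) * s) * G' s) s := by
    rw [hX]; exact hode
  refine ⟨e, fun s => -(e s * G' s / (q * G s)), fun s => -(e s * X s / ((q + 1) * G s)),
    fun s => (2 * a - 1) * (e s / G s ^ 2) * G' s * (G s - s * G' s / q), ?_⟩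
  have hq1 : q + 1 ≠ 0 := by positivity
  constructor
  · exact hec
  · exact ((hec.mul hG'c).div (continuousOn_const.mul hGc)
      fun s hs => mul_ne_zero hq.ne' (hGne s hs)).neg
  · exact ((hec.mul hXc).div (continuousOn_const.mul hGc)
      fun s hs => mul_ne_zero hq1 (hGne s hs)).neg
  · exact ((continuousOn_const.mul (hec.div (hGc.pow 2) fun s hs => pow_ne_zero _ (hGne s hs))).mul
      hG'c).mul (hGc.sub ((continuousOn_id.mul hG'c).div_const q))
  · exact hepos
  · intro s hs
    have h1 := hpos s hs
    have h2 := hepos s hs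
    exact mul_pos (mul_pos (mul_pos h2a (div_pos h2 (pow_pos h1.1 2))) h1.2.1) h1.2.2
  · exact hed
  · intro s hs
    have h1 := (hpos s (Ioo_subset_Icc_self hs)).1.ne'
    have := (((hed s hs).mul (hXd s hs)).div ((hGd s hs).const_mul (q + 1))
      (mul_ne_zero hq1 h1)).neg
    convert! this using 1
    simp only [Pi.mul_apply, hX]
    field_simp
    ring
  · exact hes
  · exact ((hes.mul hXs).div (contDiffOn_const.mul hGs)
      fun s hs => mul_ne_zero hq1 (hGne s (Ioo_subset_Icc_self hs))).neg
  · intro s hs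
    have h1 := (hpos s (Ioo_subset_Icc_self hs)).1.ne'
    simp only [hX]
    field_simp
    ring
  · intro s hs
    have h1 := (hpos s (Ioo_subset_Icc_self hs)).1.ne'
    simp only [hX]
    field_simp
    ring
  · simp [he, hG0]
  · simp only [he, hX, hG0]
    field_simp
    simp
  · have := hGne 1 h11
    simp only [hX]
    field_simp
    ring
  · have h1 := hepos 0 h01
    have h2 := (hpos 0 h01).2.1
    simp only [hG0]
    field_simp
    simp [hq.ne']

/-- The flow between the vacuum boundary and the sonic curve at time `1`, in terms of the position
`y ∈ [yB, yD]`: the Riemann variables `r ≤ ℓ`. They satisfy the self-similar transport equations,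
`ℓ₀` is the value of `ℓ` at the sonic point, and `charL_limit` says that the one-sided derivative of
`ℓ` there is that of the simple wave on the other side, while `r` has a kink. -/
structure IsRarefactionProfile (a q ℓ₀ yB yD : ℝ) (r ℓ : ℝ → ℝ) : Prop where
  lt : yB < yD
  sonic : (1 + 1 / q) * yD = -((1 - a) * ℓ₀)
  r_sonic : r yD = 0
  l_sonic : ℓ yD = ℓ₀
  vacuum : r yB = ℓ yB
  kinematic : (1 + 1 / q) * yB = -ℓ yB
  l_pos : ∀ y ∈ Icc yB yD, 0 < ℓ y
  r_nonneg : ∀ y ∈ Icc yB yD, 0 ≤ r y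
  r_lt : ∀ y ∈ Ioc yB yD, r y < ℓ y
  smooth_r : ContDiffOn ℝ ∞ r (Ioo yB yD)
  smooth_l : ContDiffOn ℝ ∞ ℓ (Ioo yB yD)
  charR : ∀ y ∈ Ioo yB yD, deriv r y * (a * r y + (1 - a) * ℓ y + (1 + 1 / q) * y) = r y / q
  charL : ∀ y ∈ Ioo yB yD, deriv ℓ y * (a * ℓ y + (1 - a) * r y + (1 + 1 / q) * y) = ℓ y / q
  charR_limit : ∃ κ < 0, Tendsto (deriv r) (𝓝[<] yD) (𝓝 κ)
  charL_limit : Tendsto (deriv ℓ) (𝓝[<] yD) (𝓝 (1 / (q * (2 * a - 1))))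
  holder : ∃ C : ℝ, 0 ≤ C ∧ ∀ y ∈ Icc yB yD, ∀ z ∈ Icc yB yD,
    |r y - r z| ≤ C * √|y - z| ∧ |ℓ y - ℓ z| ≤ C * √|y - z|
  physical : ∃ κ > 0, HasDerivWithinAt (fun y => (ℓ y - r y) ^ 2) κ (Ici yB) yB

lemma IsRarefactionParam.sq_le {a q ℓ₀ : ℝ} {e e' Y D : ℝ → ℝ}
    (h : IsRarefactionParam a q ℓ₀ e e' Y D) : ∃ c > 0, ∀ s₁ ∈ Icc (0 : ℝ) 1,
      ∀ s₂ ∈ Icc (0 : ℝ) 1, s₁ ≤ s₂ → c * (s₂ - s₁) ^ 2 ≤ Y s₁ - Y s₂ := by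
  obtain ⟨s₀, hs₀, hmin⟩ := isCompact_Icc.exists_isMinOn (nonempty_Icc.2 zero_le_one) h.cont_D
  have hc := h.D_pos s₀ hs₀
  refine ⟨D s₀ / 2, by positivity, fun s₁ h₁ s₂ h₂ h12 => ?_⟩
  have hanti : AntitoneOn (fun s => Y s - D s₀ / 2 * (1 - s) ^ 2) (Icc 0 1) := by
    have hder : ∀ s ∈ Ioo (0 : ℝ) 1, HasDerivAt (fun s => Y s - D s₀ / 2 * (1 - s) ^ 2)
        (-((1 - s) * (D s - D s₀))) s := fun s hs => by
      have h1 : HasDerivAt (fun s : ℝ => (1 - s) ^ 2) (2 * (1 - s) * (-1)) s := by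
        simpa using ((hasDerivAt_id s).const_sub 1).fun_pow 2
      convert! (h.deriv_Y s hs).sub (h1.const_mul (D s₀ / 2)) using 1
      ring
    refine antitoneOn_of_deriv_nonpos (convex_Icc 0 1)
      (h.cont_Y.sub (by fun_prop)) ?_ ?_
    · rw [interior_Icc]
      exact fun s hs => (hder s hs).differentiableAt.differentiableWithinAt
    · rw [interior_Icc]
      intro s hs
      rw [(hder s hs).deriv]
      have : D s₀ ≤ D s := hmin (Ioo_subset_Icc_self hs)
      nlinarith [hs.2]
  have := hanti h₁ h₂ h12
  simp only at this
  nlinarith [mul_nonneg hc.le (mul_nonneg (sub_nonneg.2 h12) (sub_nonneg.2 h₂.2))]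

theorem IsRarefactionParam.exists_profile {a q ℓ₀ : ℝ} {e e' Y D : ℝ → ℝ}
    (h : IsRarefactionParam a q ℓ₀ e e' Y D) :
    ∃ (yB yD : ℝ) (r ℓ : ℝ → ℝ), IsRarefactionProfile a q ℓ₀ yB yD r ℓ := by
  have h01 : (0 : ℝ) ∈ Icc (0 : ℝ) 1 := ⟨le_rfl, zero_le_one⟩
  have h11 : (1 : ℝ) ∈ Icc (0 : ℝ) 1 := ⟨zero_le_one, le_rfl⟩
  obtain ⟨c, hc, hsq⟩ := h.sq_le
  have hanti : StrictAntiOn Y (Icc 0 1) := fun s₁ h₁ s₂ h₂ h12 => by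
    have := hsq s₁ h₁ s₂ h₂ h12.le
    have : 0 < c * (s₂ - s₁) ^ 2 := mul_pos hc (pow_pos (sub_pos.2 h12) 2)
    linarith
  have hsurj : ∀ y, ∃ s, y ∈ Icc (Y 1) (Y 0) → s ∈ Icc (0 : ℝ) 1 ∧ Y s = y := fun y => by
    by_cases hy : y ∈ Icc (Y 1) (Y 0)
    · obtain ⟨s, hs, hs'⟩ := intermediate_value_Icc' zero_le_one h.cont_Y hy
      exact ⟨s, fun _ => ⟨hs, hs'⟩⟩
    · exact ⟨0, fun hy' => absurd hy' hy⟩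
  choose S hS using hsurj
  have hlt : Y 1 < Y 0 := hanti h01 h11 zero_lt_one
  have hmem : ∀ s ∈ Icc (0 : ℝ) 1, Y s ∈ Icc (Y 1) (Y 0) := fun s hs =>
    ⟨hanti.antitoneOn hs h11 hs.2, hanti.antitoneOn h01 hs hs.1⟩
  have hSY : ∀ s ∈ Icc (0 : ℝ) 1, S (Y s) = s := fun s hs =>
    hanti.injOn (hS _ (hmem s hs)).1 hs (hS _ (hmem s hs)).2
  have hSo : ∀ y ∈ Ioo (Y 1) (Y 0), S y ∈ Ioo (0 : ℝ) 1 := fun y hy => by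
    obtain ⟨h1, h2⟩ := hS y (Ioo_subset_Icc_self hy)
    refine ⟨lt_of_le_of_ne h1.1 fun h0 => ?_, lt_of_le_of_ne h1.2 fun h0 => ?_⟩
    · rw [← h0] at h2; exact hy.2.ne h2.symm
    · rw [h0] at h2; exact hy.1.ne h2
  have hS0 : S (Y 0) = 0 := hSY 0 h01
  have hS1 : S (Y 1) = 1 := hSY 1 h11
  have hShol : ∀ y ∈ Icc (Y 1) (Y 0), ∀ z ∈ Icc (Y 1) (Y 0),
      |S y - S z| ≤ (√c)⁻¹ * √|y - z| := by
    intro y hy z hz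
    wlog hyz : S y ≤ S z generalizing y z
    · rw [abs_sub_comm, abs_sub_comm y]
      exact this z hz y hy (le_of_not_ge hyz)
    have h1 := hsq _ (hS y hy).1 _ (hS z hz).1 hyz
    rw [(hS y hy).2, (hS z hz).2] at h1
    rw [← div_eq_inv_mul, le_div_iff₀ (Real.sqrt_pos.2 hc), mul_comm]
    refine Real.le_sqrt_of_sq_le ?_
    rw [mul_pow, Real.sq_sqrt hc.le, sq_abs]
    have := le_abs_self (y - z)
    nlinarith
  have hScont : ContinuousOn S (Icc (Y 1) (Y 0)) := by
    intro y hy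
    rw [ContinuousWithinAt, tendsto_iff_dist_tendsto_zero]
    have hlim : Tendsto (fun z => (√c)⁻¹ * √|z - y|) (𝓝[Icc (Y 1) (Y 0)] y) (𝓝 0) := by
      have : Continuous fun z => (√c)⁻¹ * √|z - y| := by fun_prop
      have h2 := (this.tendsto y).mono_left (nhdsWithin_le_nhds (s := Icc (Y 1) (Y 0)))
      simpa using h2
    refine squeeze_zero' (Eventually.of_forall fun _ => dist_nonneg) ?_ hlim
    filter_upwards [self_mem_nhdsWithin] with z hz
    exact hShol z hz y hy
  have hYne : ∀ s ∈ Ioo (0 : ℝ) 1, -((1 - s) * D s) ≠ 0 := fun s hs =>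
    neg_ne_zero.2 (mul_pos (sub_pos.2 hs.2) (h.D_pos s (Ioo_subset_Icc_self hs))).ne'
  have hSd : ∀ y ∈ Ioo (Y 1) (Y 0), HasDerivAt S (-((1 - S y) * D (S y)))⁻¹ y := fun y hy => by
    refine HasDerivAt.of_local_left_inverse
      ((hScont y (Ioo_subset_Icc_self hy)).continuousAt (Icc_mem_nhds hy.1 hy.2))
      (h.deriv_Y _ (hSo y hy)) (hYne _ (hSo y hy)) ?_
    filter_upwards [Icc_mem_nhds hy.1 hy.2] with z hz using (hS z hz).2
  have hSs : ContDiffOn ℝ ∞ S (Ioo (Y 1) (Y 0)) := fun y hy => by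
    refine ContDiffAt.contDiffWithinAt ?_
    have hs := hSo y hy
    have := ContDiffAt.leftInverse (g := S) (h.smooth_Y.contDiffAt (Ioo_mem_nhds hs.1 hs.2))
      ((h.deriv_Y _ hs).hasFDerivAt_equiv (hYne _ hs))
      (by filter_upwards [Icc_mem_nhds hs.1 hs.2] with z hz using hSY z hz)
    rwa [(hS y (Ioo_subset_Icc_self hy)).2] at this
  have hled : ∀ y ∈ Ioo (Y 1) (Y 0), HasDerivAt (fun y => e (S y))
      (e' (S y) * (-((1 - S y) * D (S y)))⁻¹) y := fun y hy =>
    (h.deriv_e _ (hSo y hy)).comp y (hSd y hy)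
  have hred : ∀ y ∈ Ioo (Y 1) (Y 0), HasDerivAt (fun y => S y * e (S y))
      ((e (S y) + S y * e' (S y)) * (-((1 - S y) * D (S y)))⁻¹) y := fun y hy => by
    convert! (hSd y hy).mul (hled y hy) using 1
    ring
  have hmaps : MapsTo S (Icc (Y 1) (Y 0)) (Icc 0 1) := fun y hy => (hS y hy).1
  have hecont : ContinuousOn (fun y => e (S y)) (Icc (Y 1) (Y 0)) := h.cont_e.comp hScont hmaps
  have hyD : Y 0 ∈ Icc (Y 1) (Y 0) := ⟨hlt.le, le_rfl⟩
  have hyB : Y 1 ∈ Icc (Y 1) (Y 0) := ⟨le_rfl, hlt.le⟩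
  -- composition with `S` transports limits at the two endpoints
  have hlimD : ∀ f : ℝ → ℝ, ContinuousOn f (Icc 0 1) →
      Tendsto (fun y => f (S y)) (𝓝[<] (Y 0)) (𝓝 (f 0)) := fun f hf => by
    have h1 := (hf.comp hScont hmaps) _ hyD
    have h2 : Tendsto (f ∘ S) (𝓝[Ioo (Y 1) (Y 0)] (Y 0)) (𝓝 (f (S (Y 0)))) :=
      h1.mono_left (nhdsWithin_mono _ Ioo_subset_Icc_self)
    rwa [nhdsWithin_Ioo_eq_nhdsLT hlt, hS0] at h2
  have hlimB : ∀ f : ℝ → ℝ, ContinuousOn f (Icc 0 1) →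
      Tendsto (fun y => f (S y)) (𝓝[>] (Y 1)) (𝓝 (f 1)) := fun f hf => by
    have h1 := (hf.comp hScont hmaps) _ hyB
    have h2 : Tendsto (f ∘ S) (𝓝[Ioo (Y 1) (Y 0)] (Y 1)) (𝓝 (f (S (Y 1)))) :=
      h1.mono_left (nhdsWithin_mono _ Ioo_subset_Icc_self)
    rwa [nhdsWithin_Ioo_eq_nhdsGT hlt, hS1] at h2
  have hD0 := h.D_pos 0 h01
  have hD1 := h.D_pos 1 h11
  have he1 := h.e_pos 1 h11
  refine ⟨Y 1, Y 0, fun y => S y * e (S y), fun y => e (S y), ?_⟩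
  constructor
  · exact hlt
  · exact h.Y_zero
  · simp [hS0]
  · simp [hS0, h.e_zero]
  · simp [hS1]
  · simpa only [hS1] using h.Y_one
  · exact fun y hy => h.e_pos _ (hmaps hy)
  · exact fun y hy => mul_nonneg (hmaps hy).1 (h.e_pos _ (hmaps hy)).le
  · intro y hy
    have hy' := Ioc_subset_Icc_self hy
    have : S y < 1 := lt_of_le_of_ne (hmaps hy').2 fun h1 => by
      have := (hS y hy').2
      rw [h1] at this
      exact hy.1.ne this
    have := h.e_pos _ (hmaps hy')
    nlinarith
  · exact hSs.mul (h.smooth_e.comp hSs hSo)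
  · exact h.smooth_e.comp hSs hSo
  · intro y hy
    rw [(hred y hy).deriv]
    have h1 := h.charR _ (hSo y hy)
    rw [(hS y (Ioo_subset_Icc_self hy)).2] at h1
    rw [mul_right_comm, ← h1, mul_assoc, mul_inv_cancel₀ (hYne _ (hSo y hy)), mul_one]
  · intro y hy
    rw [(hled y hy).deriv]
    have h1 := h.charL _ (hSo y hy)
    rw [(hS y (Ioo_subset_Icc_self hy)).2] at h1
    rw [mul_right_comm, ← h1, mul_assoc, mul_inv_cancel₀ (hYne _ (hSo y hy)), mul_one]
  · refine ⟨e 0 * (-D 0)⁻¹, mul_neg_of_pos_of_neg (h.e_pos 0 h01) (inv_lt_zero.2 (by linarith)), ?_⟩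
    have h1 : Tendsto (fun y => (e (S y) + S y * e' (S y)) * (-((1 - S y) * D (S y)))⁻¹)
        (𝓝[<] (Y 0)) (𝓝 ((e 0 + 0 * e' 0) * (-((1 - 0) * D 0))⁻¹)) := by
      have hS' := hlimD id continuousOn_id
      refine ((hlimD e h.cont_e).add (hS'.mul (hlimD e' h.cont_e'))).mul
        (Tendsto.inv₀ (((hS'.const_sub 1).mul (hlimD D h.cont_D)).neg) ?_)
      simp only [sub_zero, one_mul]
      exact neg_ne_zero.2 hD0.ne'
    simp only [zero_mul, add_zero, sub_zero, one_mul] at h1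
    refine h1.congr' ?_
    filter_upwards [Ioo_mem_nhdsLT hlt] with y hy using (hred y hy).deriv.symm
  · have h1 : Tendsto (fun y => e' (S y) * (-((1 - S y) * D (S y)))⁻¹)
        (𝓝[<] (Y 0)) (𝓝 (e' 0 * (-((1 - 0) * D 0))⁻¹)) := by
      have hS' := hlimD id continuousOn_id
      refine (hlimD e' h.cont_e').mul
        (Tendsto.inv₀ (((hS'.const_sub 1).mul (hlimD D h.cont_D)).neg) ?_)
      simp only [sub_zero, one_mul]
      exact neg_ne_zero.2 hD0.ne'
    rw [sub_zero, one_mul, ← div_eq_mul_inv, h.slope_zero] at h1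
    refine h1.congr' ?_
    filter_upwards [Ioo_mem_nhdsLT hlt] with y hy using (hled y hy).deriv.symm
  · obtain ⟨M₁, hM₁, hl₁⟩ := exists_lipschitz_of_deriv h.cont_e h.deriv_e h.cont_e'
    obtain ⟨M₂, hM₂, hl₂⟩ := exists_lipschitz_of_deriv (f := fun s => s * e s)
      (f' := fun s => e s + s * e' s) (continuousOn_id.mul h.cont_e)
      (fun s hs => by simpa using (hasDerivAt_id s).fun_mul (h.deriv_e s hs))
      (h.cont_e.add (continuousOn_id.mul h.cont_e'))
    refine ⟨max M₁ M₂ * (√c)⁻¹, by positivity, fun y hy z hz => ⟨?_, ?_⟩⟩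
    · refine (hl₂ _ (hmaps hy) _ (hmaps hz)).trans ?_
      rw [mul_assoc]
      exact mul_le_mul (le_max_right _ _) (hShol y hy z hz) (abs_nonneg _) (by positivity)
    · refine (hl₁ _ (hmaps hy) _ (hmaps hz)).trans ?_
      rw [mul_assoc]
      exact mul_le_mul (le_max_left _ _) (hShol y hy z hz) (abs_nonneg _) (by positivity)
  · refine ⟨2 * e 1 ^ 2 / D 1, by positivity, ?_⟩
    have hder : ∀ y ∈ Ioo (Y 1) (Y 0), HasDerivAt (fun y => (e (S y) - S y * e (S y)) ^ 2)
        ((2 * e (S y) ^ 2 - 2 * e (S y) * e' (S y) * (1 - S y)) / D (S y)) y := fun y hy => by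
      convert! ((hled y hy).sub (hred y hy)).pow 2 using 1
      have h1 : 1 - S y ≠ 0 := (sub_pos.2 (hSo y hy).2).ne'
      have h2 := (h.D_pos _ (Ioo_subset_Icc_self (hSo y hy))).ne'
      simp only [Pi.sub_apply]
      field_simp
      ring
    refine hasDerivWithinAt_Ici_of_tendsto_deriv (s := Ioo (Y 1) (Y 0))
      (fun y hy => (hder y hy).differentiableAt.differentiableWithinAt) ?_
      (Ioo_mem_nhdsGT hlt) ?_
    · have : ContinuousOn (fun y => (e (S y) - S y * e (S y)) ^ 2) (Icc (Y 1) (Y 0)) :=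
        (hecont.sub (hScont.mul hecont)).pow 2
      exact (this _ hyB).mono Ioo_subset_Icc_self
    · have h1 := hlimB (fun s => (2 * e s ^ 2 - 2 * e s * e' s * (1 - s)) / D s)
        (((continuousOn_const.mul (h.cont_e.pow 2)).sub
          (((continuousOn_const.mul h.cont_e).mul h.cont_e').mul (by fun_prop))).div h.cont_D
          fun s hs => (h.D_pos s hs).ne')
      simp only [sub_self, mul_zero, sub_zero] at h1
      refine h1.congr' ?_
      filter_upwards [Ioo_mem_nhdsGT hlt] with y hy using (hder y hy).deriv.symm

theorem exists_rarefactionProfile {a q ℓ₀ : ℝ} (ha : 1 / 2 < a) (ha1 : a < 1) (hq : 0 < q)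
    (hℓ₀ : 0 < ℓ₀) : ∃ (yB yD : ℝ) (r ℓ : ℝ → ℝ), IsRarefactionProfile a q ℓ₀ yB yD r ℓ := by
  obtain ⟨e, e', Y, D, h⟩ := exists_rarefactionParam ha ha1 hq hℓ₀
  exact h.exists_profile

/-! ### The simple wave -/

/-- The tangent line inequality for the power function. -/
lemma Real.mul_sub_le_rpow_sub_rpow {p x y : ℝ} (hp : 1 ≤ p) (hx : 0 ≤ x) (hy : 0 ≤ y) :
    p * x ^ (p - 1) * (y - x) ≤ y ^ p - x ^ p := by
  rcases hx.eq_or_lt with rfl | hx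
  · rcases hp.eq_or_lt with rfl | hp
    · simp
    · rw [Real.zero_rpow (by linarith), Real.zero_rpow (by linarith)]
      simpa using Real.rpow_nonneg hy p
  · have h1 : -1 ≤ y / x - 1 := by
      have := div_nonneg hy hx.le
      linarith
    have h2 := one_add_mul_self_le_rpow_one_add h1 hp
    rw [add_sub_cancel, Real.div_rpow hy hx.le, le_div_iff₀ (Real.rpow_pos_of_pos hx p)] at h2
    have h3 : x ^ p = x ^ (p - 1) * x := by rw [← Real.rpow_add_one hx.ne', sub_add_cancel]
    have h4 : (1 + p * (y / x - 1)) * x ^ p = x ^ p + p * x ^ (p - 1) * (y - x) := by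
      rw [h3]; field_simp
    linarith

lemma Real.sub_rpow_le_rpow_sub_rpow {p x y : ℝ} (hp : 1 ≤ p) (hx : 0 ≤ x) (hxy : x ≤ y) :
    (y - x) ^ p ≤ y ^ p - x ^ p := by
  have := NNReal.add_rpow_le_rpow_add ⟨y - x, sub_nonneg.2 hxy⟩ ⟨x, hx⟩ hp
  have h2 : (y - x) ^ p + x ^ p ≤ (y - x + x) ^ p := by exact_mod_cast this
  rw [sub_add_cancel] at h2
  linarith

/-- The curve `x = 0` for `t < 0` and `x = y t ^ δ` for `t ≥ 0`. -/
noncomputable def powerCurve (δ y t : ℝ) : ℝ := if t < 0 then 0 else y * t ^ δ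

/-- The constants of the simple wave: `x = K ℓ ^ (q + 1) - a ℓ t` is solved for `ℓ` as long as
`d t ≤ K ℓ ^ q`. Equality holds on the sonic curve, and `a < (q + 1) d` says that this curve is
reached before the wave breaks. -/
structure SimpleWaveConstants (a q d K : ℝ) : Prop where
  a_pos : 0 < a
  q_pos : 0 < q
  K_pos : 0 < K
  d_pos : 0 < d
  lt_mul : a < (q + 1) * d

/-- The value `ℓ` of the Riemann variable at `(t, x)` in the simple wave. -/
structure IsSimpleWave (a q d K t x ℓ : ℝ) : Prop where
  nonneg : 0 ≤ ℓ
  eq : K * ℓ ^ (q + 1) - a * ℓ * t = x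
  le : d * t ≤ K * ℓ ^ q

namespace SimpleWaveConstants

variable {a q d K : ℝ}

/-- Coercivity of the simple wave relation up to the sonic curve. -/
lemma coercive (h : SimpleWaveConstants a q d K) : ∃ c > 0, ∀ t ℓ₁ ℓ₂ : ℝ, 0 ≤ ℓ₁ → ℓ₁ ≤ ℓ₂ →
    d * t ≤ K * ℓ₁ ^ q →
      c * (ℓ₂ - ℓ₁) ^ (q + 1) ≤ K * (ℓ₂ ^ (q + 1) - ℓ₁ ^ (q + 1)) - a * t * (ℓ₂ - ℓ₁) := by
  obtain ⟨ha, hq, hK, hd, hlt⟩ := h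
  have hθ : a / ((q + 1) * d) < 1 := by rw [div_lt_one (by positivity)]; exact hlt
  refine ⟨(1 - a / ((q + 1) * d)) * K, mul_pos (by linarith) hK, fun t ℓ₁ ℓ₂ h1 h12 ht => ?_⟩
  have t1 := Real.mul_sub_le_rpow_sub_rpow (p := q + 1) (by linarith) h1 (h1.trans h12)
  have t2 := Real.sub_rpow_le_rpow_sub_rpow (p := q + 1) (by linarith) h1 h12
  rw [add_sub_cancel_right] at t1
  have hs : 0 ≤ ℓ₂ - ℓ₁ := sub_nonneg.2 h12
  have h3 : a * t * (ℓ₂ - ℓ₁) ≤ a / ((q + 1) * d) * K * ((q + 1) * ℓ₁ ^ q * (ℓ₂ - ℓ₁)) := by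
    have : a / ((q + 1) * d) * K * ((q + 1) * ℓ₁ ^ q * (ℓ₂ - ℓ₁)) =
        a / d * (K * ℓ₁ ^ q) * (ℓ₂ - ℓ₁) := by field_simp
    rw [this]
    refine mul_le_mul_of_nonneg_right ?_ hs
    calc a * t = a / d * (d * t) := by field_simp
      _ ≤ _ := mul_le_mul_of_nonneg_left ht (by positivity)
  have h4 : a / ((q + 1) * d) * K * ((q + 1) * ℓ₁ ^ q * (ℓ₂ - ℓ₁)) ≤
      a / ((q + 1) * d) * K * (ℓ₂ ^ (q + 1) - ℓ₁ ^ (q + 1)) :=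
    mul_le_mul_of_nonneg_left t1 (by positivity)
  have h5 := mul_le_mul_of_nonneg_left t2 (mul_pos (sub_pos.2 hθ) hK).le
  nlinarith

/-- Joint stability of the simple wave in `(t, x)`. -/
lemma stability (h : SimpleWaveConstants a q d K) : ∃ C : ℝ, 0 ≤ C ∧ ∀ t₁ x₁ ℓ₁ t₂ x₂ ℓ₂ : ℝ,
    IsSimpleWave a q d K t₁ x₁ ℓ₁ → IsSimpleWave a q d K t₂ x₂ ℓ₂ →
      |ℓ₁ - ℓ₂| ^ (q + 1) ≤ C * (|x₁ - x₂| + a * max ℓ₁ ℓ₂ * |t₁ - t₂|) := by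
  obtain ⟨c, hc, hco⟩ := h.coercive
  refine ⟨c⁻¹, by positivity, fun t₁ x₁ ℓ₁ t₂ x₂ ℓ₂ h₁ h₂ => ?_⟩
  wlog h12 : ℓ₁ ≤ ℓ₂ generalizing t₁ x₁ ℓ₁ t₂ x₂ ℓ₂
  · rw [abs_sub_comm ℓ₁, abs_sub_comm x₁, abs_sub_comm t₁, max_comm]
    exact this t₂ x₂ ℓ₂ t₁ x₁ ℓ₁ h₂ h₁ (le_of_not_ge h12)
  have h3 := hco t₁ ℓ₁ ℓ₂ h₁.nonneg h12 h₁.le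
  have h4 : K * (ℓ₂ ^ (q + 1) - ℓ₁ ^ (q + 1)) - a * t₁ * (ℓ₂ - ℓ₁) =
      (x₂ - x₁) + a * ℓ₂ * (t₂ - t₁) := by
    rw [← h₁.eq, ← h₂.eq]; ring
  rw [h4] at h3
  rw [abs_sub_comm, abs_of_nonneg (sub_nonneg.2 h12), max_eq_right h12, abs_sub_comm x₁,
    abs_sub_comm t₁, inv_mul_eq_div, le_div_iff₀ hc, mul_comm]
  refine h3.trans (add_le_add (le_abs_self _) ?_)
  exact mul_le_mul_of_nonneg_left (le_abs_self _) (mul_nonneg h.a_pos.le h₂.nonneg)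

lemma unique (h : SimpleWaveConstants a q d K) {t x ℓ₁ ℓ₂ : ℝ}
    (h₁ : IsSimpleWave a q d K t x ℓ₁) (h₂ : IsSimpleWave a q d K t x ℓ₂) : ℓ₁ = ℓ₂ := by
  obtain ⟨C, hC, hst⟩ := h.stability
  have h3 := hst _ _ _ _ _ _ h₁ h₂
  simp only [sub_self, abs_zero, mul_zero, add_zero] at h3
  by_contra hne
  exact absurd h3 (not_le.2 (Real.rpow_pos_of_pos (abs_pos.2 (sub_ne_zero.2 hne)) _))

lemma isSimpleWave_sonic (h : SimpleWaveConstants a q d K) {t : ℝ} (ht : 0 ≤ t) :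
    IsSimpleWave a q d K t ((d - a) * (d / K) ^ (1 / q) * t ^ (1 + 1 / q))
      ((d / K) ^ (1 / q) * t ^ (1 / q)) := by
  obtain ⟨ha, hq, hK, hd, hlt⟩ := h
  have hdK : 0 ≤ d / K := by positivity
  have e1 : ((d / K) ^ (1 / q) * t ^ (1 / q)) ^ q = d / K * t := by
    rw [Real.mul_rpow (by positivity) (by positivity), ← Real.rpow_mul hdK, ← Real.rpow_mul ht,
      one_div_mul_cancel hq.ne', Real.rpow_one, Real.rpow_one]
  have e2 : t ^ (1 + 1 / q) = t * t ^ (1 / q) := by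
    rw [Real.rpow_add_of_nonneg ht zero_le_one (by positivity), Real.rpow_one]
  have hKd : K * (d / K) = d := mul_div_cancel₀ _ hK.ne'
  refine ⟨by positivity, ?_, ?_⟩
  · rw [Real.rpow_add_of_nonneg (by positivity) hq.le zero_le_one, e1, Real.rpow_one, e2]
    linear_combination (t * ((d / K) ^ (1 / q) * t ^ (1 / q))) * hKd
  · rw [e1]
    exact le_of_eq (by linear_combination -t * hKd)

/-- On the closed region of the simple wave, the smallest value is attained on its boundary. -/
lemma exists_boundary (h : SimpleWaveConstants a q d K) (t : ℝ) : ∃ ℓ₁,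
    IsSimpleWave a q d K t (powerCurve (1 + 1 / q) ((d - a) * (d / K) ^ (1 / q)) t) ℓ₁ ∧
      ∀ x ℓ, IsSimpleWave a q d K t x ℓ → ℓ₁ ≤ ℓ := by
  rcases lt_or_ge t 0 with ht | ht
  · refine ⟨0, ⟨le_rfl, ?_, ?_⟩, fun x ℓ hℓ => hℓ.nonneg⟩
    · rw [powerCurve, if_pos ht, Real.zero_rpow (by linarith [h.q_pos])]; simp
    · rw [Real.zero_rpow h.q_pos.ne']
      nlinarith [h.d_pos]
  · have h1 := h.isSimpleWave_sonic ht
    refine ⟨_, by rw [powerCurve, if_neg (not_lt.2 ht)]; exact h1, fun x ℓ hℓ => ?_⟩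
    rw [← Real.mul_rpow (div_pos h.d_pos h.K_pos).le ht]
    have hq := h.q_pos
    have : d / K * t ≤ ℓ ^ q := by
      rw [div_mul_eq_mul_div, div_le_iff₀ h.K_pos, mul_comm (ℓ ^ q)]; exact hℓ.le
    calc (d / K * t) ^ (1 / q) ≤ (ℓ ^ q) ^ (1 / q) :=
          Real.rpow_le_rpow (mul_nonneg (div_pos h.d_pos h.K_pos).le ht) this (by positivity)
      _ = ℓ := by rw [← Real.rpow_mul hℓ.nonneg, mul_one_div_cancel hq.ne', Real.rpow_one]

lemma powerCurve_le (h : SimpleWaveConstants a q d K) {t x ℓ : ℝ}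
    (hℓ : IsSimpleWave a q d K t x ℓ) :
    powerCurve (1 + 1 / q) ((d - a) * (d / K) ^ (1 / q)) t ≤ x := by
  obtain ⟨ℓ₁, h1, hmin⟩ := h.exists_boundary t
  obtain ⟨c, hc, hco⟩ := h.coercive
  have h2 := hmin x ℓ hℓ
  have h3 := hco t ℓ₁ ℓ h1.nonneg h2 h1.le
  have h4 : 0 ≤ c * (ℓ - ℓ₁) ^ (q + 1) :=
    mul_nonneg hc.le (Real.rpow_nonneg (sub_nonneg.2 h2) _)
  have := h1.eq
  have := hℓ.eq
  nlinarith

lemma exists_isSimpleWave (h : SimpleWaveConstants a q d K) {t x : ℝ}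
    (hx : powerCurve (1 + 1 / q) ((d - a) * (d / K) ^ (1 / q)) t ≤ x) :
    ∃ ℓ, IsSimpleWave a q d K t x ℓ := by
  obtain ⟨ℓ₁, h1, -⟩ := h.exists_boundary t
  obtain ⟨c, hc, hco⟩ := h.coercive
  have hq := h.q_pos
  set x₁ := powerCurve (1 + 1 / q) ((d - a) * (d / K) ^ (1 / q)) t with hx₁
  have hnn : 0 ≤ (x - x₁) / c := div_nonneg (sub_nonneg.2 hx) hc.le
  set L := ℓ₁ + ((x - x₁) / c) ^ (1 / (q + 1)) with hL
  have hL1 : ℓ₁ ≤ L := by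
    have := Real.rpow_nonneg hnn (1 / (q + 1))
    linarith
  have h3 := hco t ℓ₁ L h1.nonneg hL1 h1.le
  have h4 : (L - ℓ₁) ^ (q + 1) = (x - x₁) / c := by
    rw [hL, add_sub_cancel_left, ← Real.rpow_mul hnn, one_div_mul_cancel (by positivity),
      Real.rpow_one]
  rw [h4, mul_div_cancel₀ _ hc.ne'] at h3
  have hcont : Continuous fun ℓ : ℝ => K * ℓ ^ (q + 1) - a * ℓ * t :=
    (continuous_const.mul (Real.continuous_rpow_const (by linarith))).sub (by fun_prop)
  have h5 := h1.eq
  obtain ⟨ℓ, hℓ, hℓ'⟩ := intermediate_value_Icc hL1 hcont.continuousOn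
    (show x ∈ Icc _ _ from ⟨by linarith, by nlinarith⟩)
  refine ⟨ℓ, h1.nonneg.trans hℓ.1, hℓ', h1.le.trans ?_⟩
  exact mul_le_mul_of_nonneg_left (Real.rpow_le_rpow h1.nonneg hℓ.1 hq.le) h.K_pos.le

lemma strict (h : SimpleWaveConstants a q d K) {t x ℓ : ℝ} (hℓ : IsSimpleWave a q d K t x ℓ)
    (hx : powerCurve (1 + 1 / q) ((d - a) * (d / K) ^ (1 / q)) t < x) :
    0 < ℓ ∧ d * t < K * ℓ ^ q := by
  obtain ⟨ℓ₁, h1, hmin⟩ := h.exists_boundary t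
  have hlt : ℓ₁ < ℓ := lt_of_le_of_ne (hmin x ℓ hℓ) fun he => by
    have := hℓ.eq
    rw [← he, h1.eq] at this
    exact hx.ne this
  refine ⟨h1.nonneg.trans_lt hlt, h1.le.trans_lt ?_⟩
  exact mul_lt_mul_of_pos_left (Real.rpow_lt_rpow h1.nonneg hlt h.q_pos) h.K_pos

lemma scaling (h : SimpleWaveConstants a q d K) {t x ℓ s : ℝ} (hs : 0 < s)
    (hℓ : IsSimpleWave a q d K t x ℓ) :
    IsSimpleWave a q d K (s * t) (s ^ (1 + 1 / q) * x) (s ^ (1 / q) * ℓ) := by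
  have hq := h.q_pos
  have hp : 0 ≤ s ^ (1 / q) := Real.rpow_nonneg hs.le _
  have e1 : (s ^ (1 / q) * ℓ) ^ q = s * ℓ ^ q := by
    rw [Real.mul_rpow hp hℓ.nonneg, ← Real.rpow_mul hs.le, one_div_mul_cancel hq.ne', Real.rpow_one]
  refine ⟨mul_nonneg hp hℓ.nonneg, ?_, ?_⟩
  · rw [← hℓ.eq, Real.rpow_add_of_nonneg (mul_nonneg hp hℓ.nonneg) hq.le zero_le_one, e1,
      Real.rpow_add_of_nonneg hℓ.nonneg hq.le zero_le_one, Real.rpow_add hs, Real.rpow_one,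
      Real.rpow_one, Real.rpow_one]
    ring
  · rw [e1]
    have := mul_le_mul_of_nonneg_left hℓ.le hs.le
    linarith

lemma denom_pos (h : SimpleWaveConstants a q d K) {t ℓ : ℝ} (hℓ : 0 < ℓ)
    (hle : d * t ≤ K * ℓ ^ q) : 0 < (q + 1) * K * ℓ ^ q - a * t := by
  obtain ⟨ha, hq, hK, hd, hlt⟩ := h
  have hp : 0 < K * ℓ ^ q := mul_pos hK (Real.rpow_pos_of_pos hℓ q)
  have h1 : a * (d * t) ≤ a * (K * ℓ ^ q) := mul_le_mul_of_nonneg_left hle ha.le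
  have h2 : a * (K * ℓ ^ q) < (q + 1) * d * (K * ℓ ^ q) := mul_lt_mul_of_pos_right hlt hp
  have h3 : 0 < d * ((q + 1) * K * ℓ ^ q - a * t) := by nlinarith
  exact pos_of_mul_pos_right h3 hd.le

lemma bounded (h : SimpleWaveConstants a q d K) {R t x ℓ : ℝ} (hℓ : IsSimpleWave a q d K t x ℓ)
    (ht : |t| ≤ R) (hx : |x| ≤ R) : ℓ ≤ max 1 (((1 + a) * R / K) ^ (1 / q)) := by
  obtain ⟨ha, hq, hK, hd, hlt⟩ := h
  rcases le_total ℓ 1 with h1 | h1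
  · exact h1.trans (le_max_left _ _)
  refine le_trans ?_ (le_max_right _ _)
  have hℓ0 : 0 < ℓ := by linarith
  have e := hℓ.eq
  rw [Real.rpow_add_one hℓ0.ne'] at e
  have ht' := (abs_le.1 ht).2
  have hx' := (abs_le.1 hx).2
  have hR : 0 ≤ R := (abs_nonneg t).trans ht
  have h2 : ℓ * (K * ℓ ^ q) ≤ ℓ * ((1 + a) * R) := by
    have h3 : a * ℓ * t ≤ a * ℓ * R := mul_le_mul_of_nonneg_left ht' (by positivity)
    have h4 : R ≤ ℓ * R := le_mul_of_one_le_left hR h1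
    nlinarith
  have h3 : ℓ ^ q ≤ (1 + a) * R / K := by
    rw [le_div_iff₀ hK, mul_comm]
    exact le_of_mul_le_mul_left h2 hℓ0
  calc ℓ = (ℓ ^ q) ^ (1 / q) := by
        rw [← Real.rpow_mul hℓ0.le, mul_one_div_cancel hq.ne', Real.rpow_one]
    _ ≤ _ := Real.rpow_le_rpow (Real.rpow_nonneg hℓ0.le _) h3 (by positivity)

end SimpleWaveConstants

/-- The simple wave as a function of `(t, x)`; it is `0` outside its domain. -/
noncomputable def simpleWave (a q d K t x : ℝ) : ℝ :=
  open scoped Classical in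
  if h : ∃ ℓ, IsSimpleWave a q d K t x ℓ then h.choose else 0

namespace SimpleWaveConstants

variable {a q d K : ℝ}

lemma isSimpleWave (h : SimpleWaveConstants a q d K) {t x : ℝ}
    (hx : powerCurve (1 + 1 / q) ((d - a) * (d / K) ^ (1 / q)) t ≤ x) :
    IsSimpleWave a q d K t x (simpleWave a q d K t x) := by
  have := h.exists_isSimpleWave hx
  rw [simpleWave, dif_pos this]
  exact this.choose_spec

lemma simpleWave_eq (h : SimpleWaveConstants a q d K) {t x ℓ : ℝ}
    (hℓ : IsSimpleWave a q d K t x ℓ) : simpleWave a q d K t x = ℓ :=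
  h.unique (h.isSimpleWave (h.powerCurve_le hℓ)) hℓ

lemma simpleWave_holder (h : SimpleWaveConstants a q d K) (R : ℝ) : ∃ C : ℝ, 0 ≤ C ∧
    ∀ p₁ p₂ : ℝ × ℝ,
      powerCurve (1 + 1 / q) ((d - a) * (d / K) ^ (1 / q)) p₁.1 ≤ p₁.2 →
      powerCurve (1 + 1 / q) ((d - a) * (d / K) ^ (1 / q)) p₂.1 ≤ p₂.2 →
      |p₁.1| ≤ R → |p₁.2| ≤ R → |p₂.1| ≤ R → |p₂.2| ≤ R →
      |simpleWave a q d K p₁.1 p₁.2 - simpleWave a q d K p₂.1 p₂.2| ≤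
        C * dist p₁ p₂ ^ (1 / (q + 1)) := by
  obtain ⟨C, hC, hst⟩ := h.stability
  have ha := h.a_pos
  have hq := h.q_pos
  set W := max 1 (((1 + a) * R / K) ^ (1 / q)) with hW
  have hW0 : 0 ≤ W := zero_le_one.trans (le_max_left _ _)
  refine ⟨(C * (1 + a * W)) ^ (1 / (q + 1)), by positivity, fun p₁ p₂ h₁ h₂ ht₁ hx₁ ht₂ hx₂ => ?_⟩
  have s₁ := h.isSimpleWave h₁
  have s₂ := h.isSimpleWave h₂
  have key := hst _ _ _ _ _ _ s₁ s₂
  have hmax : max (simpleWave a q d K p₁.1 p₁.2) (simpleWave a q d K p₂.1 p₂.2) ≤ W :=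
    max_le (h.bounded s₁ ht₁ hx₁) (h.bounded s₂ ht₂ hx₂)
  have hd1 : |p₁.1 - p₂.1| ≤ dist p₁ p₂ := by
    rw [← Real.dist_eq, Prod.dist_eq]; exact le_max_left _ _
  have hd2 : |p₁.2 - p₂.2| ≤ dist p₁ p₂ := by
    rw [← Real.dist_eq, Prod.dist_eq]; exact le_max_right _ _
  have h3 : |p₁.2 - p₂.2| + a * max (simpleWave a q d K p₁.1 p₁.2) (simpleWave a q d K p₂.1 p₂.2) *
      |p₁.1 - p₂.1| ≤ (1 + a * W) * dist p₁ p₂ := by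
    have : a * max (simpleWave a q d K p₁.1 p₁.2) (simpleWave a q d K p₂.1 p₂.2) *
      |p₁.1 - p₂.1| ≤ a * W * dist p₁ p₂ :=
      mul_le_mul (mul_le_mul_of_nonneg_left hmax ha.le) hd1 (abs_nonneg _) (by positivity)
    linarith
  have h4 := key.trans (mul_le_mul_of_nonneg_left h3 hC)
  rw [← mul_assoc] at h4
  rw [← Real.mul_rpow (by positivity) dist_nonneg]
  calc _ = (|simpleWave a q d K p₁.1 p₁.2 - simpleWave a q d K p₂.1 p₂.2| ^ (q + 1)) ^
        (1 / (q + 1)) := by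
        rw [← Real.rpow_mul (abs_nonneg _), mul_one_div_cancel (by positivity), Real.rpow_one]
    _ ≤ _ := Real.rpow_le_rpow (Real.rpow_nonneg (abs_nonneg _) _) h4 (by positivity)

lemma contDiffAt_simpleWave (h : SimpleWaveConstants a q d K) {t x : ℝ}
    (hx : powerCurve (1 + 1 / q) ((d - a) * (d / K) ^ (1 / q)) t < x) :
    ContDiffAt ℝ ∞ (fun p : ℝ × ℝ => simpleWave a q d K p.1 p.2) (t, x) := by
  have hℓ := h.isSimpleWave hx.le
  obtain ⟨hpos, hlt⟩ := h.strict hℓ hx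
  set ℓ := simpleWave a q d K t x
  set β := (q + 1) * K * ℓ ^ q - a * t with hβ
  have hβ0 : β ≠ 0 := (h.denom_pos hpos hlt.le).ne'
  let Φ : ℝ × ℝ → ℝ × ℝ := fun z => (z.1, K * z.2 ^ (q + 1) - a * z.2 * z.1)
  let e : (ℝ × ℝ) ≃L[ℝ] ℝ × ℝ := ContinuousLinearEquiv.skewProd (ContinuousLinearEquiv.refl ℝ ℝ)
    (ContinuousLinearEquiv.unitsEquivAut ℝ (Units.mk0 β hβ0))
    ((-(a * ℓ)) • ContinuousLinearMap.id ℝ ℝ)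
  have hΦs : ContDiffAt ℝ ∞ Φ (t, ℓ) := by
    refine contDiffAt_fst.prodMk ?_
    refine (contDiffAt_const.mul (contDiffAt_snd.rpow_const_of_ne hpos.ne')).sub ?_
    exact (contDiffAt_const.mul contDiffAt_snd).mul contDiffAt_fst
  have hΦ' : HasFDerivAt Φ (e : ℝ × ℝ →L[ℝ] ℝ × ℝ) (t, ℓ) := by
    have h1 : HasFDerivAt (fun z : ℝ × ℝ => K * z.2 ^ (q + 1) - a * z.2 * z.1) _ (t, ℓ) :=
      (((hasFDerivAt_snd (p := (t, ℓ))).rpow_const (p := q + 1) (Or.inl hpos.ne')).const_mul K).sub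
        (((hasFDerivAt_snd (p := (t, ℓ))).const_mul a).mul (hasFDerivAt_fst (p := (t, ℓ))))
    have h2 := (hasFDerivAt_fst (𝕜 := ℝ) (p := (t, ℓ))).prodMk h1
    convert! h2 using 1
    ext <;> simp [e, hβ]
    ring
  have hev : ∀ᶠ z in 𝓝 (t, ℓ), (fun p : ℝ × ℝ => (p.1, simpleWave a q d K p.1 p.2)) (Φ z) = z := by
    have c1 : ContinuousAt (fun z : ℝ × ℝ => z.2) (t, ℓ) := continuousAt_snd
    have c2 : ContinuousAt (fun z : ℝ × ℝ => K * z.2 ^ q - d * z.1) (t, ℓ) :=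
      ContinuousAt.sub (continuousAt_const.mul (continuousAt_snd.rpow_const (Or.inl hpos.ne')))
        (by fun_prop)
    filter_upwards [c1.eventually (lt_mem_nhds hpos),
      c2.eventually (lt_mem_nhds (show 0 < K * ℓ ^ q - d * t by linarith))] with z h1 h2
    have : IsSimpleWave a q d K z.1 (K * z.2 ^ (q + 1) - a * z.2 * z.1) z.2 :=
      ⟨h1.le, rfl, by linarith⟩
    simp only [Φ, h.simpleWave_eq this]
  have key := ContDiffAt.leftInverse
    (g := fun p : ℝ × ℝ => (p.1, simpleWave a q d K p.1 p.2)) hΦs hΦ' hev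
  have hΦx : Φ (t, ℓ) = (t, x) := by simp only [Φ, hℓ.eq]
  rw [hΦx] at key
  exact key.snd

/-- The derivatives of the simple wave with respect to `x` and `t`. -/
lemma hasDerivAt_simpleWave (h : SimpleWaveConstants a q d K) {t x : ℝ}
    (hx : powerCurve (1 + 1 / q) ((d - a) * (d / K) ^ (1 / q)) t < x) :
    HasDerivAt (fun z => simpleWave a q d K t z)
      (((q + 1) * K * simpleWave a q d K t x ^ q - a * t)⁻¹) x ∧
    HasDerivAt (fun s => simpleWave a q d K s x)
      (a * simpleWave a q d K t x * ((q + 1) * K * simpleWave a q d K t x ^ q - a * t)⁻¹) t := by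
  have hℓ := h.isSimpleWave hx.le
  obtain ⟨hpos, hlt⟩ := h.strict hℓ hx
  have hβ0 := (h.denom_pos hpos hlt.le).ne'
  have hdiff := (h.contDiffAt_simpleWave hx).differentiableAt (by simp)
  -- points near `(t, x)` satisfy the relation defining the wave
  have hev : ∀ᶠ p in 𝓝 (t, x), IsSimpleWave a q d K p.1 p.2 (simpleWave a q d K p.1 p.2) := by
    have c1 : ContinuousAt (fun p : ℝ × ℝ => simpleWave a q d K p.1 p.2) (t, x) := hdiff.continuousAt
    by_cases ht : t < 0
    · have hx0 : 0 < x := by rwa [powerCurve, if_pos ht] at hx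
      filter_upwards [continuousAt_fst.eventually (gt_mem_nhds ht),
        continuousAt_snd.eventually (lt_mem_nhds hx0)] with p h1 h2
      exact h.isSimpleWave (by rw [powerCurve, if_pos h1]; exact h2.le)
    · have hq := h.q_pos
      rw [powerCurve, if_neg ht] at hx
      have c2 : ContinuousAt (fun p : ℝ × ℝ =>
          p.2 - (d - a) * (d / K) ^ (1 / q) * p.1 ^ (1 + 1 / q)) (t, x) :=
        ContinuousAt.sub continuousAt_snd (continuousAt_const.mul
          (continuousAt_fst.rpow_const (Or.inr (by positivity))))
      rcases (not_lt.1 ht).eq_or_lt with h0 | h0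
      · have hx0 : 0 < x := by
          rwa [← h0, Real.zero_rpow (by positivity), mul_zero] at hx
        filter_upwards [c2.eventually (lt_mem_nhds (sub_pos.2 hx)),
          continuousAt_snd.eventually (lt_mem_nhds hx0)] with p h1 h2
        refine h.isSimpleWave ?_
        rw [powerCurve]
        split_ifs with h3
        · exact h2.le
        · linarith
      · filter_upwards [c2.eventually (lt_mem_nhds (sub_pos.2 hx)),
          continuousAt_fst.eventually (lt_mem_nhds h0)] with p h1 h2
        refine h.isSimpleWave ?_
        rw [powerCurve, if_neg (not_lt.2 h2.le)]
        linarith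
  constructor
  · have hd : DifferentiableAt ℝ (fun z => simpleWave a q d K t z) x :=
      DifferentiableAt.comp (f := fun z : ℝ => (t, z)) x hdiff (by fun_prop)
    obtain ⟨D, hD⟩ : ∃ D, HasDerivAt (fun z => simpleWave a q d K t z) D x := ⟨_, hd.hasDerivAt⟩
    have h1 := ((hD.rpow_const (p := q + 1) (Or.inl hpos.ne')).const_mul K).sub
      ((hD.const_mul a).mul_const t)
    have h2 : HasDerivAt (fun z : ℝ => z) 1 x := hasDerivAt_id x
    have h3 := h1.unique (h2.congr_of_eventuallyEq ?_)
    · rw [add_sub_cancel_right] at h3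
      convert! hD using 1
      rw [inv_eq_one_div, div_eq_iff hβ0]
      linear_combination -h3
    · have : Tendsto (fun z : ℝ => (t, z)) (𝓝 x) (𝓝 (t, x)) :=
        (Continuous.prodMk_right t).tendsto x
      filter_upwards [this.eventually hev] with z hz using hz.eq
  · have hd : DifferentiableAt ℝ (fun s => simpleWave a q d K s x) t :=
      DifferentiableAt.comp (f := fun s : ℝ => (s, x)) t hdiff (by fun_prop)
    obtain ⟨D, hD⟩ : ∃ D, HasDerivAt (fun s => simpleWave a q d K s x) D t := ⟨_, hd.hasDerivAt⟩
    have h1 := ((hD.rpow_const (p := q + 1) (Or.inl hpos.ne')).const_mul K).sub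
      ((hD.const_mul a).mul (hasDerivAt_id t))
    have h2 : HasDerivAt (fun _ : ℝ => x) 0 t := hasDerivAt_const t x
    have h3 := h1.unique (h2.congr_of_eventuallyEq ?_)
    · rw [add_sub_cancel_right] at h3
      simp only [id] at h3
      convert! hD using 1
      rw [← div_eq_mul_inv, div_eq_iff hβ0]
      linear_combination -h3
    · have : Tendsto (fun s : ℝ => (s, x)) (𝓝 t) (𝓝 (t, x)) :=
        (Continuous.prodMk_left x).tendsto t
      filter_upwards [this.eventually hev] with z hz using hz.eq

end SimpleWaveConstants

/-! ### Hölder continuity of self-similar functions -/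

lemma Real.rpow_le_mul_rpow_of_le {D B α β : ℝ} (hD : 0 ≤ D) (hDB : D ≤ B) (hα : 0 ≤ α)
    (hαβ : α ≤ β) : D ^ β ≤ B ^ (β - α) * D ^ α := by
  have : D ^ β = D ^ (β - α) * D ^ α := by
    rw [← Real.rpow_add_of_nonneg hD (sub_nonneg.2 hαβ) hα, sub_add_cancel]
  rw [this]
  exact mul_le_mul_of_nonneg_right (Real.rpow_le_rpow hD hDB (sub_nonneg.2 hαβ))
    (Real.rpow_nonneg hD α)

/-- The function `t ^ p` is Hölder continuous on `[0, R]` with each exponent `α ≤ min 1 p`. -/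
lemma exists_holder_rpow {p α : ℝ} (hα : 0 < α) (hα1 : α ≤ 1) (hαp : α ≤ p) {R : ℝ}
    (hR : 0 ≤ R) : ∃ C : ℝ, 0 ≤ C ∧ ∀ s ∈ Icc 0 R, ∀ t ∈ Icc 0 R,
      |s ^ p - t ^ p| ≤ C * |s - t| ^ α := by
  have hp : 0 < p := hα.trans_le hαp
  rcases le_total 1 p with h1 | h1
  · refine ⟨p * R ^ (p - 1) * R ^ (1 - α), by positivity, fun s hs t ht => ?_⟩
    wlog hst : s ≤ t generalizing s t
    · rw [abs_sub_comm, abs_sub_comm s]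
      exact this t ht s hs (le_of_not_ge hst)
    have h2 := Real.mul_sub_le_rpow_sub_rpow h1 ht.1 hs.1
    have h3 : s ^ p ≤ t ^ p := Real.rpow_le_rpow hs.1 hst hp.le
    have h4 : t ^ (p - 1) ≤ R ^ (p - 1) := Real.rpow_le_rpow ht.1 ht.2 (sub_nonneg.2 h1)
    have h5 : 0 ≤ t - s := sub_nonneg.2 hst
    have h6 := Real.rpow_le_mul_rpow_of_le h5 (by linarith [ht.2, hs.1] : t - s ≤ R) hα.le hα1
    rw [Real.rpow_one] at h6
    rw [abs_sub_comm, abs_of_nonneg (sub_nonneg.2 h3), abs_sub_comm, abs_of_nonneg h5]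
    calc t ^ p - s ^ p ≤ p * t ^ (p - 1) * (t - s) := by linarith
      _ ≤ p * R ^ (p - 1) * (R ^ (1 - α) * (t - s) ^ α) := by gcongr
      _ = _ := by ring
  · refine ⟨R ^ (p - α), by positivity, fun s hs t ht => ?_⟩
    wlog hst : s ≤ t generalizing s t
    · rw [abs_sub_comm, abs_sub_comm s]
      exact this t ht s hs (le_of_not_ge hst)
    have h3 : s ^ p ≤ t ^ p := Real.rpow_le_rpow hs.1 hst hp.le
    have h5 : 0 ≤ t - s := sub_nonneg.2 hst
    have h6 := Real.rpow_le_mul_rpow_of_le h5 (by linarith [ht.2, hs.1] : t - s ≤ R) hα.le hαp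
    have h7 : (t - s + s) ^ p ≤ (t - s) ^ p + s ^ p := by
      exact_mod_cast NNReal.rpow_add_le_add_rpow ⟨t - s, h5⟩ ⟨s, hs.1⟩ hp.le h1
    rw [sub_add_cancel] at h7
    rw [abs_sub_comm, abs_of_nonneg (sub_nonneg.2 h3), abs_sub_comm, abs_of_nonneg h5]
    linarith

set_option maxHeartbeats 1000000 in
/-- A function on `{yB t ^ δ ≤ x}` which is homogeneous with a `1/2`-Hölder profile on the sector
`yB t ^ δ ≤ x ≤ yD t ^ δ`, and Hölder continuous on the rest of the domain, is Hölder continuous.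
Points of the sector are moved along the curves `x = y t ^ δ` and then at constant time. -/
lemma holder_of_sector {q yB yD α : ℝ} (hq : 0 < q) (hBD : yB < yD) (hD : yD < 0) (hα : 0 < α)
    (hα2 : α ≤ 1 / 2) (hαq : α ≤ 1 / (q + 1)) {f : ℝ → ℝ → ℝ} {g : ℝ → ℝ}
    (hfg : ∀ t, 0 ≤ t → ∀ y ∈ Icc yB yD, f t (y * t ^ (1 + 1 / q)) = t ^ (1 / q) * g y)
    {C₀ : ℝ} (hC₀ : 0 ≤ C₀) (hg : ∀ y ∈ Icc yB yD, ∀ z ∈ Icc yB yD, |g y - g z| ≤ C₀ * √|y - z|)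
    (hright : ∀ R : ℝ, ∃ C : ℝ, 0 ≤ C ∧ ∀ p₁ p₂ : ℝ × ℝ,
      powerCurve (1 + 1 / q) yD p₁.1 ≤ p₁.2 → powerCurve (1 + 1 / q) yD p₂.1 ≤ p₂.2 →
      |p₁.1| ≤ R → |p₁.2| ≤ R → |p₂.1| ≤ R → |p₂.2| ≤ R →
      |f p₁.1 p₁.2 - f p₂.1 p₂.2| ≤ C * dist p₁ p₂ ^ α) (R : ℝ) :
    ∃ C : ℝ, 0 ≤ C ∧ ∀ p₁ p₂ : ℝ × ℝ,
      powerCurve (1 + 1 / q) yB p₁.1 ≤ p₁.2 → powerCurve (1 + 1 / q) yB p₂.1 ≤ p₂.2 →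
      |p₁.1| ≤ R → |p₁.2| ≤ R → |p₂.1| ≤ R → |p₂.2| ≤ R →
      |f p₁.1 p₁.2 - f p₂.1 p₂.2| ≤ C * dist p₁ p₂ ^ α := by
  set δ := 1 + 1 / q with hδ
  have hq' : 0 < 1 / q := by positivity
  have hδ1 : 1 ≤ δ := by linarith
  have hα1 : α ≤ 1 := by linarith
  have hα1q : α ≤ 1 / q := hαq.trans (one_div_le_one_div_of_le hq (by linarith))
  have hδα : δ * α ≤ 1 / q := by
    have : δ * (1 / (q + 1)) = 1 / q := by rw [hδ]; field_simp
    rw [← this]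
    exact mul_le_mul_of_nonneg_left hαq (by linarith)
  rcases lt_or_ge R 0 with hR | hR
  · exact ⟨0, le_rfl, fun p₁ p₂ _ _ h => absurd ((abs_nonneg _).trans h) (not_le.2 hR)⟩
  -- a bound of the profile
  have hyDm : yD ∈ Icc yB yD := ⟨hBD.le, le_rfl⟩
  obtain ⟨M, hM0, hM⟩ : ∃ M : ℝ, 0 ≤ M ∧ ∀ y ∈ Icc yB yD, |g y| ≤ M := by
    refine ⟨|g yD| + C₀ * √(yD - yB), by positivity, fun y hy => ?_⟩
    have h1 := hg y hy yD hyDm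
    have h2 : |y - yD| ≤ yD - yB := by
      rw [abs_sub_comm, abs_of_nonneg (sub_nonneg.2 hy.2)]; linarith [hy.1]
    have h3 := mul_le_mul_of_nonneg_left (Real.sqrt_le_sqrt h2) hC₀
    have h4 : |g y| ≤ |g yD| + |g y - g yD| := by
      have := abs_add_le (g yD) (g y - g yD)
      rwa [add_sub_cancel] at this
    linarith
  -- motion along the curves `x = y t ^ δ`
  obtain ⟨C₁, hC₁, hpow⟩ := exists_holder_rpow hα hα1 hα1q hR
  have hray : ∀ t₁ ∈ Icc 0 R, ∀ t₂ ∈ Icc 0 R, ∀ y ∈ Icc yB yD,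
      |f t₁ (y * t₁ ^ δ) - f t₂ (y * t₂ ^ δ)| ≤ M * C₁ * |t₁ - t₂| ^ α := by
    intro t₁ h₁ t₂ h₂ y hy
    rw [hfg t₁ h₁.1 y hy, hfg t₂ h₂.1 y hy, ← sub_mul, abs_mul]
    have := mul_le_mul (hpow t₁ h₁ t₂ h₂) (hM y hy) (abs_nonneg _)
      (mul_nonneg hC₁ (Real.rpow_nonneg (abs_nonneg _) _))
    linarith
  -- motion at constant time in the sector
  obtain ⟨C₂, hC₂, hsect⟩ : ∃ C₂ : ℝ, 0 ≤ C₂ ∧ ∀ t ∈ Icc 0 R, ∀ y ∈ Icc yB yD, ∀ z ∈ Icc yB yD,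
      |f t (y * t ^ δ) - f t (z * t ^ δ)| ≤ C₂ * |y * t ^ δ - z * t ^ δ| ^ α := by
    have hBD' : 0 ≤ yD - yB := by linarith
    refine ⟨R ^ (1 / q - δ * α) * (C₀ * (yD - yB) ^ (1 / 2 - α)), by positivity,
      fun t ht y hy z hz => ?_⟩
    rw [hfg t ht.1 y hy, hfg t ht.1 z hz, ← mul_sub, abs_mul, ← sub_mul, abs_mul,
      Real.mul_rpow (abs_nonneg _) (abs_nonneg _), abs_of_nonneg (Real.rpow_nonneg ht.1 _),
      abs_of_nonneg (Real.rpow_nonneg ht.1 _), ← Real.rpow_mul ht.1]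
    have h1 := Real.rpow_le_mul_rpow_of_le ht.1 ht.2 (by positivity) hδα
    have h2 : |y - z| ≤ yD - yB := by
      rw [abs_le]; constructor <;> linarith [hy.1, hy.2, hz.1, hz.2]
    have h3 := Real.rpow_le_mul_rpow_of_le (abs_nonneg (y - z)) h2 hα.le hα2
    have h4 := hg y hy z hz
    rw [Real.sqrt_eq_rpow] at h4
    calc t ^ (1 / q) * |g y - g z| ≤ (R ^ (1 / q - δ * α) * t ^ (δ * α)) *
          (C₀ * ((yD - yB) ^ (1 / 2 - α) * |y - z| ^ α)) :=
          mul_le_mul h1 (h4.trans (mul_le_mul_of_nonneg_left h3 hC₀)) (abs_nonneg _)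
            (mul_nonneg (Real.rpow_nonneg hR _) (Real.rpow_nonneg ht.1 _))
      _ = _ := by ring
  -- a ball which contains all auxiliary points
  set R' := R + |yD| * R ^ δ with hR'
  have hRR' : R ≤ R' := by
    have : 0 ≤ |yD| * R ^ δ := by positivity
    linarith
  obtain ⟨C₃, hC₃, hr⟩ := hright R'
  have hcurve : ∀ y t, 0 ≤ t → powerCurve δ y t = y * t ^ δ := fun y t ht => by
    rw [powerCurve, if_neg (not_lt.2 ht)]
  -- points of the domain outside the closed simple wave region lie in the sector
  have hdich : ∀ t x, powerCurve δ yB t ≤ x → powerCurve δ yD t ≤ x ∨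
      (0 < t ∧ ∃ y ∈ Icc yB yD, x = y * t ^ δ) := by
    intro t x hx
    rcases le_or_gt (powerCurve δ yD t) x with h | h
    · exact Or.inl h
    · right
      have ht : 0 < t := by
        by_contra hcon
        rcases (not_lt.1 hcon).eq_or_lt with h0 | h0
        · rw [h0, hcurve _ 0 le_rfl, Real.zero_rpow (by linarith), mul_zero] at h hx
          linarith
        · rw [powerCurve, if_pos h0] at h hx
          linarith
      rw [hcurve _ _ ht.le] at h hx
      have hp := Real.rpow_pos_of_pos ht δ
      refine ⟨ht, x / t ^ δ, ⟨?_, ?_⟩, (div_mul_cancel₀ _ hp.ne').symm⟩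
      · rwa [le_div_iff₀ hp]
      · rw [div_le_iff₀ hp]; exact h.le
  have hyDR : ∀ t ∈ Icc 0 R, |yD * t ^ δ| ≤ R' := fun t ht => by
    rw [abs_mul, abs_of_nonneg (Real.rpow_nonneg ht.1 _)]
    have := mul_le_mul_of_nonneg_left (Real.rpow_le_rpow ht.1 ht.2 (by linarith : 0 ≤ δ))
      (abs_nonneg yD)
    linarith
  have hsame : ∀ t ∈ Icc 0 R, ∀ y ∈ Icc yB yD, ∀ x, powerCurve δ yB t ≤ x → |x| ≤ R →
      |f t (y * t ^ δ) - f t x| ≤ (C₂ + C₃) * |y * t ^ δ - x| ^ α := by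
    intro t ht y hy x hx hxR
    have hnn : 0 ≤ |y * t ^ δ - x| ^ α := Real.rpow_nonneg (abs_nonneg _) _
    rcases hdich t x hx with h | ⟨-, z, hz, rfl⟩
    · rw [hcurve _ _ ht.1] at h
      have hyD' : y * t ^ δ ≤ yD * t ^ δ :=
        mul_le_mul_of_nonneg_right hy.2 (Real.rpow_nonneg ht.1 _)
      have h1 := hsect t ht y hy yD hyDm
      have h2 := hr (t, yD * t ^ δ) (t, x) (hcurve _ _ ht.1).le (by rw [hcurve _ _ ht.1]; exact h)
        ((abs_of_nonneg ht.1).le.trans (ht.2.trans hRR')) (hyDR t ht)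
        ((abs_of_nonneg ht.1).le.trans (ht.2.trans hRR')) (hxR.trans hRR')
      rw [Prod.dist_eq, dist_self, Real.dist_eq, max_eq_right (abs_nonneg _)] at h2
      have h3 : |y * t ^ δ - yD * t ^ δ| ^ α ≤ |y * t ^ δ - x| ^ α := by
        refine Real.rpow_le_rpow (abs_nonneg _) ?_ hα.le
        rw [abs_of_nonpos (by linarith), abs_of_nonpos (by linarith)]; linarith
      have h4 : |yD * t ^ δ - x| ^ α ≤ |y * t ^ δ - x| ^ α := by
        refine Real.rpow_le_rpow (abs_nonneg _) ?_ hα.le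
        rw [abs_of_nonpos (by linarith), abs_of_nonpos (by linarith)]; linarith
      have h5 := abs_sub_le (f t (y * t ^ δ)) (f t (yD * t ^ δ)) (f t x)
      have h6 := mul_le_mul_of_nonneg_left h3 hC₂
      have h7 := mul_le_mul_of_nonneg_left h4 hC₃
      simp only at h2
      linarith
    · have := hsect t ht y hy z hz
      have := mul_nonneg hC₃ hnn
      linarith
  obtain ⟨L, hL, hlip⟩ := exists_holder_rpow (p := δ) zero_lt_one le_rfl hδ1 hR
  set B := 1 + |yB| * L with hB
  have hB0 : 0 ≤ B := by positivity
  -- one point in the sector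
  have hmain : ∀ p₁ p₂ : ℝ × ℝ, (0 < p₁.1 ∧ ∃ y ∈ Icc yB yD, p₁.2 = y * p₁.1 ^ δ) →
      powerCurve δ yB p₂.1 ≤ p₂.2 → |p₁.1| ≤ R → |p₁.2| ≤ R → |p₂.1| ≤ R → |p₂.2| ≤ R →
      |f p₁.1 p₁.2 - f p₂.1 p₂.2| ≤ (M * C₁ + (C₂ + C₃) * B ^ α + C₃) * dist p₁ p₂ ^ α := by
    rintro ⟨t₁, x₁⟩ ⟨t₂, x₂⟩ ⟨ht₁, y, hy, hx₁⟩ h₂ ht₁R hx₁R ht₂R hx₂R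
    simp only at *
    have hd1 : |t₁ - t₂| ≤ dist (t₁, x₁) (t₂, x₂) := by
      rw [← Real.dist_eq, Prod.dist_eq]; exact le_max_left _ _
    have hd2 : |x₁ - x₂| ≤ dist (t₁, x₁) (t₂, x₂) := by
      rw [← Real.dist_eq, Prod.dist_eq]; exact le_max_right _ _
    set D := dist (t₁, x₁) (t₂, x₂)
    have hD0 : 0 ≤ D := dist_nonneg
    have hDα : 0 ≤ D ^ α := Real.rpow_nonneg hD0 _
    have ht₁m : t₁ ∈ Icc 0 R := ⟨ht₁.le, (le_abs_self _).trans ht₁R⟩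
    have hMC : 0 ≤ M * C₁ := mul_nonneg hM0 hC₁
    have hBα : 0 ≤ B ^ α := Real.rpow_nonneg hB0 _
    rcases le_or_gt 0 t₂ with ht₂ | ht₂
    · have ht₂m : t₂ ∈ Icc 0 R := ⟨ht₂, (le_abs_self _).trans ht₂R⟩
      have h3 := hray t₁ ht₁m t₂ ht₂m y hy
      have h4 := hsame t₂ ht₂m y hy x₂ h₂ hx₂R
      have h5 := mul_le_mul_of_nonneg_left (Real.rpow_le_rpow (abs_nonneg _) hd1 hα.le) hMC
      have h6 : |y * t₂ ^ δ - x₂| ≤ B * D := by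
        have e1 := abs_sub_le (y * t₂ ^ δ) x₁ x₂
        have e2 : |y * t₂ ^ δ - x₁| ≤ |yB| * (L * D) := by
          rw [hx₁, ← mul_sub, abs_mul]
          refine mul_le_mul ?_ ?_ (abs_nonneg _) (abs_nonneg _)
          · rw [abs_of_neg (by linarith [hy.2]), abs_of_neg (by linarith)]
            linarith [hy.1]
          · have := hlip t₂ ht₂m t₁ ht₁m
            rw [Real.rpow_one, abs_sub_comm t₂] at this
            exact this.trans (mul_le_mul_of_nonneg_left hd1 hL)
        rw [hB]; nlinarith
      have h7 : (C₂ + C₃) * |y * t₂ ^ δ - x₂| ^ α ≤ (C₂ + C₃) * (B ^ α * D ^ α) := by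
        rw [← Real.mul_rpow hB0 hD0]
        exact mul_le_mul_of_nonneg_left (Real.rpow_le_rpow (abs_nonneg _) h6 hα.le) (by linarith)
      have h8 := abs_sub_le (f t₁ x₁) (f t₂ (y * t₂ ^ δ)) (f t₂ x₂)
      rw [← hx₁] at h3
      have h10 : 0 ≤ C₃ * D ^ α := mul_nonneg hC₃ hDα
      have e : (M * C₁ + (C₂ + C₃) * B ^ α + C₃) * D ^ α =
          M * C₁ * D ^ α + (C₂ + C₃) * (B ^ α * D ^ α) + C₃ * D ^ α := by ring
      rw [e]
      linarith
    · have h0m : (0 : ℝ) ∈ Icc 0 R := ⟨le_rfl, hR⟩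
      have h3 := hray t₁ ht₁m 0 h0m y hy
      rw [← hx₁, Real.zero_rpow (by linarith : δ ≠ 0), mul_zero, sub_zero] at h3
      have hx₂ : 0 ≤ x₂ := by rwa [powerCurve, if_pos ht₂] at h₂
      have hx₁0 : x₁ ≤ 0 := by
        rw [hx₁]
        exact mul_nonpos_of_nonpos_of_nonneg (by linarith [hy.2]) (Real.rpow_nonneg ht₁.le _)
      have h4 := hr (0, 0) (t₂, x₂)
        (by rw [hcurve _ _ le_rfl, Real.zero_rpow (by linarith : δ ≠ 0), mul_zero])
        (by rw [powerCurve, if_pos ht₂]; exact hx₂) (by simp; linarith) (by simp; linarith)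
        (ht₂R.trans hRR') (hx₂R.trans hRR')
      have h5 : dist ((0 : ℝ), (0 : ℝ)) (t₂, x₂) ≤ D := by
        rw [Prod.dist_eq, Real.dist_eq, Real.dist_eq]
        refine max_le ?_ ?_
        · refine le_trans ?_ hd1
          rw [abs_of_nonneg (by linarith), abs_of_nonneg (by linarith)]; linarith
        · refine le_trans ?_ hd2
          rw [abs_of_nonpos (by linarith), abs_of_nonpos (by linarith)]; linarith
      have h6 := mul_le_mul_of_nonneg_left (Real.rpow_le_rpow dist_nonneg h5 hα.le) hC₃
      have h7 : |t₁| ≤ D := by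
        refine le_trans ?_ hd1
        rw [abs_of_pos ht₁, abs_of_nonneg (by linarith)]; linarith
      have h8 := mul_le_mul_of_nonneg_left (Real.rpow_le_rpow (abs_nonneg _) h7 hα.le) hMC
      have h9 := abs_sub_le (f t₁ x₁) (f 0 0) (f t₂ x₂)
      simp only at h4
      have h10 : 0 ≤ (C₂ + C₃) * B ^ α * D ^ α :=
        mul_nonneg (mul_nonneg (add_nonneg hC₂ hC₃) hBα) hDα
      have e : (M * C₁ + (C₂ + C₃) * B ^ α + C₃) * D ^ α =
          M * C₁ * D ^ α + (C₂ + C₃) * B ^ α * D ^ α + C₃ * D ^ α := by ring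
      rw [e]
      linarith
  refine ⟨M * C₁ + (C₂ + C₃) * B ^ α + C₃, by positivity,
    fun p₁ p₂ h₁ h₂ ht₁ hx₁ ht₂ hx₂ => ?_⟩
  rcases hdich _ _ h₁ with h₁' | h₁'
  · rcases hdich _ _ h₂ with h₂' | h₂'
    · have := hr p₁ p₂ h₁' h₂' (ht₁.trans hRR') (hx₁.trans hRR') (ht₂.trans hRR') (hx₂.trans hRR')
      have h3 : 0 ≤ dist p₁ p₂ ^ α := Real.rpow_nonneg dist_nonneg _
      have h4 : 0 ≤ (M * C₁ + (C₂ + C₃) * B ^ α) * dist p₁ p₂ ^ α := by positivity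
      linarith
    · rw [abs_sub_comm, dist_comm]
      exact hmain p₂ p₁ h₂' h₁ ht₂ hx₂ ht₁ hx₁
  · exact hmain p₁ p₂ h₁' h₂ ht₁ hx₁ ht₂ hx₂

/-! ### Local Lipschitz continuity across a kink -/

/-- `f` is Lipschitz continuous near the point `x`. -/
def LipschitzNear {E F : Type*} [PseudoEMetricSpace E] [PseudoEMetricSpace F] (f : E → F) (x : E) :
    Prop :=
  ∃ C : ℝ≥0, ∃ V ∈ 𝓝 x, LipschitzOnWith C f V

namespace LipschitzNear

variable {E F G : Type*} [PseudoEMetricSpace E] [PseudoEMetricSpace F] [PseudoEMetricSpace G]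

lemma continuousAt {f : E → F} {x : E} (h : LipschitzNear f x) : ContinuousAt f x := by
  obtain ⟨C, V, hV, hf⟩ := h
  exact hf.continuousOn.continuousAt hV

lemma comp {g : F → G} {f : E → F} {x : E} (hg : LipschitzNear g (f x)) (hf : LipschitzNear f x) :
    LipschitzNear (fun z => g (f z)) x := by
  have hc := hf.continuousAt
  obtain ⟨C, V, hV, hf⟩ := hf
  obtain ⟨C', V', hV', hg⟩ := hg
  exact ⟨C' * C, V ∩ f ⁻¹' V', inter_mem hV (hc hV'),
    hg.comp (hf.mono inter_subset_left) fun z hz => hz.2⟩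

lemma prodMk {f : E → F} {g : E → G} {x : E} (hf : LipschitzNear f x) (hg : LipschitzNear g x) :
    LipschitzNear (fun z => (f z, g z)) x := by
  obtain ⟨C, V, hV, hf⟩ := hf
  obtain ⟨C', V', hV', hg⟩ := hg
  exact ⟨max C C', V ∩ V', inter_mem hV hV',
    (hf.mono inter_subset_left).prodMk (hg.mono inter_subset_right)⟩

lemma congr {f g : E → F} {x : E} (hf : LipschitzNear f x) (h : g =ᶠ[𝓝 x] f) :
    LipschitzNear g x := by
  obtain ⟨C, V, hV, hf⟩ := hf
  refine ⟨C, V ∩ {z | g z = f z}, inter_mem hV h, fun y hy z hz => ?_⟩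
  rw [hy.2, hz.2]
  exact hf hy.1 hz.1

end LipschitzNear

lemma ContDiffAt.lipschitzNear {E F : Type*} [NormedAddCommGroup E] [NormedSpace ℝ E]
    [NormedAddCommGroup F] [NormedSpace ℝ F] {f : E → F} {x : E} (h : ContDiffAt ℝ 1 f x) :
    LipschitzNear f x :=
  h.exists_lipschitzOnWith

/-- A continuous function whose derivative has one-sided limits is Lipschitz near the point. -/
lemma lipschitzNear_of_tendsto_deriv {f : ℝ → ℝ} {p l r : ℝ} (hf : ∀ᶠ x in 𝓝 p, ContinuousAt f x)
    (hdl : ∀ᶠ x in 𝓝[<] p, DifferentiableAt ℝ f x) (hdr : ∀ᶠ x in 𝓝[>] p, DifferentiableAt ℝ f x)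
    (hl : Tendsto (deriv f) (𝓝[<] p) (𝓝 l)) (hr : Tendsto (deriv f) (𝓝[>] p) (𝓝 r)) :
    LipschitzNear f p := by
  set M := max (|l| + 1) (|r| + 1) with hM
  have hM0 : 0 ≤ M := le_trans (by positivity) (le_max_left _ _)
  have bl : ∀ᶠ x in 𝓝[<] p, |deriv f x| ≤ M :=
    (hl.abs.eventually (gt_mem_nhds (lt_add_one |l|))).mono
      fun x hx => hx.le.trans (le_max_left _ _)
  have br : ∀ᶠ x in 𝓝[>] p, |deriv f x| ≤ M :=
    (hr.abs.eventually (gt_mem_nhds (lt_add_one |r|))).mono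
      fun x hx => hx.le.trans (le_max_right _ _)
  obtain ⟨a, ha, hal⟩ := (mem_nhdsLT_iff_exists_Ioo_subset).1 (hdl.and bl)
  obtain ⟨b, hb, hbr⟩ := (mem_nhdsGT_iff_exists_Ioo_subset).1 (hdr.and br)
  obtain ⟨ε, hε, hcont⟩ := Metric.eventually_nhds_iff_ball.1 hf
  have ha' : a < p := ha
  have hb' : p < b := hb
  set a' := max a (p - ε / 2) with ha'def
  set b' := min b (p + ε / 2) with hb'def
  have hap : a' < p := max_lt ha' (by linarith)
  have hpb : p < b' := lt_min hb' (by linarith)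
  have hcI : ContinuousOn f (Icc a' b') := fun x hx => by
    refine (hcont x ?_).continuousWithinAt
    rw [Metric.mem_ball, Real.dist_eq, abs_lt]
    have h1 := (le_max_right a (p - ε / 2)).trans hx.1
    have h2 := hx.2.trans (min_le_right b (p + ε / 2))
    constructor <;> linarith
  have hL : ∀ x ∈ Icc a' p, ∀ y ∈ Icc a' p, |f x - f y| ≤ M * |x - y| := fun x hx y hy =>
    abs_sub_le_of_abs_deriv_le (hcI.mono (Icc_subset_Icc le_rfl hpb.le))
      (fun z hz => (hal ⟨(le_max_left _ _).trans_lt hz.1, hz.2⟩).1.hasDerivAt)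
      (fun z hz => (hal ⟨(le_max_left _ _).trans_lt hz.1, hz.2⟩).2) hx hy
  have hR : ∀ x ∈ Icc p b', ∀ y ∈ Icc p b', |f x - f y| ≤ M * |x - y| := fun x hx y hy =>
    abs_sub_le_of_abs_deriv_le (hcI.mono (Icc_subset_Icc hap.le le_rfl))
      (fun z hz => (hbr ⟨hz.1, hz.2.trans_le (min_le_left _ _)⟩).1.hasDerivAt)
      (fun z hz => (hbr ⟨hz.1, hz.2.trans_le (min_le_left _ _)⟩).2) hx hy
  refine ⟨⟨M, hM0⟩, Icc a' b', Icc_mem_nhds hap hpb, LipschitzOnWith.of_dist_le_mul ?_⟩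
  intro x hx y hy
  rw [Real.dist_eq, Real.dist_eq]
  change |f x - f y| ≤ M * |x - y|
  wlog hxy : x ≤ y generalizing x y
  · rw [abs_sub_comm, abs_sub_comm x]
    exact this y hy x hx (le_of_not_ge hxy)
  rcases le_total y p with h1 | h1
  · exact hL x ⟨hx.1, hxy.trans h1⟩ y ⟨hy.1, h1⟩
  rcases le_total p x with h2 | h2
  · exact hR x ⟨h2, hx.2⟩ y ⟨h1, hy.2⟩
  have e1 := hL x ⟨hx.1, h2⟩ p ⟨hap.le, le_rfl⟩
  have e2 := hR p ⟨le_rfl, hpb.le⟩ y ⟨h1, hy.2⟩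
  have e3 := abs_sub_le (f x) (f p) (f y)
  rw [abs_of_nonpos (by linarith : x - p ≤ 0)] at e1
  rw [abs_of_nonpos (by linarith : p - y ≤ 0)] at e2
  rw [abs_of_nonpos (by linarith : x - y ≤ 0)]
  linarith

/-! ### The Riemann variables of the flow -/

/-- A pair of Riemann variables `r ≤ ℓ` on the closed fluid region `powerCurve (1 + 1 / q) yB t ≤ x`,
with vacuum where `r = ℓ`. They satisfy `r_t = (a r + (1 - a) ℓ) r_x` and
`ℓ_t = (a ℓ + (1 - a) r) ℓ_x` off the sonic curve `x = yD t ^ (1 + 1 / q)`, form a simple wave with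
`r = 0` to the right of that curve, and `r` has a kink on it. -/
structure IsRiemannFlow (a q d K yB yD : ℝ) (r ℓ : ℝ → ℝ → ℝ) : Prop where
  yB_lt : yB < yD
  yD_neg : yD < 0
  right : ∀ t x, powerCurve (1 + 1 / q) yD t ≤ x → r t x = 0 ∧ IsSimpleWave a q d K t x (ℓ t x)
  scaling : ∀ s t x, 0 < s → powerCurve (1 + 1 / q) yB t ≤ x →
    r (s * t) (s ^ (1 + 1 / q) * x) = s ^ (1 / q) * r t x ∧
    ℓ (s * t) (s ^ (1 + 1 / q) * x) = s ^ (1 / q) * ℓ t x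
  nonneg : ∀ t x, powerCurve (1 + 1 / q) yB t ≤ x → 0 ≤ r t x ∧ r t x ≤ ℓ t x
  lt : ∀ t x, powerCurve (1 + 1 / q) yB t < x → r t x < ℓ t x
  vacuum : ∀ t, r t (powerCurve (1 + 1 / q) yB t) = ℓ t (powerCurve (1 + 1 / q) yB t)
  kinematic : ∀ t, 0 ≤ t → ℓ t (yB * t ^ (1 + 1 / q)) = -((1 + 1 / q) * yB) * t ^ (1 / q)
  l_pos : ∀ t x, 0 < t → powerCurve (1 + 1 / q) yB t ≤ x → 0 < ℓ t x
  sonic : (1 + 1 / q) * yD = -((1 - a) * ℓ 1 yD)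
  smooth : ∀ t x, powerCurve (1 + 1 / q) yB t < x → x ≠ powerCurve (1 + 1 / q) yD t →
    ContDiffAt ℝ ∞ (fun p : ℝ × ℝ => r p.1 p.2) (t, x) ∧
    ContDiffAt ℝ ∞ (fun p : ℝ × ℝ => ℓ p.1 p.2) (t, x)
  transport : ∀ t x, powerCurve (1 + 1 / q) yB t < x → x ≠ powerCurve (1 + 1 / q) yD t →
    ∃ rx lx : ℝ, HasDerivAt (r t) rx x ∧
      HasDerivAt (fun s => r s x) ((a * r t x + (1 - a) * ℓ t x) * rx) t ∧
      HasDerivAt (ℓ t) lx x ∧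
      HasDerivAt (fun s => ℓ s x) ((a * ℓ t x + (1 - a) * r t x) * lx) t
  holder : ∃ α : ℝ, 0 < α ∧ α ≤ 1 ∧ ∀ R : ℝ, ∃ C : ℝ, 0 ≤ C ∧ ∀ p₁ p₂ : ℝ × ℝ,
    powerCurve (1 + 1 / q) yB p₁.1 ≤ p₁.2 → powerCurve (1 + 1 / q) yB p₂.1 ≤ p₂.2 →
    |p₁.1| ≤ R → |p₁.2| ≤ R → |p₂.1| ≤ R → |p₂.2| ≤ R →
    |r p₁.1 p₁.2 - r p₂.1 p₂.2| ≤ C * dist p₁ p₂ ^ α ∧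
    |ℓ p₁.1 p₁.2 - ℓ p₂.1 p₂.2| ≤ C * dist p₁ p₂ ^ α
  lipschitz : ∀ t, 0 < t →
    LipschitzNear (fun p : ℝ × ℝ => r p.1 p.2) (t, yD * t ^ (1 + 1 / q)) ∧
    LipschitzNear (fun p : ℝ × ℝ => ℓ p.1 p.2) (t, yD * t ^ (1 + 1 / q))
  kink : ∀ t, 0 < t → ∃ κ lx : ℝ, κ ≠ 0 ∧
    Tendsto (fun p : ℝ × ℝ => deriv (r p.1) p.2)
      (𝓝[regionLeft (1 + 1 / q) yB yD] (t, yD * t ^ (1 + 1 / q))) (𝓝 κ) ∧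
    Tendsto (fun p : ℝ × ℝ => deriv (r p.1) p.2)
      (𝓝[regionRight (1 + 1 / q) yD] (t, yD * t ^ (1 + 1 / q))) (𝓝 0) ∧
    Tendsto (fun p : ℝ × ℝ => deriv (ℓ p.1) p.2)
      (𝓝[regionLeft (1 + 1 / q) yB yD] (t, yD * t ^ (1 + 1 / q))) (𝓝 lx) ∧
    Tendsto (fun p : ℝ × ℝ => deriv (ℓ p.1) p.2)
      (𝓝[regionRight (1 + 1 / q) yD] (t, yD * t ^ (1 + 1 / q))) (𝓝 lx)
  physical : ∀ t, 0 < t → ∃ κ > 0,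
    HasDerivWithinAt (fun x => (ℓ t x - r t x) ^ 2) κ (Ici (powerCurve (1 + 1 / q) yB t))
      (powerCurve (1 + 1 / q) yB t)

lemma powerCurve_of_nonneg {δ y t : ℝ} (ht : 0 ≤ t) : powerCurve δ y t = y * t ^ δ := by
  rw [powerCurve, if_neg (not_lt.2 ht)]

lemma powerCurve_of_nonpos {δ y t : ℝ} (hδ : δ ≠ 0) (ht : t ≤ 0) : powerCurve δ y t = 0 := by
  rcases ht.eq_or_lt with rfl | ht
  · rw [powerCurve_of_nonneg le_rfl, Real.zero_rpow hδ, mul_zero]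
  · rw [powerCurve, if_pos ht]

lemma continuous_powerCurve {δ : ℝ} (hδ : 0 < δ) (y : ℝ) : Continuous (powerCurve δ y) := by
  have : powerCurve δ y = fun t => y * max t 0 ^ δ := by
    funext t
    rcases le_total 0 t with h | h
    · rw [powerCurve_of_nonneg h, max_eq_left h]
    · rw [powerCurve_of_nonpos hδ.ne' h, max_eq_right h, Real.zero_rpow hδ.ne', mul_zero]
  rw [this]
  exact continuous_const.mul
    ((Real.continuous_rpow_const hδ.le).comp (continuous_id.max continuous_const))

/-- The function which equals `t ^ (1 / q) g (x / t ^ (1 + 1 / q))` to the left of the curve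
`x = yD t ^ (1 + 1 / q)`, `t > 0`, and `w` elsewhere. -/
noncomputable def glue (q yD : ℝ) (g : ℝ → ℝ) (w : ℝ → ℝ → ℝ) (t x : ℝ) : ℝ :=
  open scoped Classical in
  if 0 < t ∧ x < yD * t ^ (1 + 1 / q) then t ^ (1 / q) * g (x / t ^ (1 + 1 / q)) else w t x

section Glue

variable {q yB yD : ℝ} {g : ℝ → ℝ} {w : ℝ → ℝ → ℝ}

lemma glue_of_le {t x : ℝ} (h : powerCurve (1 + 1 / q) yD t ≤ x) :
    glue q yD g w t x = w t x := by
  rw [glue, if_neg]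
  rintro ⟨ht, hx⟩
  rw [powerCurve_of_nonneg ht.le] at h
  linarith

lemma glue_of_lt {t x : ℝ} (ht : 0 < t) (h : x < yD * t ^ (1 + 1 / q)) :
    glue q yD g w t x = t ^ (1 / q) * g (x / t ^ (1 + 1 / q)) := by
  rw [glue, if_pos ⟨ht, h⟩]

/-- Points of the fluid region which do not belong to the closed region of the simple wave. -/
lemma mem_sector_of_lt (hq : 0 < q) {t x : ℝ} (hB : powerCurve (1 + 1 / q) yB t ≤ x)
    (hD : x < powerCurve (1 + 1 / q) yD t) : 0 < t ∧ x < yD * t ^ (1 + 1 / q) ∧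
      x / t ^ (1 + 1 / q) ∈ Ico yB yD := by
  have hδ : (1 + 1 / q) ≠ 0 := by positivity
  have ht : 0 < t := by
    by_contra hcon
    rw [powerCurve_of_nonpos hδ (not_lt.1 hcon)] at hB hD
    linarith
  rw [powerCurve_of_nonneg ht.le] at hB hD
  have hp := Real.rpow_pos_of_pos ht (1 + 1 / q)
  exact ⟨ht, hD, by rwa [le_div_iff₀ hp], by rwa [div_lt_iff₀ hp]⟩

lemma glue_scaling (hq : 0 < q)
    (hw : ∀ s t x, 0 < s → powerCurve (1 + 1 / q) yD t ≤ x →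
      w (s * t) (s ^ (1 + 1 / q) * x) = s ^ (1 / q) * w t x) {s t x : ℝ} (hs : 0 < s)
    (hx : powerCurve (1 + 1 / q) yB t ≤ x) :
    glue q yD g w (s * t) (s ^ (1 + 1 / q) * x) = s ^ (1 / q) * glue q yD g w t x := by
  have hsp := Real.rpow_pos_of_pos hs (1 + 1 / q)
  rcases le_or_gt (powerCurve (1 + 1 / q) yD t) x with h | h
  · have h' : powerCurve (1 + 1 / q) yD (s * t) ≤ s ^ (1 + 1 / q) * x := by
      rcases le_or_gt 0 t with ht | ht
      · rw [powerCurve_of_nonneg ht] at h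
        rw [powerCurve_of_nonneg (by positivity), Real.mul_rpow hs.le ht]
        nlinarith
      · rw [powerCurve, if_pos ht] at h
        rw [powerCurve, if_pos (mul_neg_of_pos_of_neg hs ht)]
        positivity
    rw [glue_of_le h, glue_of_le h', hw s t x hs h]
  · obtain ⟨ht, hxD, -⟩ := mem_sector_of_lt hq hx h
    have htp := Real.rpow_pos_of_pos ht (1 + 1 / q)
    rw [glue_of_lt ht hxD, glue_of_lt (mul_pos hs ht), Real.mul_rpow hs.le ht.le,
      Real.mul_rpow hs.le ht.le, mul_div_mul_left _ _ hsp.ne', mul_assoc]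
    rw [Real.mul_rpow hs.le ht.le]
    nlinarith

lemma glue_curve (hq : 0 < q) (hBD : yB < yD)
    (hwD : ∀ t, 0 ≤ t → w t (yD * t ^ (1 + 1 / q)) = t ^ (1 / q) * g yD) (hw0 : w 0 0 = 0) {t : ℝ}
    (ht : 0 ≤ t) {y : ℝ} (hy : y ∈ Icc yB yD) :
    glue q yD g w t (y * t ^ (1 + 1 / q)) = t ^ (1 / q) * g y := by
  have hδ : (1 + 1 / q) ≠ 0 := by positivity
  rcases ht.eq_or_lt with rfl | ht
  · rw [Real.zero_rpow hδ, mul_zero, Real.zero_rpow (by positivity), zero_mul,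
      glue_of_le (by rw [powerCurve_of_nonpos hδ le_rfl]), hw0]
  have htp := Real.rpow_pos_of_pos ht (1 + 1 / q)
  rcases hy.2.eq_or_lt with rfl | hlt
  · rw [glue_of_le (by rw [powerCurve_of_nonneg ht.le]), hwD t ht.le]
  · rw [glue_of_lt ht (mul_lt_mul_of_pos_right hlt htp), mul_div_cancel_right₀ _ htp.ne']

lemma glue_eventuallyEq_left (hq : 0 < q) {t x : ℝ} (ht : 0 < t)
    (hx : x < yD * t ^ (1 + 1 / q)) : ∀ᶠ p : ℝ × ℝ in 𝓝 (t, x),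
      glue q yD g w p.1 p.2 = p.1 ^ (1 / q) * g (p.2 / p.1 ^ (1 + 1 / q)) := by
  have hc : Continuous fun p : ℝ × ℝ => p.1 ^ (1 + 1 / q) :=
    (Real.continuous_rpow_const (by positivity)).comp continuous_fst
  filter_upwards [(isOpen_lt continuous_const continuous_fst).mem_nhds
    (show (0 : ℝ) < ((t, x) : ℝ × ℝ).1 from ht),
    (isOpen_lt continuous_snd (continuous_const.mul hc)).mem_nhds
      (show ((t, x) : ℝ × ℝ).2 < yD * ((t, x) : ℝ × ℝ).1 ^ (1 + 1 / q) from hx)] with p h1 h2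
  exact glue_of_lt h1 h2

lemma glue_eventuallyEq_right (hq : 0 < q) {t x : ℝ} (hx : powerCurve (1 + 1 / q) yD t < x) :
    ∀ᶠ p : ℝ × ℝ in 𝓝 (t, x), glue q yD g w p.1 p.2 = w p.1 p.2 := by
  have hδ : 0 < 1 + 1 / q := by positivity
  filter_upwards [(isOpen_lt ((continuous_powerCurve hδ yD).comp continuous_fst)
    continuous_snd).mem_nhds (show powerCurve _ yD ((t, x) : ℝ × ℝ).1 < _ from hx)] with p h1
  exact glue_of_le (le_of_lt h1)

/-- The derivatives of a homogeneous function in terms of its profile. -/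
lemma hasDerivAt_profile (hq : 0 < q) {t x g' : ℝ} (ht : 0 < t)
    (hg : HasDerivAt g g' (x / t ^ (1 + 1 / q))) :
    HasDerivAt (fun z => t ^ (1 / q) * g (z / t ^ (1 + 1 / q))) (g' / t) x ∧
    HasDerivAt (fun s => s ^ (1 / q) * g (x / s ^ (1 + 1 / q)))
      (t ^ (1 / q) / t * (g (x / t ^ (1 + 1 / q)) / q -
        (1 + 1 / q) * (x / t ^ (1 + 1 / q)) * g')) t := by
  have htq := (Real.rpow_pos_of_pos ht (1 / q)).ne'
  have htd := (Real.rpow_pos_of_pos ht (1 + 1 / q)).ne'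
  have e : t ^ (1 + 1 / q) = t * t ^ (1 / q) := by rw [Real.rpow_add ht, Real.rpow_one]
  constructor
  · have h1 : HasDerivAt (fun z : ℝ => z / t ^ (1 + 1 / q)) (1 / t ^ (1 + 1 / q)) x :=
      (hasDerivAt_id x).div_const _
    have h2 := (hg.comp x h1).const_mul (t ^ (1 / q))
    convert! h2 using 1
    rw [e]
    field_simp
  · have h1 : HasDerivAt (fun s : ℝ => s ^ (1 + 1 / q)) ((1 + 1 / q) * t ^ (1 + 1 / q - 1)) t :=
      Real.hasDerivAt_rpow_const (Or.inl ht.ne')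
    have h2 : HasDerivAt (fun s : ℝ => s ^ (1 / q)) (1 / q * t ^ (1 / q - 1)) t :=
      Real.hasDerivAt_rpow_const (Or.inl ht.ne')
    have h3 : HasDerivAt (fun s : ℝ => x / s ^ (1 + 1 / q)) _ t :=
      (hasDerivAt_const t x).div h1 htd
    have h4 := h2.mul (hg.comp t h3)
    convert! h4 using 1
    simp only [Function.comp, add_sub_cancel_left]
    rw [Real.rpow_sub_one ht.ne', e]
    field_simp
    ring

end Glue

/-- The data from which the flow is glued: the constants of the simple wave, and the profile of the
flow between the vacuum boundary and the sonic curve. The relation between `a`, `q` and `d` says that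
the curve `d t = K ℓ ^ q` is a characteristic of the variable `r`. -/
structure IsGlueData (a q d K yB yD : ℝ) (rp lp : ℝ → ℝ) : Prop where
  half_lt : 1 / 2 < a
  lt_one : a < 1
  wave : SimpleWaveConstants a q d K
  d_eq : (q + 1) * d = a + q * (2 * a - 1)
  profile : IsRarefactionProfile a q ((d / K) ^ (1 / q)) yB yD rp lp

namespace IsGlueData

variable {a q d K yB yD : ℝ} {rp lp : ℝ → ℝ}

lemma yD_eq (h : IsGlueData a q d K yB yD rp lp) : (d - a) * (d / K) ^ (1 / q) = yD := by
  have hq := h.wave.q_pos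
  have h1 := h.profile.sonic
  have h2 : (q + 1) * (d - a) = -(q * (1 - a)) := by linear_combination h.d_eq
  have h3 : (1 + 1 / q) * ((d - a) * (d / K) ^ (1 / q)) = (1 + 1 / q) * yD := by
    rw [h1]
    have : (1 + 1 / q) * (d - a) = -(1 - a) := by
      field_simp
      linear_combination h2
    linear_combination (d / K) ^ (1 / q) * this
  exact mul_left_cancel₀ (by positivity) h3

lemma sonic_pos (h : IsGlueData a q d K yB yD rp lp) : 0 < (d / K) ^ (1 / q) :=
  Real.rpow_pos_of_pos (div_pos h.wave.d_pos h.wave.K_pos) _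

lemma yD_neg (h : IsGlueData a q d K yB yD rp lp) : yD < 0 := by
  have hq := h.wave.q_pos
  have h1 := h.profile.sonic
  have h2 := mul_pos (sub_pos.2 h.lt_one) h.sonic_pos
  have h3 : 0 < 1 + 1 / q := by positivity
  nlinarith

lemma isSimpleWave (h : IsGlueData a q d K yB yD rp lp) {t x : ℝ}
    (hx : powerCurve (1 + 1 / q) yD t ≤ x) :
    IsSimpleWave a q d K t x (simpleWave a q d K t x) :=
  h.wave.isSimpleWave (by rw [h.yD_eq]; exact hx)

lemma simpleWave_sonic (h : IsGlueData a q d K yB yD rp lp) {t : ℝ} (ht : 0 ≤ t) :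
    simpleWave a q d K t (yD * t ^ (1 + 1 / q)) = t ^ (1 / q) * lp yD := by
  have := h.wave.simpleWave_eq (h.wave.isSimpleWave_sonic ht)
  rw [h.yD_eq] at this
  rw [this, h.profile.l_sonic, mul_comm]

lemma simpleWave_zero (h : IsGlueData a q d K yB yD rp lp) : simpleWave a q d K 0 0 = 0 := by
  have hq := h.wave.q_pos
  have := h.simpleWave_sonic le_rfl
  rwa [Real.zero_rpow (by positivity), mul_zero, Real.zero_rpow (by positivity), zero_mul] at this

lemma simpleWave_scaling (h : IsGlueData a q d K yB yD rp lp) (s t x : ℝ) (hs : 0 < s)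
    (hx : powerCurve (1 + 1 / q) yD t ≤ x) :
    simpleWave a q d K (s * t) (s ^ (1 + 1 / q) * x) = s ^ (1 / q) * simpleWave a q d K t x :=
  h.wave.simpleWave_eq (h.wave.scaling hs (h.isSimpleWave hx))

lemma glueL_curve (h : IsGlueData a q d K yB yD rp lp) {t : ℝ} (ht : 0 ≤ t) {y : ℝ}
    (hy : y ∈ Icc yB yD) :
    glue q yD lp (simpleWave a q d K) t (y * t ^ (1 + 1 / q)) = t ^ (1 / q) * lp y :=
  glue_curve h.wave.q_pos h.profile.lt (fun _ => h.simpleWave_sonic) h.simpleWave_zero ht hy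

lemma glueR_curve (h : IsGlueData a q d K yB yD rp lp) {t : ℝ} (ht : 0 ≤ t) {y : ℝ}
    (hy : y ∈ Icc yB yD) :
    glue q yD rp (fun _ _ => 0) t (y * t ^ (1 + 1 / q)) = t ^ (1 / q) * rp y :=
  glue_curve h.wave.q_pos h.profile.lt (fun t _ => by rw [h.profile.r_sonic, mul_zero]) rfl ht hy

lemma holder (h : IsGlueData a q d K yB yD rp lp) : ∃ α : ℝ, 0 < α ∧ α ≤ 1 ∧
    ∀ R : ℝ, ∃ C : ℝ, 0 ≤ C ∧ ∀ p₁ p₂ : ℝ × ℝ,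
    powerCurve (1 + 1 / q) yB p₁.1 ≤ p₁.2 → powerCurve (1 + 1 / q) yB p₂.1 ≤ p₂.2 →
    |p₁.1| ≤ R → |p₁.2| ≤ R → |p₂.1| ≤ R → |p₂.2| ≤ R →
    |glue q yD rp (fun _ _ => 0) p₁.1 p₁.2 - glue q yD rp (fun _ _ => 0) p₂.1 p₂.2| ≤
      C * dist p₁ p₂ ^ α ∧
    |glue q yD lp (simpleWave a q d K) p₁.1 p₁.2 - glue q yD lp (simpleWave a q d K) p₂.1 p₂.2| ≤
      C * dist p₁ p₂ ^ α := by
  have hq := h.wave.q_pos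
  obtain ⟨C₀, hC₀, hC⟩ := h.profile.holder
  have hα : 0 < min (1 / 2) (1 / (q + 1)) := lt_min (by norm_num) (by positivity)
  refine ⟨min (1 / 2) (1 / (q + 1)), hα, (min_le_left _ _).trans (by norm_num), fun R => ?_⟩
  obtain ⟨C₁, hC₁, h1⟩ := holder_of_sector hq h.profile.lt h.yD_neg hα (min_le_left _ _)
    (min_le_right _ _) (f := glue q yD rp (fun _ _ => 0)) (fun t ht y hy => h.glueR_curve ht hy) hC₀
    (fun y hy z hz => (hC y hy z hz).1)
    (fun R => ⟨0, le_rfl, fun p₁ p₂ h1 h2 _ _ _ _ => by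
      rw [glue_of_le h1, glue_of_le h2]; simp⟩) R
  obtain ⟨C₂, hC₂, h2⟩ := holder_of_sector hq h.profile.lt h.yD_neg hα (min_le_left _ _)
    (min_le_right _ _) (f := glue q yD lp (simpleWave a q d K)) (fun t ht y hy => h.glueL_curve ht hy)
    hC₀ (fun y hy z hz => (hC y hy z hz).2)
    (fun R => by
      obtain ⟨C, hC, hh⟩ := h.wave.simpleWave_holder R
      refine ⟨C * (2 * |R|) ^ (1 / (q + 1) - min (1 / 2) (1 / (q + 1))), by positivity,
        fun p₁ p₂ h1 h2 a1 a2 a3 a4 => ?_⟩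
      rw [glue_of_le h1, glue_of_le h2]
      refine (hh p₁ p₂ (by rw [h.yD_eq]; exact h1) (by rw [h.yD_eq]; exact h2) a1 a2 a3 a4).trans ?_
      rw [mul_assoc]
      refine mul_le_mul_of_nonneg_left ?_ hC
      refine Real.rpow_le_mul_rpow_of_le dist_nonneg ?_ hα.le (min_le_right _ _)
      rw [Prod.dist_eq, Real.dist_eq, Real.dist_eq]
      have e1 := abs_sub p₁.1 p₂.1
      have e2 := abs_sub p₁.2 p₂.2
      have e3 := le_abs_self R
      exact max_le (by linarith) (by linarith)) R
  refine ⟨C₁ + C₂, by positivity, fun p₁ p₂ a1 a2 a3 a4 a5 a6 => ?_⟩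
  have hD : 0 ≤ dist p₁ p₂ ^ min (1 / 2) (1 / (q + 1)) := Real.rpow_nonneg dist_nonneg _
  have e1 := h1 p₁ p₂ a1 a2 a3 a4 a5 a6
  have e2 := h2 p₁ p₂ a1 a2 a3 a4 a5 a6
  have e3 := mul_nonneg hC₁ hD
  have e4 := mul_nonneg hC₂ hD
  constructor <;> linarith

/-- In the sector, the flow has its homogeneous form in a neighbourhood. -/
lemma contDiffAt_sector (h : IsGlueData a q d K yB yD rp lp) {g : ℝ → ℝ} {w : ℝ → ℝ → ℝ}
    (hg : ContDiffOn ℝ ∞ g (Ioo yB yD)) {t x : ℝ} (ht : 0 < t) (hxD : x < yD * t ^ (1 + 1 / q))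
    (hxB : yB * t ^ (1 + 1 / q) < x) :
    ContDiffAt ℝ ∞ (fun p : ℝ × ℝ => glue q yD g w p.1 p.2) (t, x) := by
  have hp := Real.rpow_pos_of_pos ht (1 + 1 / q)
  have hy : x / t ^ (1 + 1 / q) ∈ Ioo yB yD := ⟨by rwa [lt_div_iff₀ hp], by rwa [div_lt_iff₀ hp]⟩
  refine ContDiffAt.congr_of_eventuallyEq ?_ (glue_eventuallyEq_left h.wave.q_pos ht hxD)
  have h1 : ∀ p : ℝ, ContDiffAt ℝ ∞ (fun z : ℝ × ℝ => z.1 ^ p) (t, x) := fun p =>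
    contDiffAt_fst.rpow_const_of_ne ht.ne'
  refine (h1 _).mul ?_
  have h2 : ContDiffAt ℝ ∞ (fun z : ℝ × ℝ => z.2 / z.1 ^ (1 + 1 / q)) (t, x) :=
    contDiffAt_snd.div (h1 _) hp.ne'
  exact ContDiffAt.comp (g := g) (f := fun z : ℝ × ℝ => z.2 / z.1 ^ (1 + 1 / q)) (t, x)
    (hg.contDiffAt (Ioo_mem_nhds hy.1 hy.2)) h2

lemma contDiffAt_wave (h : IsGlueData a q d K yB yD rp lp) {g : ℝ → ℝ} {w : ℝ → ℝ → ℝ} {t x : ℝ}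
    (hw : ContDiffAt ℝ ∞ (fun p : ℝ × ℝ => w p.1 p.2) (t, x))
    (hx : powerCurve (1 + 1 / q) yD t < x) :
    ContDiffAt ℝ ∞ (fun p : ℝ × ℝ => glue q yD g w p.1 p.2) (t, x) :=
  hw.congr_of_eventuallyEq (glue_eventuallyEq_right h.wave.q_pos hx)

lemma hasDerivAt_sector (h : IsGlueData a q d K yB yD rp lp) {g : ℝ → ℝ} {w : ℝ → ℝ → ℝ}
    (hg : ContDiffOn ℝ ∞ g (Ioo yB yD)) {t x : ℝ} (ht : 0 < t) (hxD : x < yD * t ^ (1 + 1 / q))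
    (hxB : yB * t ^ (1 + 1 / q) < x) :
    HasDerivAt (glue q yD g w t) (deriv g (x / t ^ (1 + 1 / q)) / t) x ∧
    HasDerivAt (fun s => glue q yD g w s x)
      (t ^ (1 / q) / t * (g (x / t ^ (1 + 1 / q)) / q -
        (1 + 1 / q) * (x / t ^ (1 + 1 / q)) * deriv g (x / t ^ (1 + 1 / q)))) t := by
  have hp := Real.rpow_pos_of_pos ht (1 + 1 / q)
  have hy : x / t ^ (1 + 1 / q) ∈ Ioo yB yD := ⟨by rwa [lt_div_iff₀ hp], by rwa [div_lt_iff₀ hp]⟩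
  have hd : HasDerivAt g (deriv g (x / t ^ (1 + 1 / q))) (x / t ^ (1 + 1 / q)) :=
    ((hg.contDiffAt (Ioo_mem_nhds hy.1 hy.2)).differentiableAt (by simp)).hasDerivAt
  have hev := glue_eventuallyEq_left (g := g) (w := w) h.wave.q_pos ht hxD
  obtain ⟨h1, h2⟩ := hasDerivAt_profile h.wave.q_pos ht hd
  exact ⟨h1.congr_of_eventuallyEq (((Continuous.prodMk_right t).tendsto x).eventually hev),
    h2.congr_of_eventuallyEq (((Continuous.prodMk_left x).tendsto t).eventually hev)⟩

lemma hasDerivAt_waveL (h : IsGlueData a q d K yB yD rp lp) {t x : ℝ}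
    (hx : powerCurve (1 + 1 / q) yD t < x) :
    HasDerivAt (glue q yD lp (simpleWave a q d K) t)
      (((q + 1) * K * simpleWave a q d K t x ^ q - a * t)⁻¹) x ∧
    HasDerivAt (fun s => glue q yD lp (simpleWave a q d K) s x)
      (a * simpleWave a q d K t x * ((q + 1) * K * simpleWave a q d K t x ^ q - a * t)⁻¹) t := by
  obtain ⟨h1, h2⟩ := h.wave.hasDerivAt_simpleWave (t := t) (x := x) (by rw [h.yD_eq]; exact hx)
  have hev := glue_eventuallyEq_right (g := lp) (w := simpleWave a q d K) h.wave.q_pos hx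
  exact ⟨h1.congr_of_eventuallyEq (((Continuous.prodMk_right t).tendsto x).eventually hev),
    h2.congr_of_eventuallyEq (((Continuous.prodMk_left x).tendsto t).eventually hev)⟩

lemma hasDerivAt_waveR (h : IsGlueData a q d K yB yD rp lp) {t x : ℝ}
    (hx : powerCurve (1 + 1 / q) yD t < x) :
    HasDerivAt (glue q yD rp (fun _ _ => 0) t) 0 x ∧
    HasDerivAt (fun s => glue q yD rp (fun _ _ => 0) s x) 0 t := by
  have hev := glue_eventuallyEq_right (g := rp) (w := fun _ _ => 0) h.wave.q_pos hx
  exact ⟨(hasDerivAt_const x (0 : ℝ)).congr_of_eventuallyEq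
      (((Continuous.prodMk_right t).tendsto x).eventually hev),
    (hasDerivAt_const t (0 : ℝ)).congr_of_eventuallyEq
      (((Continuous.prodMk_left x).tendsto t).eventually hev)⟩

lemma transport (h : IsGlueData a q d K yB yD rp lp) {t x : ℝ}
    (hB : powerCurve (1 + 1 / q) yB t < x) (hD : x ≠ powerCurve (1 + 1 / q) yD t) :
    ∃ rx lx : ℝ, HasDerivAt (glue q yD rp (fun _ _ => 0) t) rx x ∧
      HasDerivAt (fun s => glue q yD rp (fun _ _ => 0) s x)
        ((a * glue q yD rp (fun _ _ => 0) t x +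
          (1 - a) * glue q yD lp (simpleWave a q d K) t x) * rx) t ∧
      HasDerivAt (glue q yD lp (simpleWave a q d K) t) lx x ∧
      HasDerivAt (fun s => glue q yD lp (simpleWave a q d K) s x)
        ((a * glue q yD lp (simpleWave a q d K) t x +
          (1 - a) * glue q yD rp (fun _ _ => 0) t x) * lx) t := by
  rcases lt_or_gt_of_ne hD with hlt | hgt
  · obtain ⟨ht, hxD, hy⟩ := mem_sector_of_lt h.wave.q_pos hB.le hlt
    rw [powerCurve_of_nonneg ht.le] at hB
    have hp := Real.rpow_pos_of_pos ht (1 + 1 / q)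
    have hy' : x / t ^ (1 + 1 / q) ∈ Ioo yB yD := ⟨by rwa [lt_div_iff₀ hp], hy.2⟩
    obtain ⟨r1, r2⟩ := h.hasDerivAt_sector (w := fun _ _ => 0) h.profile.smooth_r ht hxD hB
    obtain ⟨l1, l2⟩ := h.hasDerivAt_sector (w := simpleWave a q d K) h.profile.smooth_l ht hxD hB
    have cR := h.profile.charR _ hy'
    have cL := h.profile.charL _ hy'
    refine ⟨_, _, r1, ?_, l1, ?_⟩
    · convert! r2 using 1
      rw [glue_of_lt ht hxD, glue_of_lt ht hxD, ← cR]
      ring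
    · convert! l2 using 1
      rw [glue_of_lt ht hxD, glue_of_lt ht hxD, ← cL]
      ring
  · obtain ⟨r1, r2⟩ := h.hasDerivAt_waveR hgt
    obtain ⟨l1, l2⟩ := h.hasDerivAt_waveL hgt
    refine ⟨_, _, r1, ?_, l1, ?_⟩
    · convert! r2 using 1
      ring
    · convert! l2 using 1
      rw [glue_of_le hgt.le, glue_of_le hgt.le]
      ring

lemma tendsto_sector {t : ℝ} (ht : 0 < t) :
    Tendsto (fun p : ℝ × ℝ => p.2 / p.1 ^ (1 + 1 / q))
      (𝓝[regionLeft (1 + 1 / q) yB yD] (t, yD * t ^ (1 + 1 / q))) (𝓝[<] yD) := by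
  have hp := Real.rpow_pos_of_pos ht (1 + 1 / q)
  refine tendsto_nhdsWithin_iff.2 ⟨?_, ?_⟩
  · have : ContinuousAt (fun p : ℝ × ℝ => p.2 / p.1 ^ (1 + 1 / q)) (t, yD * t ^ (1 + 1 / q)) :=
      continuousAt_snd.div (continuousAt_fst.rpow_const (Or.inl ht.ne')) hp.ne'
    have h2 := this.tendsto.mono_left
      (nhdsWithin_le_nhds (s := regionLeft (1 + 1 / q) yB yD))
    rwa [mul_div_cancel_right₀ _ hp.ne'] at h2
  · filter_upwards [self_mem_nhdsWithin] with p hp'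
    exact (div_lt_iff₀ (Real.rpow_pos_of_pos hp'.1 _)).2 hp'.2.2

lemma tendsto_deriv_sector (h : IsGlueData a q d K yB yD rp lp) {g : ℝ → ℝ} {w : ℝ → ℝ → ℝ}
    {κ : ℝ} (hg : ContDiffOn ℝ ∞ g (Ioo yB yD)) (hκ : Tendsto (deriv g) (𝓝[<] yD) (𝓝 κ)) {t : ℝ}
    (ht : 0 < t) : Tendsto (fun p : ℝ × ℝ => deriv (glue q yD g w p.1) p.2)
      (𝓝[regionLeft (1 + 1 / q) yB yD] (t, yD * t ^ (1 + 1 / q))) (𝓝 (κ / t)) := by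
  have h1 := hκ.comp (tendsto_sector (q := q) (yB := yB) ht)
  have h2 : Tendsto (fun p : ℝ × ℝ => p.1)
      (𝓝[regionLeft (1 + 1 / q) yB yD] (t, yD * t ^ (1 + 1 / q))) (𝓝 t) :=
    (continuous_fst.tendsto _).mono_left nhdsWithin_le_nhds
  refine (h1.div h2 ht.ne').congr' ?_
  filter_upwards [self_mem_nhdsWithin] with p hp
  exact (h.hasDerivAt_sector hg hp.1 hp.2.2 hp.2.1).1.deriv.symm

lemma tendsto_deriv_waveR (h : IsGlueData a q d K yB yD rp lp) (p₀ : ℝ × ℝ) :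
    Tendsto (fun p : ℝ × ℝ => deriv (glue q yD rp (fun _ _ => 0) p.1) p.2)
      (𝓝[regionRight (1 + 1 / q) yD] p₀) (𝓝 0) := by
  refine tendsto_const_nhds.congr' ?_
  filter_upwards [self_mem_nhdsWithin] with p hp
  exact (h.hasDerivAt_waveR (by rw [powerCurve_of_nonneg hp.1.le]; exact hp.2)).1.deriv.symm

lemma tendsto_deriv_waveL (h : IsGlueData a q d K yB yD rp lp) {t : ℝ} (ht : 0 < t) :
    Tendsto (fun p : ℝ × ℝ => deriv (glue q yD lp (simpleWave a q d K) p.1) p.2)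
      (𝓝[regionRight (1 + 1 / q) yD] (t, yD * t ^ (1 + 1 / q)))
      (𝓝 (1 / (q * (2 * a - 1)) / t)) := by
  have hq := h.wave.q_pos
  set p₀ : ℝ × ℝ := (t, yD * t ^ (1 + 1 / q)) with hp₀
  set F := 𝓝[regionRight (1 + 1 / q) yD] p₀ with hF
  have hFn : F ≤ 𝓝 p₀ := nhdsWithin_le_nhds
  have hright : ∀ᶠ p in F, powerCurve (1 + 1 / q) yD p.1 < p.2 := by
    filter_upwards [self_mem_nhdsWithin] with p hp
    rw [powerCurve_of_nonneg hp.1.le]; exact hp.2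
  -- the wave is continuous up to the curve
  have hlim : Tendsto (fun p : ℝ × ℝ => simpleWave a q d K p.1 p.2) F
      (𝓝 (simpleWave a q d K p₀.1 p₀.2)) := by
    obtain ⟨C, hC, hh⟩ := h.wave.simpleWave_holder (|p₀.1| + |p₀.2| + 1)
    rw [tendsto_iff_dist_tendsto_zero]
    have hz : Tendsto (fun p => C * dist p p₀ ^ (1 / (q + 1))) F (𝓝 0) := by
      have c1 : Continuous fun p : ℝ × ℝ => C * dist p p₀ ^ (1 / (q + 1)) :=
        continuous_const.mul ((Real.continuous_rpow_const (by positivity)).comp (by fun_prop))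
      have c2 := (c1.tendsto p₀).mono_left hFn
      rwa [dist_self, Real.zero_rpow (by positivity), mul_zero] at c2
    refine squeeze_zero' (Eventually.of_forall fun _ => dist_nonneg) ?_ hz
    have b1 : ∀ᶠ p in F, |p.1| < |p₀.1| + 1 :=
      hFn ((continuous_fst.abs.tendsto p₀).eventually (gt_mem_nhds (lt_add_one _)))
    have b2 : ∀ᶠ p in F, |p.2| < |p₀.2| + 1 :=
      hFn ((continuous_snd.abs.tendsto p₀).eventually (gt_mem_nhds (lt_add_one _)))
    filter_upwards [hright, b1, b2] with p h1 h2 h3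
    have h4 := abs_nonneg p₀.1
    have h5 := abs_nonneg p₀.2
    rw [Real.dist_eq]
    refine hh p p₀ (by rw [h.yD_eq]; exact h1.le) ?_ (by linarith) (by linarith) (by linarith)
      (by linarith)
    rw [h.yD_eq, hp₀, powerCurve_of_nonneg ht.le]
  have hcurve := h.wave.isSimpleWave_sonic ht.le
  rw [h.yD_eq] at hcurve
  have hval : simpleWave a q d K p₀.1 p₀.2 = (d / K) ^ (1 / q) * t ^ (1 / q) :=
    h.wave.simpleWave_eq hcurve
  have hKq : K * simpleWave a q d K p₀.1 p₀.2 ^ q = d * t := by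
    have hdK : 0 ≤ d / K := (div_pos h.wave.d_pos h.wave.K_pos).le
    rw [hval, Real.mul_rpow (by positivity) (by positivity), ← Real.rpow_mul hdK,
      ← Real.rpow_mul ht.le, one_div_mul_cancel hq.ne', Real.rpow_one, Real.rpow_one, ← mul_assoc,
      mul_div_cancel₀ _ h.wave.K_pos.ne']
  have h2a : 0 < 2 * a - 1 := by linarith [h.half_lt]
  have hden : (q + 1) * K * simpleWave a q d K p₀.1 p₀.2 ^ q - a * t = q * (2 * a - 1) * t := by
    linear_combination (q + 1) * hKq + t * h.d_eq
  have hlim2 : Tendsto (fun p : ℝ × ℝ =>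
      ((q + 1) * K * simpleWave a q d K p.1 p.2 ^ q - a * p.1)⁻¹) F
      (𝓝 ((q + 1) * K * simpleWave a q d K p₀.1 p₀.2 ^ q - a * t)⁻¹) := by
    refine Tendsto.inv₀ ((tendsto_const_nhds.mul (hlim.rpow_const (Or.inr hq.le))).sub
      (tendsto_const_nhds.mul ((continuous_fst.tendsto p₀).mono_left hFn))) ?_
    rw [hden]; positivity
  rw [hden, show (q * (2 * a - 1) * t)⁻¹ = 1 / (q * (2 * a - 1)) / t by field_simp] at hlim2
  refine hlim2.congr' ?_
  filter_upwards [hright] with p hp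
  exact (h.hasDerivAt_waveL hp).1.deriv.symm

end IsGlueData

lemma continuousAt_of_holder {δ yB α : ℝ} (hδ : 0 < δ) (hα : 0 < α) {f : ℝ → ℝ → ℝ}
    (hf : ∀ R : ℝ, ∃ C : ℝ, 0 ≤ C ∧ ∀ p₁ p₂ : ℝ × ℝ,
      powerCurve δ yB p₁.1 ≤ p₁.2 → powerCurve δ yB p₂.1 ≤ p₂.2 →
      |p₁.1| ≤ R → |p₁.2| ≤ R → |p₂.1| ≤ R → |p₂.2| ≤ R →
      |f p₁.1 p₁.2 - f p₂.1 p₂.2| ≤ C * dist p₁ p₂ ^ α) {p₀ : ℝ × ℝ}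
    (h₀ : powerCurve δ yB p₀.1 < p₀.2) : ContinuousAt (fun p : ℝ × ℝ => f p.1 p.2) p₀ := by
  obtain ⟨C, hC, hh⟩ := hf (|p₀.1| + |p₀.2| + 1)
  rw [ContinuousAt, tendsto_iff_dist_tendsto_zero]
  have hz : Tendsto (fun p => C * dist p p₀ ^ α) (𝓝 p₀) (𝓝 0) := by
    have c1 : Continuous fun p : ℝ × ℝ => C * dist p p₀ ^ α :=
      continuous_const.mul ((Real.continuous_rpow_const hα.le).comp (by fun_prop))
    have c2 := c1.tendsto p₀
    rwa [dist_self, Real.zero_rpow hα.ne', mul_zero] at c2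
  refine squeeze_zero' (Eventually.of_forall fun _ => dist_nonneg) ?_ hz
  have b1 : ∀ᶠ p in 𝓝 p₀, |p.1| < |p₀.1| + 1 :=
    (continuous_fst.abs.tendsto p₀).eventually (gt_mem_nhds (lt_add_one _))
  have b2 : ∀ᶠ p in 𝓝 p₀, |p.2| < |p₀.2| + 1 :=
    (continuous_snd.abs.tendsto p₀).eventually (gt_mem_nhds (lt_add_one _))
  have b3 : ∀ᶠ p : ℝ × ℝ in 𝓝 p₀, powerCurve δ yB p.1 < p.2 :=
    (isOpen_lt ((continuous_powerCurve hδ yB).comp continuous_fst) continuous_snd).mem_nhds h₀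
  filter_upwards [b1, b2, b3] with p h1 h2 h3
  have h4 := abs_nonneg p₀.1
  have h5 := abs_nonneg p₀.2
  rw [Real.dist_eq]
  exact hh p p₀ h3.le h₀.le (by linarith) (by linarith) (by linarith) (by linarith)

namespace IsGlueData

variable {a q d K yB yD : ℝ} {rp lp : ℝ → ℝ}

/-- The Lipschitz property on the sonic curve follows from that of the profile at time `1`. -/
lemma lipschitzNear_glue (h : IsGlueData a q d K yB yD rp lp) {g : ℝ → ℝ} {w : ℝ → ℝ → ℝ} {l r : ℝ}
    (hscale : ∀ s t x, 0 < s → powerCurve (1 + 1 / q) yB t ≤ x →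
      glue q yD g w (s * t) (s ^ (1 + 1 / q) * x) = s ^ (1 / q) * glue q yD g w t x)
    (hcont : ∀ p : ℝ × ℝ, powerCurve (1 + 1 / q) yB p.1 < p.2 →
      ContinuousAt (fun p : ℝ × ℝ => glue q yD g w p.1 p.2) p)
    (hdiff : ∀ t x, powerCurve (1 + 1 / q) yB t < x → x ≠ powerCurve (1 + 1 / q) yD t →
      DifferentiableAt ℝ (glue q yD g w t) x)
    (hl : Tendsto (fun p : ℝ × ℝ => deriv (glue q yD g w p.1) p.2)
      (𝓝[regionLeft (1 + 1 / q) yB yD] (1, yD * 1 ^ (1 + 1 / q))) (𝓝 l))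
    (hr : Tendsto (fun p : ℝ × ℝ => deriv (glue q yD g w p.1) p.2)
      (𝓝[regionRight (1 + 1 / q) yD] (1, yD * 1 ^ (1 + 1 / q))) (𝓝 r)) {t : ℝ} (ht : 0 < t) :
    LipschitzNear (fun p : ℝ × ℝ => glue q yD g w p.1 p.2) (t, yD * t ^ (1 + 1 / q)) := by
  have hq := h.wave.q_pos
  have hBD := h.profile.lt
  have hp := Real.rpow_pos_of_pos ht (1 + 1 / q)
  have hcur : ∀ y : ℝ, powerCurve (1 + 1 / q) y 1 = y := fun y => by
    rw [powerCurve_of_nonneg zero_le_one, Real.one_rpow, mul_one]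
  rw [Real.one_rpow, mul_one] at hl hr
  have hmk : Tendsto (fun y : ℝ => ((1 : ℝ), y)) (𝓝 yD) (𝓝 (1, yD)) :=
    (Continuous.prodMk_right (1 : ℝ)).tendsto yD
  have hlip : LipschitzNear (glue q yD g w 1) yD := by
    refine lipschitzNear_of_tendsto_deriv (l := l) (r := r) ?_ ?_ ?_ ?_ ?_
    · filter_upwards [lt_mem_nhds hBD] with y hy
      exact ContinuousAt.comp (f := fun y : ℝ => ((1 : ℝ), y)) (hcont (1, y) (by rw [hcur]; exact hy))
        (Continuous.prodMk_right (1 : ℝ)).continuousAt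
    · filter_upwards [Ioo_mem_nhdsLT hBD] with y hy
      exact hdiff 1 y (by rw [hcur]; exact hy.1) (by rw [hcur]; exact hy.2.ne)
    · filter_upwards [self_mem_nhdsWithin] with y hy
      have hy' : yD < y := hy
      exact hdiff 1 y (by rw [hcur]; exact hBD.trans hy') (by rw [hcur]; exact hy'.ne')
    · refine hl.comp (tendsto_nhdsWithin_iff.2 ⟨hmk.mono_left nhdsWithin_le_nhds, ?_⟩)
      filter_upwards [Ioo_mem_nhdsLT hBD] with y hy
      exact ⟨zero_lt_one, by simpa using hy.1, by simpa using hy.2⟩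
    · refine hr.comp (tendsto_nhdsWithin_iff.2 ⟨hmk.mono_left nhdsWithin_le_nhds, ?_⟩)
      filter_upwards [self_mem_nhdsWithin] with y hy
      exact ⟨zero_lt_one, by simpa using hy⟩
  set p₀ : ℝ × ℝ := (t, yD * t ^ (1 + 1 / q)) with hp₀
  have h1 : ∀ p : ℝ, ContDiffAt ℝ 1 (fun z : ℝ × ℝ => z.1 ^ p) p₀ := fun p =>
    contDiffAt_fst.rpow_const_of_ne ht.ne'
  have h2 : LipschitzNear (fun z : ℝ × ℝ => z.2 / z.1 ^ (1 + 1 / q)) p₀ :=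
    (contDiffAt_snd.div (h1 _) hp.ne').lipschitzNear
  have hy0 : p₀.2 / p₀.1 ^ (1 + 1 / q) = yD := mul_div_cancel_right₀ _ hp.ne'
  have h3 : LipschitzNear (fun z : ℝ × ℝ => glue q yD g w 1 (z.2 / z.1 ^ (1 + 1 / q))) p₀ :=
    LipschitzNear.comp (by rw [hy0]; exact hlip) h2
  have h4 : LipschitzNear (fun z : ℝ × ℝ =>
      z.1 ^ (1 / q) * glue q yD g w 1 (z.2 / z.1 ^ (1 + 1 / q))) p₀ :=
    LipschitzNear.comp (g := fun z : ℝ × ℝ => z.1 * z.2)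
      (f := fun z : ℝ × ℝ => (z.1 ^ (1 / q), glue q yD g w 1 (z.2 / z.1 ^ (1 + 1 / q))))
      (contDiffAt_fst.mul contDiffAt_snd).lipschitzNear ((h1 _).lipschitzNear.prodMk h3)
  refine h4.congr ?_
  have hδ : 0 < 1 + 1 / q := by positivity
  have b1 : ∀ᶠ p : ℝ × ℝ in 𝓝 p₀, powerCurve (1 + 1 / q) yB p.1 < p.2 :=
    (isOpen_lt ((continuous_powerCurve hδ yB).comp continuous_fst) continuous_snd).mem_nhds
      (by
        change powerCurve _ yB t < yD * t ^ (1 + 1 / q)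
        rw [powerCurve_of_nonneg ht.le]
        exact mul_lt_mul_of_pos_right hBD hp)
  have b2 : ∀ᶠ p : ℝ × ℝ in 𝓝 p₀, 0 < p.1 :=
    (isOpen_lt continuous_const continuous_fst).mem_nhds ht
  filter_upwards [b1, b2] with p h5 h6
  have h7 := Real.rpow_pos_of_pos h6 (1 + 1 / q)
  rw [powerCurve_of_nonneg h6.le] at h5
  have h8 := hscale p.1 1 (p.2 / p.1 ^ (1 + 1 / q)) h6 (by
    rw [hcur, le_div_iff₀ h7]; exact h5.le)
  rwa [mul_one, mul_div_cancel₀ _ h7.ne'] at h8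

theorem isRiemannFlow (h : IsGlueData a q d K yB yD rp lp) :
    IsRiemannFlow a q d K yB yD (glue q yD rp fun _ _ => 0) (glue q yD lp (simpleWave a q d K)) := by
  have hq := h.wave.q_pos
  have hδ : 0 < 1 + 1 / q := by positivity
  have hBD := h.profile.lt
  have hscR : ∀ s t x, 0 < s → powerCurve (1 + 1 / q) yB t ≤ x →
      glue q yD rp (fun _ _ => 0) (s * t) (s ^ (1 + 1 / q) * x) =
        s ^ (1 / q) * glue q yD rp (fun _ _ => 0) t x := fun s t x hs hx =>
    glue_scaling hq (fun _ _ _ _ _ => (mul_zero _).symm) hs hx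
  have hscL : ∀ s t x, 0 < s → powerCurve (1 + 1 / q) yB t ≤ x →
      glue q yD lp (simpleWave a q d K) (s * t) (s ^ (1 + 1 / q) * x) =
        s ^ (1 / q) * glue q yD lp (simpleWave a q d K) t x := fun s t x hs hx =>
    glue_scaling hq h.simpleWave_scaling hs hx
  obtain ⟨α, hα, hα1, hhol⟩ := h.holder
  obtain ⟨κ, hκ, hκR⟩ := h.profile.charR_limit
  have hκL := h.profile.charL_limit
  have htr := fun t x => h.transport (t := t) (x := x)
  have hcur0 : ∀ y t, 0 ≤ t → powerCurve (1 + 1 / q) y t = y * t ^ (1 + 1 / q) :=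
    fun y t ht => powerCurve_of_nonneg ht
  constructor
  · exact hBD
  · exact h.yD_neg
  · intro t x hx
    rw [glue_of_le hx, glue_of_le hx]
    exact ⟨rfl, h.isSimpleWave hx⟩
  · exact fun s t x hs hx => ⟨hscR s t x hs hx, hscL s t x hs hx⟩
  · intro t x hx
    rcases le_or_gt (powerCurve (1 + 1 / q) yD t) x with hD | hD
    · rw [glue_of_le hD, glue_of_le hD]
      exact ⟨le_rfl, (h.isSimpleWave hD).nonneg⟩
    · obtain ⟨ht, hxD, hy⟩ := mem_sector_of_lt hq hx hD
      have hp := Real.rpow_pos_of_pos ht (1 / q)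
      rw [glue_of_lt ht hxD, glue_of_lt ht hxD]
      refine ⟨mul_nonneg hp.le (h.profile.r_nonneg _ (Ico_subset_Icc_self hy)),
        mul_le_mul_of_nonneg_left ?_ hp.le⟩
      rcases hy.1.eq_or_lt with h1 | h1
      · rw [← h1]; exact h.profile.vacuum.le
      · exact (h.profile.r_lt _ ⟨h1, hy.2.le⟩).le
  · intro t x hx
    rcases lt_trichotomy (powerCurve (1 + 1 / q) yD t) x with hD | hD | hD
    · rw [glue_of_le hD.le, glue_of_le hD.le]
      exact (h.wave.strict (h.isSimpleWave hD.le) (by rw [h.yD_eq]; exact hD)).1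
    · have ht : 0 < t := by
        by_contra hcon
        rw [← hD, powerCurve_of_nonpos hδ.ne' (not_lt.1 hcon),
          powerCurve_of_nonpos hδ.ne' (not_lt.1 hcon)] at hx
        exact lt_irrefl _ hx
      rw [← hD, hcur0 _ _ ht.le, h.glueR_curve ht.le ⟨hBD.le, le_rfl⟩,
        h.glueL_curve ht.le ⟨hBD.le, le_rfl⟩]
      exact mul_lt_mul_of_pos_left (h.profile.r_lt _ ⟨hBD, le_rfl⟩) (Real.rpow_pos_of_pos ht _)
    · obtain ⟨ht, hxD, hy⟩ := mem_sector_of_lt hq hx.le hD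
      rw [hcur0 _ _ ht.le] at hx
      rw [glue_of_lt ht hxD, glue_of_lt ht hxD]
      refine mul_lt_mul_of_pos_left (h.profile.r_lt _ ⟨?_, hy.2.le⟩) (Real.rpow_pos_of_pos ht _)
      rwa [lt_div_iff₀ (Real.rpow_pos_of_pos ht _)]
  · intro t
    rcases le_or_gt 0 t with ht | ht
    · rw [hcur0 _ _ ht, h.glueR_curve ht ⟨le_rfl, hBD.le⟩, h.glueL_curve ht ⟨le_rfl, hBD.le⟩,
        h.profile.vacuum]
    · have e1 : powerCurve (1 + 1 / q) yB t = 0 := powerCurve_of_nonpos hδ.ne' ht.le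
      have e2 : powerCurve (1 + 1 / q) yD t ≤ 0 := (powerCurve_of_nonpos hδ.ne' ht.le).le
      rw [e1, glue_of_le e2, glue_of_le e2, h.wave.simpleWave_eq (ℓ := 0)]
      have h3 := h.wave.d_pos
      refine ⟨le_rfl, ?_, ?_⟩
      · rw [Real.zero_rpow (by positivity)]; ring
      · rw [Real.zero_rpow hq.ne']; nlinarith
  · intro t ht
    rw [h.glueL_curve ht ⟨le_rfl, hBD.le⟩, h.profile.kinematic]
    ring
  · intro t x ht hx
    rcases le_or_gt (powerCurve (1 + 1 / q) yD t) x with hD | hD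
    · rw [glue_of_le hD]
      have h1 := h.isSimpleWave hD
      refine lt_of_le_of_ne h1.nonneg fun h0 => ?_
      have h2 := h1.le
      rw [← h0, Real.zero_rpow hq.ne'] at h2
      nlinarith [mul_pos h.wave.d_pos ht]
    · obtain ⟨-, hxD, hy⟩ := mem_sector_of_lt hq hx hD
      rw [glue_of_lt ht hxD]
      exact mul_pos (Real.rpow_pos_of_pos ht _) (h.profile.l_pos _ (Ico_subset_Icc_self hy))
  · have := h.glueL_curve zero_le_one (y := yD) ⟨hBD.le, le_rfl⟩
    rw [Real.one_rpow, mul_one, Real.one_rpow, one_mul] at this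
    rw [this, h.profile.l_sonic]
    exact h.profile.sonic
  · intro t x hB hD
    rcases lt_or_gt_of_ne hD with hlt | hgt
    · obtain ⟨ht, hxD, hy⟩ := mem_sector_of_lt hq hB.le hlt
      rw [hcur0 _ _ ht.le] at hB
      exact ⟨h.contDiffAt_sector h.profile.smooth_r ht hxD hB,
        h.contDiffAt_sector h.profile.smooth_l ht hxD hB⟩
    · exact ⟨h.contDiffAt_wave contDiffAt_const hgt,
        h.contDiffAt_wave (h.wave.contDiffAt_simpleWave (by rw [h.yD_eq]; exact hgt)) hgt⟩
  · exact fun t x hB hD => h.transport hB hD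
  · exact ⟨α, hα, hα1, hhol⟩
  · intro t ht
    constructor
    · refine h.lipschitzNear_glue hscR (fun p hp => ?_) (fun t x hB hD => ?_)
        (h.tendsto_deriv_sector h.profile.smooth_r hκR zero_lt_one) (h.tendsto_deriv_waveR _) ht
      · refine continuousAt_of_holder hδ hα (fun R => ?_) hp
        obtain ⟨C, hC, hh⟩ := hhol R
        exact ⟨C, hC, fun p₁ p₂ h1 h2 h3 h4 h5 h6 => (hh p₁ p₂ h1 h2 h3 h4 h5 h6).1⟩
      · obtain ⟨rx, lx, h1, -, -, -⟩ := htr t x hB hD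
        exact h1.differentiableAt
    · refine h.lipschitzNear_glue hscL (fun p hp => ?_) (fun t x hB hD => ?_)
        (h.tendsto_deriv_sector h.profile.smooth_l hκL zero_lt_one)
        (h.tendsto_deriv_waveL zero_lt_one) ht
      · refine continuousAt_of_holder hδ hα (fun R => ?_) hp
        obtain ⟨C, hC, hh⟩ := hhol R
        exact ⟨C, hC, fun p₁ p₂ h1 h2 h3 h4 h5 h6 => (hh p₁ p₂ h1 h2 h3 h4 h5 h6).2⟩
      · obtain ⟨rx, lx, -, -, h1, -⟩ := htr t x hB hD
        exact h1.differentiableAt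
  · intro t ht
    exact ⟨κ / t, _, div_ne_zero hκ.ne ht.ne', h.tendsto_deriv_sector h.profile.smooth_r hκR ht,
      h.tendsto_deriv_waveR _, h.tendsto_deriv_sector h.profile.smooth_l hκL ht,
      h.tendsto_deriv_waveL ht⟩
  · intro t ht
    obtain ⟨κ', hκ', hder⟩ := h.profile.physical
    have hp := Real.rpow_pos_of_pos ht (1 + 1 / q)
    have hp' := Real.rpow_pos_of_pos ht (1 / q)
    rw [hcur0 _ _ ht.le]
    refine ⟨(t ^ (1 / q)) ^ 2 * (κ' * (1 / t ^ (1 + 1 / q))), by positivity, ?_⟩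
    have h1 : HasDerivWithinAt (fun z : ℝ => z / t ^ (1 + 1 / q)) (1 / t ^ (1 + 1 / q))
        (Ici (yB * t ^ (1 + 1 / q))) (yB * t ^ (1 + 1 / q)) :=
      ((hasDerivAt_id _).div_const _).hasDerivWithinAt
    have h2 : MapsTo (fun z : ℝ => z / t ^ (1 + 1 / q)) (Ici (yB * t ^ (1 + 1 / q))) (Ici yB) :=
      fun z hz => (le_div_iff₀ hp).2 hz
    have h0 : yB * t ^ (1 + 1 / q) / t ^ (1 + 1 / q) = yB :=
      mul_div_cancel_right₀ _ hp.ne'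
    have h3 := HasDerivWithinAt.comp (h₂ := fun y => (lp y - rp y) ^ 2) (yB * t ^ (1 + 1 / q))
      (by rw [h0]; exact hder) h1 h2
    refine (h3.const_mul ((t ^ (1 / q)) ^ 2)).congr_of_eventuallyEq ?_ ?_
    · have hlt : yB * t ^ (1 + 1 / q) < yD * t ^ (1 + 1 / q) := mul_lt_mul_of_pos_right hBD hp
      filter_upwards [nhdsWithin_le_nhds (gt_mem_nhds hlt)] with x hx
      rw [glue_of_lt ht hx, glue_of_lt ht hx]
      simp only [Function.comp]
      ring
    · rw [h.glueR_curve ht.le ⟨le_rfl, hBD.le⟩, h.glueL_curve ht.le ⟨le_rfl, hBD.le⟩]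
      simp only [Function.comp, mul_div_cancel_right₀ _ hp.ne']
      ring

end IsGlueData

/-- For each `K > 0` there is a flow with the simple wave `x = K ℓ ^ (q + 1) - a ℓ t`. -/
theorem exists_riemannFlow {a q K : ℝ} (ha : 1 / 2 < a) (ha1 : a < 1) (hq : 0 < q) (hK : 0 < K) :
    ∃ (d yB yD : ℝ) (r ℓ : ℝ → ℝ → ℝ), IsRiemannFlow a q d K yB yD r ℓ := by
  obtain ⟨d, hd⟩ : ∃ d, (q + 1) * d = a + q * (2 * a - 1) :=
    ⟨(a + q * (2 * a - 1)) / (q + 1), mul_div_cancel₀ _ (by positivity)⟩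
  have h2a : 0 < q * (2 * a - 1) := mul_pos hq (by linarith)
  have hd0 : 0 < d := by
    by_contra hcon
    nlinarith
  obtain ⟨yB, yD, rp, lp, hp⟩ := exists_rarefactionProfile (ℓ₀ := (d / K) ^ (1 / q)) ha ha1 hq
    (Real.rpow_pos_of_pos (div_pos hd0 hK) _)
  have hglue : IsGlueData a q d K yB yD rp lp :=
    ⟨ha, ha1, ⟨by linarith, hq, hK, hd0, by linarith⟩, hd, hp⟩
  exact ⟨d, yB, yD, _, _, hglue.isRiemannFlow⟩

/-! ### Conservation laws in the weak sense -/

/-- A continuous function with a derivative off a countable set, given there by a continuous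
function, is differentiable everywhere. -/
lemma hasDerivAt_of_off_countable {f g : ℝ → ℝ} {s : Set ℝ} (hs : s.Countable) (hf : Continuous f)
    (hg : Continuous g) (hd : ∀ x ∉ s, HasDerivAt f (g x) x) (x : ℝ) : HasDerivAt f (g x) x := by
  have h1 : ∀ y, f y = f x + ∫ z in x..y, g z := fun y => by
    rw [MeasureTheory.integral_eq_of_hasDerivAt_off_countable f g hs hf.continuousOn
      (fun z hz => hd z hz.2) (hg.intervalIntegrable _ _)]
    ring
  have h2 := ((hg.integral_hasStrictDerivAt x x).hasDerivAt).const_add (f x)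
  exact h2.congr_of_eventuallyEq (Eventually.of_forall h1)

/-- Differentiation under the integral sign for kernels with support in a fixed compact set. -/
lemma hasDerivAt_integral_of_compact {k k' : ℝ → ℝ × ℝ → ℝ} {S : Set (ℝ × ℝ)} (hS : IsCompact S)
    (hk : Continuous (Function.uncurry k)) (hk' : Continuous (Function.uncurry k'))
    (h0 : ∀ h ∈ Icc (-1 : ℝ) 1, ∀ p ∉ S, k h p = 0 ∧ k' h p = 0)
    (hd : ∀ h p, HasDerivAt (fun h => k h p) (k' h p) h) :
    HasDerivAt (fun h => ∫ p, k h p) (∫ p, k' 0 p) 0 := by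
  obtain ⟨C, hC⟩ := ((isCompact_Icc (a := (-1 : ℝ)) (b := 1)).prod hS).exists_bound_of_continuousOn
    hk'.continuousOn
  have hk0 : ∀ h, Continuous (k h) := fun h => hk.comp (Continuous.prodMk_right h)
  have hk0' : ∀ h, Continuous (k' h) := fun h => hk'.comp (Continuous.prodMk_right h)
  have hz : (0 : ℝ) ∈ Icc (-1 : ℝ) 1 := by constructor <;> norm_num
  refine (hasDerivAt_integral_of_dominated_loc_of_deriv_le (F := k) (F' := k')
    (bound := S.indicator fun _ => C) (s := Icc (-1 : ℝ) 1) (Icc_mem_nhds (by norm_num) (by norm_num))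
    (Eventually.of_forall fun h => (hk0 h).aestronglyMeasurable)
    ((hk0 0).integrable_of_hasCompactSupport (HasCompactSupport.intro hS fun p hp => (h0 0 hz p hp).1))
    (hk0' 0).aestronglyMeasurable (Eventually.of_forall fun p h hh => ?_) ?_
    (Eventually.of_forall fun p h _ => hd h p)).2
  · by_cases hp : p ∈ S
    · rw [indicator_of_mem hp]
      exact hC (h, p) ⟨hh, hp⟩
    · rw [indicator_of_notMem hp, (h0 h hh p hp).2, norm_zero]
  · rw [integrable_indicator_iff hS.measurableSet]
    exact integrableOn_const hS.measure_lt_top.ne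

/-- A continuous planar field `(A, B) = (ψ_x, -ψ_t)` with a potential `ψ` is divergence free in the
weak sense. Only `C ^ 1` test functions are at hand, so that one derivative is replaced by a
difference quotient before the integration by parts. -/
lemma integral_potential_eq_zero {ψ A B : ℝ × ℝ → ℝ} (hψ : Continuous ψ) (hA : Continuous A)
    (hB : Continuous B) (hx : ∀ t x, HasDerivAt (fun z => ψ (t, z)) (A (t, x)) x)
    (ht : ∀ t x, HasDerivAt (fun s => ψ (s, x)) (-B (t, x)) t) {φ : ℝ × ℝ → ℝ}
    (hφ : ContDiff ℝ 1 φ) (hφc : HasCompactSupport φ) :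
    ∫ p, (A p * fderiv ℝ φ p (1, 0) + B p * fderiv ℝ φ p (0, 1)) = 0 := by
  have hφd : Differentiable ℝ φ := hφ.differentiable one_ne_zero
  have hφ1 : Continuous fun p => fderiv ℝ φ p (1, 0) :=
    (hφ.continuous_fderiv one_ne_zero).clm_apply continuous_const
  have hφ2 : Continuous fun p => fderiv ℝ φ p (0, 1) :=
    (hφ.continuous_fderiv one_ne_zero).clm_apply continuous_const
  have hc1 : HasCompactSupport fun p => fderiv ℝ φ p (1, 0) :=
    hφc.fderiv_apply (𝕜 := ℝ) (1, 0)
  have hc2 : HasCompactSupport fun p => fderiv ℝ φ p (0, 1) :=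
    hφc.fderiv_apply (𝕜 := ℝ) (0, 1)
  have i1 : Integrable fun p => A p * fderiv ℝ φ p (1, 0) :=
    (hA.mul hφ1).integrable_of_hasCompactSupport hc1.mul_left
  have i2 : Integrable fun p => B p * fderiv ℝ φ p (0, 1) :=
    (hB.mul hφ2).integrable_of_hasCompactSupport hc2.mul_left
  obtain ⟨R, hR⟩ : ∃ R : ℝ, tsupport φ ⊆ Metric.closedBall 0 R :=
    hφc.isCompact.isBounded.subset_closedBall 0
  have hsupp : ∀ p : ℝ × ℝ, p ∉ Metric.closedBall (0 : ℝ × ℝ) R →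
      φ p = 0 ∧ fderiv ℝ φ p = 0 := fun p hp => by
    have : p ∉ tsupport φ := fun h => hp (hR h)
    exact ⟨image_eq_zero_of_notMem_tsupport this,
      by_contra fun h => this (support_fderiv_subset ℝ h)⟩
  have hS : IsCompact (Metric.closedBall (0 : ℝ × ℝ) (R + 1)) := isCompact_closedBall _ _
  have hshift : ∀ h ∈ Icc (-1 : ℝ) 1, ∀ p ∉ Metric.closedBall (0 : ℝ × ℝ) (R + 1),
      (p.1 + h, p.2) ∉ Metric.closedBall (0 : ℝ × ℝ) R := by
    intro h hh p hp hmem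
    apply hp
    rw [mem_closedBall_zero_iff] at hmem ⊢
    have e : p = (p.1 + h, p.2) + (-h, 0) := by ext <;> simp
    have e2 : ‖((-h, 0) : ℝ × ℝ)‖ ≤ 1 := by
      rw [Prod.norm_def, norm_zero, norm_neg, Real.norm_eq_abs]
      exact max_le (abs_le.2 ⟨by linarith [hh.1], hh.2⟩) zero_le_one
    rw [e]
    exact (norm_add_le _ _).trans (add_le_add hmem e2)
  -- the integral against the shifted test function, differentiated with respect to the shift
  have F1 : HasDerivAt (fun h : ℝ => ∫ p : ℝ × ℝ, A p * φ (p.1 + h, p.2))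
      (∫ p : ℝ × ℝ, A p * fderiv ℝ φ (p.1 + 0, p.2) (1, 0)) 0 := by
    refine hasDerivAt_integral_of_compact (k := fun h p => A p * φ (p.1 + h, p.2))
      (k' := fun h p => A p * fderiv ℝ φ (p.1 + h, p.2) (1, 0)) hS ?_ ?_ ?_ ?_
    · exact (hA.comp continuous_snd).mul (hφd.continuous.comp (by fun_prop))
    · exact (hA.comp continuous_snd).mul
        (hφ1.comp (g := fun p => fderiv ℝ φ p (1, 0)) (f := fun z : ℝ × ℝ × ℝ =>
          (z.2.1 + z.1, z.2.2)) (by fun_prop))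
    · intro h hh p hp
      obtain ⟨e1, e2⟩ := hsupp _ (hshift h hh p hp)
      simp [e1, e2]
    · intro h p
      have d1 : HasDerivAt (fun h : ℝ => (p.1 + h, p.2)) ((1, 0) : ℝ × ℝ) h :=
        ((hasDerivAt_id h).const_add p.1).prodMk (hasDerivAt_const h p.2)
      exact ((hφd _).hasFDerivAt.comp_hasDerivAt h d1).const_mul (A p)
  have F2 : HasDerivAt (fun h : ℝ => ∫ p : ℝ × ℝ, -(ψ (p.1 - h, p.2) * fderiv ℝ φ p (0, 1)))
      (∫ p : ℝ × ℝ, -(B (p.1 - 0, p.2) * fderiv ℝ φ p (0, 1))) 0 := by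
    refine hasDerivAt_integral_of_compact
      (k := fun h p => -(ψ (p.1 - h, p.2) * fderiv ℝ φ p (0, 1)))
      (k' := fun h p => -(B (p.1 - h, p.2) * fderiv ℝ φ p (0, 1)))
      (isCompact_closedBall (0 : ℝ × ℝ) R) ?_ ?_ ?_ ?_
    · exact ((hψ.comp (by fun_prop)).mul (hφ2.comp continuous_snd)).neg
    · exact ((hB.comp (by fun_prop)).mul (hφ2.comp continuous_snd)).neg
    · intro h hh p hp
      simp [(hsupp p hp).2]
    · intro h p
      have d1 : HasDerivAt (fun h : ℝ => p.1 - h) (-1) h := (hasDerivAt_id h).const_sub p.1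
      have d2 := ((ht (p.1 - h) p.2).comp h d1).mul_const (fderiv ℝ φ p (0, 1))
      convert! d2.neg using 1
      ring
  -- both integrals differ by a constant
  have hparts : ∀ h : ℝ, ∫ p : ℝ × ℝ, A p * φ (p.1 + h, p.2) =
      ∫ p : ℝ × ℝ, -(ψ (p.1 - h, p.2) * fderiv ℝ φ p (0, 1)) := by
    intro h
    have hsh : Continuous fun p : ℝ × ℝ => (p.1 + h, p.2) := by fun_prop
    have hcs : ∀ {g : ℝ × ℝ → ℝ}, HasCompactSupport g →
        HasCompactSupport fun p : ℝ × ℝ => g (p.1 + h, p.2) := fun {g} hg => by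
      have := hg.comp_homeomorph (Homeomorph.addRight ((h, 0) : ℝ × ℝ))
      convert! this using 1
      ext p
      simp [Function.comp, Prod.add_def]
    have key := integral_bilinear_hasLineDerivAt_right_eq_neg_left_of_integrable
      (μ := (volume : Measure (ℝ × ℝ))) (B := ContinuousLinearMap.mul ℝ ℝ) (f := ψ) (f' := A)
      (g := fun p : ℝ × ℝ => φ (p.1 + h, p.2))
      (g' := fun p : ℝ × ℝ => fderiv ℝ φ (p.1 + h, p.2) (0, 1)) (v := ((0, 1) : ℝ × ℝ))
      ((hA.mul (hφd.continuous.comp hsh)).integrable_of_hasCompactSupport (hcs hφc).mul_left)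
      ((hψ.mul (hφ2.comp hsh)).integrable_of_hasCompactSupport (hcs hc2).mul_left)
      ((hψ.mul (hφd.continuous.comp hsh)).integrable_of_hasCompactSupport (hcs hφc).mul_left)
      (fun p _ => by
        have := hx p.1 (p.2 + 0)
        rw [add_zero] at this
        have d1 : HasDerivAt (fun s : ℝ => p.2 + s) 1 0 := (hasDerivAt_id 0).const_add p.2
        have d2 := HasDerivAt.comp (h₂ := fun z => ψ (p.1, z)) (0 : ℝ) (by simpa using this) d1
        rw [mul_one] at d2
        unfold HasLineDerivAt
        convert! d2 using 1
        ext s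
        simp [Function.comp, Prod.add_def])
      (fun p _ => by
        have d1 : HasDerivAt (fun s : ℝ => (p.1 + h, p.2 + s)) ((0, 1) : ℝ × ℝ) 0 :=
          (hasDerivAt_const 0 (p.1 + h)).prodMk ((hasDerivAt_id 0).const_add p.2)
        have d2 := (hφd (p.1 + h, p.2 + 0)).hasFDerivAt.comp_hasDerivAt (0 : ℝ) d1
        rw [add_zero] at d2
        unfold HasLineDerivAt
        convert! d2 using 1
        ext s
        simp [Function.comp])
    simp only [ContinuousLinearMap.mul_apply'] at key
    rw [← neg_eq_iff_eq_neg.2 key, integral_neg]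
    congr 1
    have e := integral_sub_right_eq_self (μ := (volume : Measure (ℝ × ℝ)))
      (fun p : ℝ × ℝ => ψ p * fderiv ℝ φ (p.1 + h, p.2) (0, 1)) ((h, 0) : ℝ × ℝ)
    rw [← e]
    refine integral_congr_ae (Eventually.of_forall fun p => ?_)
    have e2 : p - (h, 0) = (p.1 - h, p.2) := by ext <;> simp
    simp only [e2, sub_add_cancel, Prod.mk.eta]
  have huniq := F1.unique (F2.congr_of_eventuallyEq (Eventually.of_forall hparts))
  simp only [add_zero, sub_zero, Prod.mk.eta, integral_neg] at huniq
  rw [integral_add i1 i2, huniq, neg_add_cancel]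

/-- Homogeneous functions satisfy the Euler relation for the dilations `(t, x) ↦ (s t, s ^ δ x)`. -/
lemma euler_relation {δ ν y t x : ℝ} {A : ℝ → ℝ → ℝ} {L : ℝ × ℝ →L[ℝ] ℝ}
    (hs : ∀ s, 0 < s → powerCurve δ y t ≤ x → A (s * t) (s ^ δ * x) = s ^ ν * A t x)
    (hx : powerCurve δ y t ≤ x) (hL : HasFDerivAt (fun p : ℝ × ℝ => A p.1 p.2) L (t, x)) :
    t * L (1, 0) + δ * x * L (0, 1) = ν * A t x := by
  have d1 : HasDerivAt (fun s : ℝ => (s * t, s ^ δ * x)) ((t, δ * x) : ℝ × ℝ) 1 := by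
    have e1 : HasDerivAt (fun s : ℝ => s * t) t 1 := by
      simpa using (hasDerivAt_id (1 : ℝ)).mul_const t
    have e2 : HasDerivAt (fun s : ℝ => s ^ δ * x) (δ * x) 1 := by
      have := (Real.hasDerivAt_rpow_const (x := 1) (p := δ) (Or.inl one_ne_zero)).mul_const x
      simpa using this
    exact e1.prodMk e2
  have d2 : HasDerivAt (fun s : ℝ => A (s * t) (s ^ δ * x)) (L (t, δ * x)) 1 := by
    have hL' : HasFDerivAt (fun p : ℝ × ℝ => A p.1 p.2) L ((1 : ℝ) * t, (1 : ℝ) ^ δ * x) := by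
      simpa using hL
    exact hL'.comp_hasDerivAt (1 : ℝ) d1
  have d3 : HasDerivAt (fun s : ℝ => s ^ ν * A t x) (ν * A t x) 1 := by
    have := (Real.hasDerivAt_rpow_const (x := 1) (p := ν) (Or.inl one_ne_zero)).mul_const (A t x)
    simpa using this
  have heq : (fun s : ℝ => A (s * t) (s ^ δ * x)) =ᶠ[𝓝 1] fun s => s ^ ν * A t x := by
    filter_upwards [lt_mem_nhds one_pos] with s h0 using hs s h0 hx
  rw [← d2.unique (d3.congr_of_eventuallyEq heq)]
  have : ((t, δ * x) : ℝ × ℝ) = t • ((1, 0) : ℝ × ℝ) + (δ * x) • ((0, 1) : ℝ × ℝ) := by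
    ext <;> simp
  rw [this, map_add, map_smul, map_smul, smul_eq_mul, smul_eq_mul]

lemma HasFDerivAt.hasDerivAt_fst {A : ℝ → ℝ → ℝ} {L : ℝ × ℝ →L[ℝ] ℝ} {t x : ℝ}
    (h : HasFDerivAt (fun p : ℝ × ℝ => A p.1 p.2) L (t, x)) :
    HasDerivAt (fun s => A s x) (L (1, 0)) t :=
  h.comp_hasDerivAt (f := fun s => (s, x)) t ((hasDerivAt_id t).prodMk (hasDerivAt_const t x))

lemma HasFDerivAt.hasDerivAt_snd {A : ℝ → ℝ → ℝ} {L : ℝ × ℝ →L[ℝ] ℝ} {t x : ℝ}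
    (h : HasFDerivAt (fun p : ℝ × ℝ => A p.1 p.2) L (t, x)) : HasDerivAt (A t) (L (0, 1)) x :=
  h.comp_hasDerivAt (f := fun z => (t, z)) x ((hasDerivAt_const x t).prodMk (hasDerivAt_id x))

/-- A homogeneous density `A` and flux `B` which vanish on the boundary curve and satisfy
`A_t + B_x = 0` off two curves satisfy this conservation law in the weak sense. Indeed homogeneity
makes `(δ x A - t B) / (ν + δ)`, extended by zero, a potential of the field. -/
lemma integral_homogeneous_eq_zero {δ ν yB yD : ℝ} (hδ : 0 < δ) (hm : 0 < ν + δ) (hyB : yB < 0)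
    (hyD : yD < 0) {A B : ℝ → ℝ → ℝ}
    (hA : ContinuousOn (fun p : ℝ × ℝ => A p.1 p.2) {p | powerCurve δ yB p.1 ≤ p.2})
    (hB : ContinuousOn (fun p : ℝ × ℝ => B p.1 p.2) {p | powerCurve δ yB p.1 ≤ p.2})
    (hA0 : ∀ t, A t (powerCurve δ yB t) = 0) (hB0 : ∀ t, B t (powerCurve δ yB t) = 0)
    (hsA : ∀ s t x, 0 < s → powerCurve δ yB t ≤ x → A (s * t) (s ^ δ * x) = s ^ ν * A t x)
    (hsB : ∀ s t x, 0 < s → powerCurve δ yB t ≤ x →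
      B (s * t) (s ^ δ * x) = s ^ (ν + δ - 1) * B t x)
    (hd : ∀ t x, powerCurve δ yB t < x → x ≠ powerCurve δ yD t →
      DifferentiableAt ℝ (fun p : ℝ × ℝ => A p.1 p.2) (t, x) ∧
      DifferentiableAt ℝ (fun p : ℝ × ℝ => B p.1 p.2) (t, x) ∧
      deriv (fun s => A s x) t + deriv (B t) x = 0)
    {φ : ℝ × ℝ → ℝ} (hφ : ContDiff ℝ 1 φ) (hφc : HasCompactSupport φ) :
    ∫ p in fluidDomain (powerCurve δ yB),
      (A p.1 p.2 * fderiv ℝ φ p (1, 0) + B p.1 p.2 * fderiv ℝ φ p (0, 1)) = 0 := by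
  classical
  have hpc := continuous_powerCurve hδ yB
  have hcont : ∀ {F : ℝ → ℝ → ℝ},
      ContinuousOn (fun p : ℝ × ℝ => F p.1 p.2) {p | powerCurve δ yB p.1 ≤ p.2} →
      (∀ t, F t (powerCurve δ yB t) = 0) →
      Continuous fun p : ℝ × ℝ => if powerCurve δ yB p.1 ≤ p.2 then F p.1 p.2 else 0 :=
    fun {F} hF h0 => continuous_if_le (hpc.comp continuous_fst) continuous_snd hF
      continuousOn_const fun p hp => by rw [← hp]; exact h0 p.1
  set A₀ : ℝ → ℝ → ℝ := fun t x => if powerCurve δ yB t ≤ x then A t x else 0 with hA₀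
  set B₀ : ℝ → ℝ → ℝ := fun t x => if powerCurve δ yB t ≤ x then B t x else 0 with hB₀
  have cA : Continuous fun p : ℝ × ℝ => A₀ p.1 p.2 := hcont hA hA0
  have cB : Continuous fun p : ℝ × ℝ => B₀ p.1 p.2 := hcont hB hB0
  -- the partial derivatives off the two curves
  have key : ∀ t x, x ≠ powerCurve δ yB t → x ≠ powerCurve δ yD t → ∃ At Ax Bt Bx : ℝ,
      HasDerivAt (fun s => A₀ s x) At t ∧ HasDerivAt (A₀ t) Ax x ∧
      HasDerivAt (fun s => B₀ s x) Bt t ∧ HasDerivAt (B₀ t) Bx x ∧ At + Bx = 0 ∧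
      t * At + δ * x * Ax = ν * A₀ t x ∧ t * Bt + δ * x * Bx = (ν + δ - 1) * B₀ t x := by
    intro t x hxB hxD
    rcases hxB.lt_or_gt with h | h
    · have hev : ∀ᶠ p : ℝ × ℝ in 𝓝 (t, x), p.2 < powerCurve δ yB p.1 :=
        (isOpen_lt continuous_snd (hpc.comp continuous_fst)).mem_nhds h
      have hz : ∀ F : ℝ → ℝ → ℝ,
          HasFDerivAt (fun p : ℝ × ℝ => if powerCurve δ yB p.1 ≤ p.2 then F p.1 p.2 else 0)
            (0 : ℝ × ℝ →L[ℝ] ℝ) (t, x) := fun F =>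
        (hasFDerivAt_const (0 : ℝ) (t, x)).congr_of_eventuallyEq
          (hev.mono fun p hp => if_neg (not_le.2 hp))
      refine ⟨0, 0, 0, 0, (hz A).hasDerivAt_fst (A := A₀), (hz A).hasDerivAt_snd (A := A₀),
        (hz B).hasDerivAt_fst (A := B₀), (hz B).hasDerivAt_snd (A := B₀), by ring, ?_, ?_⟩
      · simp [hA₀, not_le.2 h]
      · simp [hB₀, not_le.2 h]
    · obtain ⟨dA, dB, he⟩ := hd t x h hxD
      have hev : ∀ᶠ p : ℝ × ℝ in 𝓝 (t, x), powerCurve δ yB p.1 < p.2 :=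
        (isOpen_lt (hpc.comp continuous_fst) continuous_snd).mem_nhds h
      have fA := dA.hasFDerivAt
      have fB := dB.hasFDerivAt
      have fA₀ : HasFDerivAt (fun p : ℝ × ℝ => A₀ p.1 p.2) _ (t, x) :=
        fA.congr_of_eventuallyEq (hev.mono fun p hp => if_pos hp.le)
      have fB₀ : HasFDerivAt (fun p : ℝ × ℝ => B₀ p.1 p.2) _ (t, x) :=
        fB.congr_of_eventuallyEq (hev.mono fun p hp => if_pos hp.le)
      refine ⟨_, _, _, _, fA₀.hasDerivAt_fst, fA₀.hasDerivAt_snd, fB₀.hasDerivAt_fst,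
        fB₀.hasDerivAt_snd, ?_, ?_, ?_⟩
      · rw [← fA.hasDerivAt_fst.deriv, ← fB.hasDerivAt_snd.deriv]
        exact he
      · rw [show A₀ t x = A t x from if_pos h.le]
        exact euler_relation (fun s h0 => hsA s t x h0) h.le fA
      · rw [show B₀ t x = B t x from if_pos h.le]
        exact euler_relation (fun s h0 => hsB s t x h0) h.le fB
  have cψ : Continuous fun p : ℝ × ℝ =>
      (δ * p.2 * A₀ p.1 p.2 - p.1 * B₀ p.1 p.2) / (ν + δ) := by fun_prop
  have ψx : ∀ t x, HasDerivAt (fun z => (δ * z * A₀ t z - t * B₀ t z) / (ν + δ)) (A₀ t x) x := by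
    intro t x
    refine hasDerivAt_of_off_countable (g := A₀ t) (s := {powerCurve δ yB t, powerCurve δ yD t})
      (Set.toFinite _).countable (cψ.comp (Continuous.prodMk_right t))
      (cA.comp (Continuous.prodMk_right t)) (fun x hx => ?_) x
    simp only [mem_insert_iff, mem_singleton_iff, not_or] at hx
    obtain ⟨At, Ax, Bt, Bx, -, h2, -, h4, e1, e2, -⟩ := key t x hx.1 hx.2
    have d := ((((hasDerivAt_id x).const_mul δ).mul h2).sub (h4.const_mul t)).div_const (ν + δ)
    refine d.congr_deriv ?_
    rw [div_eq_iff hm.ne']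
    simp only [id]
    linear_combination e2 - t * e1
  have ψt : ∀ t x, HasDerivAt (fun s => (δ * x * A₀ s x - s * B₀ s x) / (ν + δ)) (-B₀ t x) t := by
    intro t x
    refine hasDerivAt_of_off_countable (g := fun s => -B₀ s x)
      (s := {(x / yB) ^ (1 / δ), (x / yD) ^ (1 / δ)})
      (Set.toFinite _).countable (cψ.comp (Continuous.prodMk_left x))
      (cB.comp (Continuous.prodMk_left x)).neg (fun t hx => ?_) t
    simp only [mem_insert_iff, mem_singleton_iff, not_or] at hx
    by_cases ht0 : t < 0 ∧ x = 0
    · obtain ⟨ht, rfl⟩ := ht0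
      have hz : ∀ s < 0, B₀ s 0 = 0 := fun s hs => by
        have : powerCurve δ yB s = 0 := if_pos hs
        have h0 := hB0 s
        rw [this] at h0
        simp only [hB₀, this, h0, ite_self]
      have : (fun s => (δ * 0 * A₀ s 0 - s * B₀ s 0) / (ν + δ)) =ᶠ[𝓝 t] fun _ => 0 := by
        filter_upwards [gt_mem_nhds ht] with s hs
        rw [hz s hs]
        ring
      rw [hz t ht, neg_zero]
      exact (hasDerivAt_const t 0).congr_of_eventuallyEq this
    · have hoff : ∀ y < 0, t ≠ (x / y) ^ (1 / δ) → x ≠ powerCurve δ y t := by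
        intro y hy hne hxy
        rcases lt_or_ge t 0 with ht | ht
        · rw [powerCurve, if_pos ht] at hxy
          exact ht0 ⟨ht, hxy⟩
        · rw [powerCurve_of_nonneg ht] at hxy
          apply hne
          rw [hxy, mul_div_cancel_left₀ _ hy.ne, ← Real.rpow_mul ht, mul_one_div_cancel hδ.ne',
            Real.rpow_one]
      obtain ⟨At, Ax, Bt, Bx, h1, -, h3, -, e1, -, e3⟩ :=
        key t x (hoff yB hyB hx.1) (hoff yD hyD hx.2)
      have d := ((h1.const_mul (δ * x)).sub ((hasDerivAt_id t).mul h3)).div_const (ν + δ)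
      refine d.congr_deriv ?_
      rw [div_eq_iff hm.ne']
      simp only [id]
      linear_combination δ * x * e1 - e3
  have hmeas : MeasurableSet (fluidDomain (powerCurve δ yB)) :=
    (isOpen_lt (hpc.comp continuous_fst) continuous_snd).measurableSet
  rw [← integral_indicator hmeas]
  refine Eq.trans (integral_congr_ae (Eventually.of_forall fun p => ?_))
    (integral_potential_eq_zero cψ cA cB ψx ψt hφ hφc)
  by_cases hp : p ∈ fluidDomain (powerCurve δ yB)
  · have : powerCurve δ yB p.1 ≤ p.2 := le_of_lt hp
    simp only [indicator_of_mem hp, hA₀, hB₀, if_pos this]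
  · have h0 : A₀ p.1 p.2 = 0 ∧ B₀ p.1 p.2 = 0 := by
      rcases (not_lt.1 hp : p.2 ≤ powerCurve δ yB p.1).eq_or_lt with h | h
      · simp only [hA₀, hB₀, h, hA0, hB0, ite_self, and_self]
      · simp only [hA₀, hB₀, if_neg (not_le.2 h), and_self]
    simp only [indicator_of_notMem hp, h0.1, h0.2, zero_mul, add_zero]

/-! ### The density as a function of the Riemann variables -/

/-- The density of the gas whose Riemann variables differ by `D`: its enthalpy is
`(γ - 1) / 16 * D ^ 2`. -/
noncomputable def gasDensity (γ D : ℝ) : ℝ := ((γ - 1) / 16 * D ^ 2) ^ (1 / (γ - 1))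

lemma gasDensity_zero {γ : ℝ} (hγ : 1 < γ) : gasDensity γ 0 = 0 := by
  have : 1 / (γ - 1) ≠ 0 := (one_div_pos.2 (sub_pos.2 hγ)).ne'
  rw [gasDensity, zero_pow two_ne_zero, mul_zero, Real.zero_rpow this]

lemma gasDensity_pos {γ D : ℝ} (hγ : 1 < γ) (hD : 0 < D) : 0 < gasDensity γ D := by
  have := sub_pos.2 hγ
  exact Real.rpow_pos_of_pos (by positivity) _

lemma gasDensity_rpow {γ : ℝ} (hγ : 1 < γ) (D : ℝ) :
    gasDensity γ D ^ (γ - 1) = (γ - 1) / 16 * D ^ 2 := by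
  have := sub_pos.2 hγ
  rw [gasDensity, ← Real.rpow_mul (by positivity), one_div_mul_cancel this.ne', Real.rpow_one]

lemma gasDensity_mul {γ : ℝ} (hγ : 1 < γ) {s : ℝ} (hs : 0 ≤ s) (D : ℝ) :
    gasDensity γ (s * D) = s ^ (2 / (γ - 1)) * gasDensity γ D := by
  have := sub_pos.2 hγ
  have e : (γ - 1) / 16 * (s * D) ^ 2 = s ^ 2 * ((γ - 1) / 16 * D ^ 2) := by ring
  rw [gasDensity, gasDensity, e, Real.mul_rpow (by positivity) (by positivity), ← Real.rpow_natCast,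
    ← Real.rpow_mul hs]
  congr 2
  push_cast
  ring

lemma pressure_gasDensity {γ D : ℝ} (hγ : 1 < γ) (hD : 0 ≤ D) :
    pressure γ (gasDensity γ D) = (γ - 1) ^ 2 / (16 * γ) * gasDensity γ D * D ^ 2 := by
  rcases hD.eq_or_lt with rfl | hD
  · rw [gasDensity_zero hγ, pressure, Real.zero_rpow (by linarith)]
    ring
  · have e : gasDensity γ D ^ γ = gasDensity γ D * gasDensity γ D ^ (γ - 1) := by
      rw [← Real.rpow_one_add' (gasDensity_pos hγ hD).le (by linarith)]
      congr 1
      ring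
    rw [pressure, e, gasDensity_rpow hγ]
    field_simp

lemma contDiffAt_gasDensity {γ D : ℝ} (hγ : 1 < γ) (hD : 0 < D) :
    ContDiffAt ℝ ∞ (gasDensity γ) D := by
  have := sub_pos.2 hγ
  exact (contDiffAt_const.mul (contDiffAt_id.pow 2)).rpow_const_of_ne
    (show (γ - 1) / 16 * D ^ 2 ≠ 0 by positivity)

lemma continuous_gasDensity {γ : ℝ} (hγ : 1 < γ) : Continuous (gasDensity γ) :=
  (Real.continuous_rpow_const (one_div_pos.2 (sub_pos.2 hγ)).le).comp (by fun_prop)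

lemma hasDerivAt_gasDensity {γ D : ℝ} (hγ : 1 < γ) (hD : 0 < D) :
    HasDerivAt (gasDensity γ) (2 / (γ - 1) * gasDensity γ D / D) D := by
  have h1 := sub_pos.2 hγ
  have hF : (γ - 1) / 16 * D ^ 2 ≠ 0 := by positivity
  have d := (((hasDerivAt_id D).pow 2).const_mul ((γ - 1) / 16)).rpow_const
    (p := 1 / (γ - 1)) (Or.inl hF)
  refine d.congr_deriv ?_
  simp only [Pi.pow_apply, id, Real.rpow_sub_one hF, gasDensity]
  push_cast
  field_simp

lemma hasDerivAt_pressure {γ ρ : ℝ} (hγ : 1 < γ) (hρ : 0 < ρ) :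
    HasDerivAt (pressure γ) ((γ - 1) * ρ ^ (γ - 1)) ρ := by
  have d := (Real.hasDerivAt_rpow_const (x := ρ) (p := γ) (Or.inl hρ.ne')).const_mul ((γ - 1) / γ)
  refine d.congr_deriv ?_
  field_simp

/-- For `γ < 3` the density is a Lipschitz function of the Riemann variables down to vacuum. -/
lemma exists_lipschitz_gasDensity {γ : ℝ} (hγ : γ ∈ Ioo (1 : ℝ) 3) {R : ℝ} (hR : 0 ≤ R) :
    ∃ C : ℝ, 0 ≤ C ∧ ∀ D ∈ Icc 0 R, ∀ E ∈ Icc 0 R,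
      |gasDensity γ D - gasDensity γ E| ≤ C * |D - E| := by
  have h1 := sub_pos.2 hγ.1
  have hp : (1 : ℝ) ≤ 2 / (γ - 1) := by
    rw [le_div_iff₀ h1]
    linarith [hγ.2]
  obtain ⟨C, hC, h⟩ := exists_holder_rpow one_pos le_rfl hp hR
  have e : ∀ D, 0 ≤ D → gasDensity γ D = D ^ (2 / (γ - 1)) * gasDensity γ 1 := fun D hD => by
    rw [← gasDensity_mul hγ.1 hD, mul_one]
  refine ⟨C * |gasDensity γ 1|, by positivity, fun D hD E hE => ?_⟩
  rw [e D hD.1, e E hE.1, ← sub_mul, abs_mul, mul_right_comm]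
  have := h D hD E hE
  rw [Real.rpow_one] at this
  exact mul_le_mul_of_nonneg_right this (abs_nonneg _)

/-- The velocity of the gas with Riemann variables `r` and `ℓ`. -/
noncomputable def riemannVelocity (r ℓ : ℝ → ℝ → ℝ) (t x : ℝ) : ℝ := -(r t x + ℓ t x) / 2

/-- The density of the gas with Riemann variables `r` and `ℓ`. -/
noncomputable def riemannDensity (γ : ℝ) (r ℓ : ℝ → ℝ → ℝ) (t x : ℝ) : ℝ :=
  gasDensity γ (ℓ t x - r t x)

/-- The Euler equations in Riemann variables: away from vacuum they follow from transport along the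
two families of characteristics, of speeds `-(a r + (1 - a) ℓ)` and `-(a ℓ + (1 - a) r)` with
`a = (γ + 1) / 4`. -/
lemma eulerAt_of_transport {γ : ℝ} (hγ : 1 < γ) {r ℓ : ℝ → ℝ → ℝ} {t x rx lx : ℝ}
    (hlt : r t x < ℓ t x) (hrx : HasDerivAt (r t) rx x)
    (hrt : HasDerivAt (fun s => r s x)
      (((γ + 1) / 4 * r t x + (1 - (γ + 1) / 4) * ℓ t x) * rx) t)
    (hlx : HasDerivAt (ℓ t) lx x)
    (hlt' : HasDerivAt (fun s => ℓ s x)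
      (((γ + 1) / 4 * ℓ t x + (1 - (γ + 1) / 4) * r t x) * lx) t) :
    EulerAt γ (riemannDensity γ r ℓ) (riemannVelocity r ℓ) t x := by
  have h1 := sub_pos.2 hγ
  have hD : 0 < ℓ t x - r t x := sub_pos.2 hlt
  have hρ := gasDensity_pos hγ hD
  have ρx := HasDerivAt.comp x (hasDerivAt_gasDensity hγ hD) (hlx.sub hrx)
  have ρt := HasDerivAt.comp (h := fun s => ℓ s x - r s x) t (hasDerivAt_gasDensity hγ hD)
    (hlt'.sub hrt)
  have ux := (hrx.add hlx).neg.div_const 2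
  have ut := (hrt.add hlt').neg.div_const 2
  have px := (hasDerivAt_pressure hγ hρ).comp x ρx
  rw [gasDensity_rpow hγ] at px
  unfold EulerAt riemannDensity riemannVelocity
  constructor
  · rw [show deriv (fun s => gasDensity γ (ℓ s x - r s x)) t = _ from ρt.deriv,
      show deriv (fun z => gasDensity γ (ℓ t z - r t z) * (-(r t z + ℓ t z) / 2)) x = _ from
        (ρx.mul ux).deriv]
    simp only [Function.comp, Pi.sub_apply, Pi.add_apply, Pi.neg_apply]
    field_simp
    ring
  · rw [show deriv (fun s => gasDensity γ (ℓ s x - r s x) * (-(r s x + ℓ s x) / 2)) t = _ from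
        (ρt.mul ut).deriv,
      show deriv (fun z => gasDensity γ (ℓ t z - r t z) * (-(r t z + ℓ t z) / 2) ^ 2 +
        pressure γ (gasDensity γ (ℓ t z - r t z))) x = _ from ((ρx.mul (ux.pow 2)).add px).deriv]
    simp only [Function.comp, Pi.sub_apply, Pi.add_apply, Pi.neg_apply, Pi.pow_apply]
    field_simp
    ring

/-- A real-valued form of the Hölder condition. -/
lemma holderUpToOrigin_of_dist {b : ℝ → ℝ} {f : ℝ → ℝ → ℝ} {α : ℝ} (hα : 0 < α) (hα1 : α ≤ 1)
    (h : ∀ R : ℝ, 0 < R → ∃ C : ℝ, 0 ≤ C ∧ ∀ p₁ p₂ : ℝ × ℝ, b p₁.1 ≤ p₁.2 → b p₂.1 ≤ p₂.2 →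
      ‖p₁‖ ≤ R → ‖p₂‖ ≤ R → |f p₁.1 p₁.2 - f p₂.1 p₂.2| ≤ C * dist p₁ p₂ ^ α) :
    HolderUpToOrigin b f := by
  refine ⟨α.toNNReal, Real.toNNReal_pos.2 hα, Real.toNNReal_le_one.2 hα1, fun R hR => ?_⟩
  obtain ⟨C, hC, hf⟩ := h R hR
  refine ⟨C.toNNReal, fun p₁ h₁ p₂ h₂ => ?_⟩
  have := hf p₁ p₂ h₁.1 h₂.1 (mem_closedBall_zero_iff.1 h₁.2) (mem_closedBall_zero_iff.1 h₂.2)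
  rw [edist_dist, edist_dist, Real.dist_eq, Real.coe_toNNReal α hα.le,
    ENNReal.ofReal_rpow_of_nonneg dist_nonneg hα.le,
    show (C.toNNReal : ENNReal) = ENNReal.ofReal C from rfl, ← ENNReal.ofReal_mul hC]
  exact ENNReal.ofReal_le_ofReal this

lemma HolderUpToOrigin.continuousOn {b : ℝ → ℝ} {f : ℝ → ℝ → ℝ} (h : HolderUpToOrigin b f) :
    ContinuousOn (fun p : ℝ × ℝ => f p.1 p.2) (closedFluidDomain b) := by
  obtain ⟨α, hα, -, h⟩ := h
  intro p hp
  obtain ⟨C, hC⟩ := h (‖p‖ + 1) (by positivity)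
  have h2 := hC.continuousOn hα p ⟨hp, mem_closedBall_zero_iff.2 (by linarith)⟩
  refine h2.mono_of_mem_nhdsWithin (inter_mem self_mem_nhdsWithin (mem_nhdsWithin_of_mem_nhds ?_))
  refine Filter.mem_of_superset (Metric.ball_mem_nhds p one_pos) fun z hz => ?_
  rw [mem_closedBall_zero_iff]
  have : ‖z - p‖ < 1 := mem_ball_iff_norm.1 hz
  linarith [norm_le_norm_add_norm_sub' z p]

/-! ### The vacuum Euler flow -/

/-- Points of the three regions of regularity, in terms of the two curves. -/
lemma mem_regular {δ yB yD : ℝ} (hBD : yB < yD) (hD : yD < 0) {p : ℝ × ℝ}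
    (hp : p ∈ regionPos ∪ regionRight δ yD ∪ regionLeft δ yB yD) :
    powerCurve δ yB p.1 < p.2 ∧ p.2 ≠ powerCurve δ yD p.1 := by
  have hle : ∀ y < 0, ∀ t, powerCurve δ y t ≤ 0 := fun y hy t => by
    unfold powerCurve
    split_ifs with h
    · exact le_rfl
    · exact mul_nonpos_of_nonpos_of_nonneg hy.le (Real.rpow_nonneg (not_lt.1 h) _)
  rcases hp with (hp | hp) | hp
  · have hp : 0 < p.2 := hp
    exact ⟨(hle yB (hBD.trans hD) p.1).trans_lt hp, ((hle yD hD p.1).trans_lt hp).ne'⟩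
  · rw [powerCurve_of_nonneg hp.1.le, powerCurve_of_nonneg hp.1.le]
    have := mul_lt_mul_of_pos_right hBD (Real.rpow_pos_of_pos hp.1 δ)
    exact ⟨this.trans hp.2, hp.2.ne'⟩
  · rw [powerCurve_of_nonneg hp.1.le, powerCurve_of_nonneg hp.1.le]
    exact ⟨hp.2.1, hp.2.2.ne⟩

namespace IsRiemannFlow

variable {γ q d K yB yD : ℝ} {r ℓ : ℝ → ℝ → ℝ}

lemma yB_neg {a : ℝ} (h : IsRiemannFlow a q d K yB yD r ℓ) : yB < 0 := h.yB_lt.trans h.yD_neg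

lemma eq_zero_of_nonpos {a : ℝ} (h : IsRiemannFlow a q d K yB yD r ℓ) (hq : 0 < q) {t : ℝ}
    (ht : t ≤ 0) : r t 0 = 0 ∧ ℓ t 0 = 0 := by
  have hδ : (1 + 1 / q) ≠ 0 := by positivity
  have h1 := (h.right t 0 (powerCurve_of_nonpos hδ ht).le).1
  have h2 := h.vacuum t
  rw [powerCurve_of_nonpos hδ ht] at h2
  exact ⟨h1, h2 ▸ h1⟩

lemma enthalpy_eq (hγ : 1 < γ) (t x : ℝ) :
    enthalpy γ (riemannDensity γ r ℓ) t x = (γ - 1) / 16 * (ℓ t x - r t x) ^ 2 :=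
  gasDensity_rpow hγ _

lemma scaling_velocity {a : ℝ} (h : IsRiemannFlow a q d K yB yD r ℓ) {s t x : ℝ} (hs : 0 < s)
    (hx : powerCurve (1 + 1 / q) yB t ≤ x) :
    riemannVelocity r ℓ (s * t) (s ^ (1 + 1 / q) * x) = s ^ (1 / q) * riemannVelocity r ℓ t x := by
  obtain ⟨e1, e2⟩ := h.scaling s t x hs hx
  simp only [riemannVelocity, e1, e2]
  ring

lemma scaling_sub {a : ℝ} (h : IsRiemannFlow a q d K yB yD r ℓ) {s t x : ℝ} (hs : 0 < s)
    (hx : powerCurve (1 + 1 / q) yB t ≤ x) :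
    ℓ (s * t) (s ^ (1 + 1 / q) * x) - r (s * t) (s ^ (1 + 1 / q) * x) =
      s ^ (1 / q) * (ℓ t x - r t x) := by
  obtain ⟨e1, e2⟩ := h.scaling s t x hs hx
  rw [e1, e2]
  ring

lemma scaling_density {a : ℝ} (h : IsRiemannFlow a q d K yB yD r ℓ) (hγ : 1 < γ) {s t x : ℝ}
    (hs : 0 < s) (hx : powerCurve (1 + 1 / q) yB t ≤ x) :
    riemannDensity γ r ℓ (s * t) (s ^ (1 + 1 / q) * x) =
      s ^ (1 / q * (2 / (γ - 1))) * riemannDensity γ r ℓ t x := by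
  simp only [riemannDensity, h.scaling_sub hs hx, gasDensity_mul hγ (Real.rpow_nonneg hs.le _),
    Real.rpow_mul hs.le]

lemma eulerAt (h : IsRiemannFlow ((γ + 1) / 4) q d K yB yD r ℓ) (hγ : 1 < γ) {t x : ℝ}
    (hB : powerCurve (1 + 1 / q) yB t < x) (hD : x ≠ powerCurve (1 + 1 / q) yD t) :
    EulerAt γ (riemannDensity γ r ℓ) (riemannVelocity r ℓ) t x := by
  obtain ⟨rx, lx, h1, h2, h3, h4⟩ := h.transport t x hB hD
  exact eulerAt_of_transport hγ (h.lt t x hB) h1 h2 h3 h4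

lemma contDiffAt_velocity {a : ℝ} (h : IsRiemannFlow a q d K yB yD r ℓ) {p : ℝ × ℝ}
    (hB : powerCurve (1 + 1 / q) yB p.1 < p.2) (hD : p.2 ≠ powerCurve (1 + 1 / q) yD p.1) :
    ContDiffAt ℝ ∞ (fun p : ℝ × ℝ => riemannVelocity r ℓ p.1 p.2) p := by
  obtain ⟨h1, h2⟩ := h.smooth p.1 p.2 hB hD
  exact (h1.add h2).neg.div_const 2

lemma contDiffAt_density {a : ℝ} (h : IsRiemannFlow a q d K yB yD r ℓ) (hγ : 1 < γ) {p : ℝ × ℝ}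
    (hB : powerCurve (1 + 1 / q) yB p.1 < p.2) (hD : p.2 ≠ powerCurve (1 + 1 / q) yD p.1) :
    ContDiffAt ℝ ∞ (fun p : ℝ × ℝ => riemannDensity γ r ℓ p.1 p.2) p := by
  obtain ⟨h1, h2⟩ := h.smooth p.1 p.2 hB hD
  exact (contDiffAt_gasDensity hγ (sub_pos.2 (h.lt p.1 p.2 hB))).comp p (h2.sub h1)

lemma smoothInRegions {a : ℝ} (h : IsRiemannFlow a q d K yB yD r ℓ) {f : ℝ → ℝ → ℝ}
    (hf : ∀ p : ℝ × ℝ, powerCurve (1 + 1 / q) yB p.1 < p.2 →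
      p.2 ≠ powerCurve (1 + 1 / q) yD p.1 → ContDiffAt ℝ ∞ (fun p : ℝ × ℝ => f p.1 p.2) p) :
    SmoothInRegions (1 + 1 / q) yB yD f := by
  have key : ∀ p ∈ regionPos ∪ regionRight (1 + 1 / q) yD ∪ regionLeft (1 + 1 / q) yB yD,
      ContDiffAt ℝ ∞ (fun p : ℝ × ℝ => f p.1 p.2) p := fun p hp =>
    hf p (mem_regular h.yB_lt h.yD_neg hp).1 (mem_regular h.yB_lt h.yD_neg hp).2
  exact ⟨fun p hp => (key p (Or.inl (Or.inl hp))).contDiffWithinAt,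
    fun p hp => (key p (Or.inl (Or.inr hp))).contDiffWithinAt,
    fun p hp => (key p (Or.inr hp)).contDiffWithinAt⟩

/-! ### Hölder continuity of velocity and density -/

lemma holder_velocity {a : ℝ} (h : IsRiemannFlow a q d K yB yD r ℓ) :
    HolderUpToOrigin (powerCurve (1 + 1 / q) yB) (riemannVelocity r ℓ) := by
  obtain ⟨α, hα, hα1, H⟩ := h.holder
  refine holderUpToOrigin_of_dist hα hα1 fun R hR => ?_
  obtain ⟨C, hC, hf⟩ := H R
  refine ⟨C, hC, fun p₁ p₂ h₁ h₂ n₁ n₂ => ?_⟩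
  obtain ⟨e1, e2⟩ := hf p₁ p₂ h₁ h₂ ((norm_fst_le p₁).trans n₁) ((norm_snd_le p₁).trans n₁)
    ((norm_fst_le p₂).trans n₂) ((norm_snd_le p₂).trans n₂)
  rw [riemannVelocity, riemannVelocity]
  rw [abs_le] at e1 e2 ⊢
  constructor <;> linarith

lemma holder_density {a : ℝ} (h : IsRiemannFlow a q d K yB yD r ℓ) (hγ : γ ∈ Ioo (1 : ℝ) 3)
    (hq : 0 < q) : HolderUpToOrigin (powerCurve (1 + 1 / q) yB) (riemannDensity γ r ℓ) := by
  obtain ⟨α, hα, hα1, H⟩ := h.holder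
  refine holderUpToOrigin_of_dist hα hα1 fun R hR => ?_
  obtain ⟨C, hC, hf⟩ := H R
  have hdiff : ∀ p₁ p₂ : ℝ × ℝ, powerCurve (1 + 1 / q) yB p₁.1 ≤ p₁.2 →
      powerCurve (1 + 1 / q) yB p₂.1 ≤ p₂.2 → ‖p₁‖ ≤ R → ‖p₂‖ ≤ R →
      |(ℓ p₁.1 p₁.2 - r p₁.1 p₁.2) - (ℓ p₂.1 p₂.2 - r p₂.1 p₂.2)| ≤ 2 * C * dist p₁ p₂ ^ α := by
    intro p₁ p₂ h₁ h₂ n₁ n₂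
    obtain ⟨e1, e2⟩ := hf p₁ p₂ h₁ h₂ ((norm_fst_le p₁).trans n₁) ((norm_snd_le p₁).trans n₁)
      ((norm_fst_le p₂).trans n₂) ((norm_snd_le p₂).trans n₂)
    rw [abs_le] at e1 e2 ⊢
    constructor <;> linarith
  -- the Riemann variables vanish at the origin, hence are bounded
  have hbd : ∀ p : ℝ × ℝ, powerCurve (1 + 1 / q) yB p.1 ≤ p.2 → ‖p‖ ≤ R →
      ℓ p.1 p.2 - r p.1 p.2 ∈ Icc 0 (2 * C * R ^ α) := by
    intro p hp hn
    obtain ⟨z1, z2⟩ := h.eq_zero_of_nonpos hq le_rfl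
    have := hdiff p 0 hp (powerCurve_of_nonpos (by positivity) le_rfl).le hn (by simpa using hR.le)
    rw [Prod.fst_zero, Prod.snd_zero, z1, z2, sub_zero, sub_zero, dist_zero_right] at this
    refine ⟨sub_nonneg.2 (h.nonneg p.1 p.2 hp).2, (le_abs_self _).trans (this.trans ?_)⟩
    have := Real.rpow_le_rpow (norm_nonneg p) hn hα.le
    gcongr
  obtain ⟨C', hC', hl⟩ := exists_lipschitz_gasDensity hγ (R := 2 * C * R ^ α) (by positivity)
  refine ⟨C' * (2 * C), by positivity, fun p₁ p₂ h₁ h₂ n₁ n₂ => ?_⟩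
  rw [mul_assoc]
  exact (hl _ (hbd p₁ h₁ n₁) _ (hbd p₂ h₂ n₂)).trans
    (mul_le_mul_of_nonneg_left (hdiff p₁ p₂ h₁ h₂ n₁ n₂) hC')

/-! ### The weak discontinuity -/

lemma onlyLipschitz_velocity {a : ℝ} (h : IsRiemannFlow a q d K yB yD r ℓ) :
    OnlyLipschitzAcross (1 + 1 / q) yB yD (riemannVelocity r ℓ) := by
  intro t ht
  obtain ⟨hr, hl⟩ := h.lipschitz t ht
  have hsm : ContDiffAt ℝ 1 (fun z : ℝ × ℝ => -(z.1 + z.2) / 2)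
      (r t (yD * t ^ (1 + 1 / q)), ℓ t (yD * t ^ (1 + 1 / q))) := by fun_prop
  refine ⟨LipschitzNear.comp (g := fun z : ℝ × ℝ => -(z.1 + z.2) / 2)
    (f := fun p : ℝ × ℝ => (r p.1 p.2, ℓ p.1 p.2)) hsm.lipschitzNear
    (hr.prodMk hl), ?_⟩
  obtain ⟨κ, lx, hκ, k1, k2, k3, k4⟩ := h.kink t ht
  have hder : ∀ p ∈ regionPos ∪ regionRight (1 + 1 / q) yD ∪ regionLeft (1 + 1 / q) yB yD,
      -(deriv (r p.1) p.2 + deriv (ℓ p.1) p.2) / 2 =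
        deriv (riemannVelocity r ℓ p.1) p.2 := fun p hp => by
    obtain ⟨m1, m2⟩ := mem_regular h.yB_lt h.yD_neg hp
    obtain ⟨rx, lx, h1, -, h3, -⟩ := h.transport p.1 p.2 m1 m2
    rw [h1.deriv, h3.deriv]
    exact ((h1.add h3).neg.div_const 2).deriv.symm
  refine ⟨-(κ + lx) / 2, -(0 + lx) / 2, fun e => hκ (by linarith), ?_, ?_⟩
  · exact (((k1.add k3).neg.div_const 2).congr'
      (eventually_mem_nhdsWithin.mono fun p hp => hder p (Or.inr hp)))
  · exact (((k2.add k4).neg.div_const 2).congr'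
      (eventually_mem_nhdsWithin.mono fun p hp => hder p (Or.inl (Or.inr hp))))

lemma onlyLipschitz_density {a : ℝ} (h : IsRiemannFlow a q d K yB yD r ℓ) (hγ : 1 < γ) :
    OnlyLipschitzAcross (1 + 1 / q) yB yD (riemannDensity γ r ℓ) := by
  intro t ht
  obtain ⟨hr, hl⟩ := h.lipschitz t ht
  have hγ' := sub_pos.2 hγ
  have hlt : powerCurve (1 + 1 / q) yB t < yD * t ^ (1 + 1 / q) := by
    rw [powerCurve_of_nonneg ht.le]
    exact mul_lt_mul_of_pos_right h.yB_lt (Real.rpow_pos_of_pos ht _)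
  have hD := sub_pos.2 (h.lt t _ hlt)
  have hsub : ContDiffAt ℝ 1 (fun z : ℝ × ℝ => z.2 - z.1)
      (r t (yD * t ^ (1 + 1 / q)), ℓ t (yD * t ^ (1 + 1 / q))) := by fun_prop
  have hsm : ContDiffAt ℝ 1 (fun z : ℝ × ℝ => gasDensity γ (z.2 - z.1))
      (r t (yD * t ^ (1 + 1 / q)), ℓ t (yD * t ^ (1 + 1 / q))) :=
    ((contDiffAt_gasDensity hγ hD).of_le (by simp)).comp
      (g := gasDensity γ) (f := fun z : ℝ × ℝ => z.2 - z.1) _ hsub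
  refine ⟨LipschitzNear.comp (g := fun z : ℝ × ℝ => gasDensity γ (z.2 - z.1))
    (f := fun p : ℝ × ℝ => (r p.1 p.2, ℓ p.1 p.2)) hsm.lipschitzNear
    (hr.prodMk hl), ?_⟩
  obtain ⟨κ, lx, hκ, k1, k2, k3, k4⟩ := h.kink t ht
  have hder : ∀ p ∈ regionPos ∪ regionRight (1 + 1 / q) yD ∪ regionLeft (1 + 1 / q) yB yD,
      2 / (γ - 1) * gasDensity γ (ℓ p.1 p.2 - r p.1 p.2) / (ℓ p.1 p.2 - r p.1 p.2) *
        (deriv (ℓ p.1) p.2 - deriv (r p.1) p.2) =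
      deriv (riemannDensity γ r ℓ p.1) p.2 := fun p hp => by
    obtain ⟨m1, m2⟩ := mem_regular h.yB_lt h.yD_neg hp
    obtain ⟨rx, lx, h1, -, h3, -⟩ := h.transport p.1 p.2 m1 m2
    rw [h1.deriv, h3.deriv]
    exact ((hasDerivAt_gasDensity hγ (sub_pos.2 (h.lt p.1 p.2 m1))).comp p.2
      (h3.sub h1)).deriv.symm
  have hcD : ContinuousAt (fun p : ℝ × ℝ => ℓ p.1 p.2 - r p.1 p.2) (t, yD * t ^ (1 + 1 / q)) :=
    hl.continuousAt.sub hr.continuousAt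
  have hcoef := ((((continuous_gasDensity hγ).continuousAt.comp hcD).const_mul (2 / (γ - 1))).div
    hcD hD.ne').tendsto
  set m : ℝ := 2 / (γ - 1) * gasDensity γ (ℓ t (yD * t ^ (1 + 1 / q)) -
    r t (yD * t ^ (1 + 1 / q))) / (ℓ t (yD * t ^ (1 + 1 / q)) - r t (yD * t ^ (1 + 1 / q))) with hm
  have hm0 : 0 < m := by
    have := gasDensity_pos hγ hD
    positivity
  refine ⟨m * (lx - κ), m * (lx - 0), fun e => hκ ?_, ?_, ?_⟩
  · have := mul_left_cancel₀ hm0.ne' e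
    linarith
  · exact (((hcoef.mono_left nhdsWithin_le_nhds).mul (k3.sub k1)).congr'
      (eventually_mem_nhdsWithin.mono fun p hp => hder p (Or.inr hp)))
  · exact (((hcoef.mono_left nhdsWithin_le_nhds).mul (k4.sub k2)).congr'
      (eventually_mem_nhdsWithin.mono fun p hp => hder p (Or.inl (Or.inr hp))))

lemma physicalVacuumAt {a : ℝ} (h : IsRiemannFlow a q d K yB yD r ℓ) (hγ : 1 < γ) {t : ℝ}
    (ht : 0 < t) : PhysicalVacuumAt γ (powerCurve (1 + 1 / q) yB) (riemannDensity γ r ℓ) t := by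
  obtain ⟨κ, hκ, hd⟩ := h.physical t ht
  have := sub_pos.2 hγ
  refine ⟨(γ - 1) / 16 * κ, by positivity, ?_⟩
  exact (hd.const_mul ((γ - 1) / 16)).congr_of_mem (fun x _ => enthalpy_eq hγ t x) self_mem_Ici

/-! ### Self-similarity -/

lemma selfSimilarBefore {a : ℝ} (h : IsRiemannFlow a q d K yB yD r ℓ) (hγ : 1 < γ) (hq : 0 < q) :
    SelfSimilarBefore γ (1 + 1 / q) (riemannDensity γ r ℓ) (riemannVelocity r ℓ) := by
  have hγ' := sub_pos.2 hγ
  have hδ : 0 < 1 + 1 / q := by positivity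
  have hB : ∀ y : ℝ, 0 ≤ y → powerCurve (1 + 1 / q) yB (-1) ≤ y := fun y hy => by
    rwa [powerCurve_of_nonpos hδ.ne' (by norm_num)]
  obtain ⟨z1, z2⟩ := h.eq_zero_of_nonpos hq (t := -1) (by norm_num)
  refine ⟨fun y => (r (-1) y + ℓ (-1) y) / 2 / ((1 + 1 / q) * y),
    fun y => (γ - 1) * ((γ - 1) / 16 * (ℓ (-1) y - r (-1) y) ^ 2) / ((1 + 1 / q) ^ 2 * y ^ 2),
    fun y hy => ⟨?_, by positivity⟩, fun t x y ht hx hy => ?_⟩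
  · obtain ⟨h1, h2⟩ := h.nonneg (-1) y (hB y hy)
    have := h1.trans h2
    positivity
  · have hs : 0 < -t := neg_pos.2 ht
    have hsp := Real.rpow_pos_of_pos hs (1 + 1 / q)
    have hy0 : 0 ≤ y := hy ▸ div_nonneg hx hsp.le
    have et : -t * -1 = t := by ring
    have ex : (-t) ^ (1 + 1 / q) * y = x := by rw [hy, mul_div_cancel₀ _ hsp.ne']
    have e1 := h.scaling_velocity hs (hB y hy0)
    have e2 := h.scaling_sub hs (hB y hy0)
    rw [et, ex] at e1 e2
    have ep : (-t) ^ (2 * (1 + 1 / q - 1)) = ((-t) ^ (1 / q)) ^ 2 := by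
      rw [← Real.rpow_natCast, ← Real.rpow_mul hs.le]
      congr 1
      push_cast
      ring
    rw [enthalpy_eq hγ, e1, e2, ep, add_sub_cancel_left, riemannVelocity]
    rcases hy0.eq_or_lt with rfl | hy0
    · simp [z1, z2]
    · constructor
      · field_simp
      · field_simp

lemma selfSimilarAfter (h : IsRiemannFlow ((γ + 1) / 4) q d K yB yD r ℓ) (hγ : γ ∈ Ioo (1 : ℝ) 3)
    (hq : 0 < q) :
    SelfSimilarAfter γ (1 + 1 / q) yB yD (riemannDensity γ r ℓ) (riemannVelocity r ℓ) := by
  have hγ' := sub_pos.2 hγ.1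
  have hδ : 0 < 1 + 1 / q := by positivity
  have hc : ∀ y : ℝ, powerCurve (1 + 1 / q) y 1 = y := fun y => by
    rw [powerCurve_of_nonneg zero_le_one, Real.one_rpow, mul_one]
  refine ⟨fun y => -(r 1 y + ℓ 1 y) / 2 / ((1 + 1 / q) * y),
    fun y => (γ - 1) * ((γ - 1) / 16 * (ℓ 1 y - r 1 y) ^ 2) / ((1 + 1 / q) ^ 2 * y ^ 2),
    fun y hy hy0 => ⟨?_, by positivity⟩, fun y hy0 => ⟨?_, by positivity⟩, ?_,
    fun t x y ht hx hx0 hy => ?_⟩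
  · have hy' := (hc yB).le.trans hy
    have h1 := (h.nonneg 1 y hy').1
    have h2 := h.l_pos 1 y one_pos hy'
    exact div_pos_of_neg_of_neg (by linarith) (mul_neg_of_pos_of_neg hδ hy0)
  · have hy' := (hc yB).le.trans (h.yB_neg.trans hy0).le
    have h1 := (h.nonneg 1 y hy').1
    have h2 := h.l_pos 1 y one_pos hy'
    exact div_neg_of_neg_of_pos (by linarith) (mul_pos hδ hy0)
  · have hr := (h.right 1 yD (hc yD).le).1
    have hl := h.l_pos 1 yD one_pos ((hc yB).le.trans h.yB_lt.le)
    have h3 : 3 - γ ≠ 0 := (sub_pos.2 hγ.2).ne'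
    have hs : (1 + 1 / q) * yD = -((3 - γ) / 4 * ℓ 1 yD) := by
      rw [h.sonic]
      ring
    simp only [hr, ← mul_pow, hs]
    field_simp
    ring
  · have hsp := Real.rpow_pos_of_pos ht (1 + 1 / q)
    have et : t * 1 = t := mul_one t
    have ex : t ^ (1 + 1 / q) * y = x := by rw [hy, mul_div_cancel₀ _ hsp.ne']
    have hyB : powerCurve (1 + 1 / q) yB 1 ≤ y := by
      rw [hc, hy, le_div_iff₀ hsp]
      exact hx
    have hy0 : y ≠ 0 := fun h0 => hx0 (by rw [← ex, h0, mul_zero])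
    have e1 := h.scaling_velocity ht hyB
    have e2 := h.scaling_sub ht hyB
    rw [et, ex] at e1 e2
    have ep : t ^ (2 * (1 + 1 / q - 1)) = (t ^ (1 / q)) ^ 2 := by
      rw [← Real.rpow_natCast, ← Real.rpow_mul ht.le]
      congr 1
      push_cast
      ring
    rw [enthalpy_eq hγ.1, e1, e2, ep, add_sub_cancel_left, riemannVelocity]
    constructor
    · field_simp
    · field_simp

/-! ### The free boundary problem -/

lemma kinematic_velocity {a : ℝ} (h : IsRiemannFlow a q d K yB yD r ℓ) (hq : 0 < q) (t : ℝ) :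
    HasDerivAt (powerCurve (1 + 1 / q) yB)
      (riemannVelocity r ℓ t (powerCurve (1 + 1 / q) yB t)) t := by
  have hδ : 0 < 1 + 1 / q := by positivity
  have hq' : 0 < 1 / q := by positivity
  have hv : ∀ t, riemannVelocity r ℓ t (powerCurve (1 + 1 / q) yB t) =
      (1 + 1 / q) * yB * max t 0 ^ (1 / q) := by
    intro t
    rw [riemannVelocity, h.vacuum t]
    rcases le_total 0 t with ht | ht
    · rw [powerCurve_of_nonneg ht, h.kinematic t ht, max_eq_left ht]
      ring
    · rw [powerCurve_of_nonpos hδ.ne' ht, (h.eq_zero_of_nonpos hq ht).2, max_eq_right ht,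
        Real.zero_rpow hq'.ne']
      ring
  rw [hv]
  refine hasDerivAt_of_off_countable (g := fun t => (1 + 1 / q) * yB * max t 0 ^ (1 / q))
    (countable_singleton (0 : ℝ)) (continuous_powerCurve hδ yB)
    (continuous_const.mul ((Real.continuous_rpow_const hq'.le).comp
      (continuous_id.max continuous_const))) (fun t ht => ?_) t
  rcases lt_or_gt_of_ne (show t ≠ 0 from ht) with ht | ht
  · rw [max_eq_right ht.le, Real.zero_rpow hq'.ne', mul_zero]
    refine (hasDerivAt_const t (0 : ℝ)).congr_of_eventuallyEq ?_
    filter_upwards [gt_mem_nhds ht] with s hs using if_pos hs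
  · rw [max_eq_left ht.le]
    have hd := (Real.hasDerivAt_rpow_const (x := t) (p := 1 + 1 / q) (Or.inl ht.ne')).const_mul yB
    rw [add_sub_cancel_left] at hd
    refine (hd.congr_deriv (by ring)).congr_of_eventuallyEq ?_
    filter_upwards [lt_mem_nhds ht] with s hs using powerCurve_of_nonneg hs.le

lemma weakEuler (h : IsRiemannFlow ((γ + 1) / 4) q d K yB yD r ℓ) (hγ : γ ∈ Ioo (1 : ℝ) 3)
    (hq : 0 < q) :
    WeakEuler γ (powerCurve (1 + 1 / q) yB) (riemannDensity γ r ℓ) (riemannVelocity r ℓ) := by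
  intro φ hφ hφc
  have hδ : 0 < 1 + 1 / q := by positivity
  have h1 := sub_pos.2 hγ.1
  have cρ := (h.holder_density hγ hq).continuousOn
  have cu := h.holder_velocity.continuousOn
  have cp : ContinuousOn (fun p : ℝ × ℝ => pressure γ (riemannDensity γ r ℓ p.1 p.2))
      (closedFluidDomain (powerCurve (1 + 1 / q) yB)) :=
    (continuous_const.mul (Real.continuous_rpow_const
      (by linarith [hγ.1] : (0 : ℝ) ≤ γ))).comp_continuousOn cρ
  have hρ0 : ∀ t, riemannDensity γ r ℓ t (powerCurve (1 + 1 / q) yB t) = 0 := fun t => by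
    rw [riemannDensity, h.vacuum t, sub_self, gasDensity_zero hγ.1]
  have hp0 : pressure γ 0 = 0 := by
    rw [pressure, Real.zero_rpow (by linarith [hγ.1]), mul_zero]
  have sρ := fun s t x hs hx => h.scaling_density hγ.1 (s := s) (t := t) (x := x) hs hx
  have su := fun s t x hs hx => h.scaling_velocity (s := s) (t := t) (x := x) hs hx
  have sp : ∀ s t x, 0 < s → powerCurve (1 + 1 / q) yB t ≤ x →
      pressure γ (riemannDensity γ r ℓ (s * t) (s ^ (1 + 1 / q) * x)) =
        s ^ (1 / q * (2 / (γ - 1))) * (s ^ (1 / q)) ^ 2 * pressure γ (riemannDensity γ r ℓ t x) := by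
    intro s t x hs hx
    have hD := sub_nonneg.2 (h.nonneg t x hx).2
    rw [riemannDensity, riemannDensity, h.scaling_sub hs hx,
      pressure_gasDensity hγ.1 (mul_nonneg (Real.rpow_nonneg hs.le _) hD),
      pressure_gasDensity hγ.1 hD, gasDensity_mul hγ.1 (Real.rpow_nonneg hs.le _),
      ← Real.rpow_mul hs.le]
    ring
  have hν : 0 < 1 / q * (2 / (γ - 1)) := by positivity
  have hρd : ∀ t x, powerCurve (1 + 1 / q) yB t < x → x ≠ powerCurve (1 + 1 / q) yD t →
      DifferentiableAt ℝ (fun p : ℝ × ℝ => riemannDensity γ r ℓ p.1 p.2) (t, x) :=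
    fun t x h2 h3 => (h.contDiffAt_density hγ.1 (p := (t, x)) h2 h3).differentiableAt (by simp)
  have hud : ∀ t x, powerCurve (1 + 1 / q) yB t < x → x ≠ powerCurve (1 + 1 / q) yD t →
      DifferentiableAt ℝ (fun p : ℝ × ℝ => riemannVelocity r ℓ p.1 p.2) (t, x) :=
    fun t x h2 h3 => (h.contDiffAt_velocity (p := (t, x)) h2 h3).differentiableAt (by simp)
  constructor
  · refine integral_homogeneous_eq_zero (A := riemannDensity γ r ℓ)
      (B := fun t x => riemannDensity γ r ℓ t x * riemannVelocity r ℓ t x)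
      hδ (add_pos hν hδ) h.yB_neg h.yD_neg cρ (cρ.mul cu) hρ0
      (fun t => by rw [hρ0, zero_mul]) sρ ?_ ?_ hφ hφc
    · intro s t x hs hx
      simp only [sρ s t x hs hx, su s t x hs hx]
      rw [show 1 / q * (2 / (γ - 1)) + (1 + 1 / q) - 1 = 1 / q * (2 / (γ - 1)) + 1 / q by ring,
        Real.rpow_add hs]
      ring
    · exact fun t x h2 h3 => ⟨hρd t x h2 h3, (hρd t x h2 h3).mul (hud t x h2 h3),
        (h.eulerAt hγ.1 h2 h3).1⟩
  · refine integral_homogeneous_eq_zero (ν := 1 / q * (2 / (γ - 1)) + 1 / q)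
      (A := fun t x => riemannDensity γ r ℓ t x * riemannVelocity r ℓ t x)
      (B := fun t x => riemannDensity γ r ℓ t x * riemannVelocity r ℓ t x ^ 2 +
        pressure γ (riemannDensity γ r ℓ t x))
      hδ (by positivity) h.yB_neg h.yD_neg (cρ.mul cu) ((cρ.mul (cu.pow 2)).add cp)
      (fun t => by rw [hρ0, zero_mul]) (fun t => by rw [hρ0, zero_mul, hp0, add_zero])
      ?_ ?_ ?_ hφ hφc
    · intro s t x hs hx
      simp only [sρ s t x hs hx, su s t x hs hx]
      rw [Real.rpow_add hs]
      ring
    · intro s t x hs hx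
      simp only [sp s t x hs hx, su s t x hs hx]
      rw [sρ s t x hs hx]
      rw [show 1 / q * (2 / (γ - 1)) + 1 / q + (1 + 1 / q) - 1 =
        1 / q * (2 / (γ - 1)) + 1 / q + 1 / q by ring, Real.rpow_add hs, Real.rpow_add hs]
      ring
    · intro t x h2 h3
      have h4 : DifferentiableAt ℝ (pressure γ) (riemannDensity γ r ℓ t x) :=
        (hasDerivAt_pressure hγ.1 (gasDensity_pos hγ.1
          (sub_pos.2 (h.lt t x h2)))).differentiableAt
      exact ⟨(hρd t x h2 h3).mul (hud t x h2 h3), ((hρd t x h2 h3).mul ((hud t x h2 h3).pow 2)).add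
        (h4.comp (f := fun p : ℝ × ℝ => riemannDensity γ r ℓ p.1 p.2) (t, x) (hρd t x h2 h3)),
        (h.eulerAt hγ.1 h2 h3).2⟩

lemma solvesVacuumEuler (h : IsRiemannFlow ((γ + 1) / 4) q d K yB yD r ℓ)
    (hγ : γ ∈ Ioo (1 : ℝ) 3) (hq : 0 < q) {T : ℝ} (hT : 0 < T) :
    SolvesVacuumEuler γ T (riemannDensity γ r ℓ (-T)) (riemannVelocity r ℓ (-T))
      (powerCurve (1 + 1 / q) yB) (riemannDensity γ r ℓ) (riemannVelocity r ℓ) := by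
  have hδ : 0 < 1 + 1 / q := by positivity
  have hb : powerCurve (1 + 1 / q) yB (-T) = 0 := powerCurve_of_nonpos hδ.ne' (by linarith)
  have hpos : ∀ t x, powerCurve (1 + 1 / q) yB t < x → 0 < riemannDensity γ r ℓ t x :=
    fun t x hx => gasDensity_pos hγ.1 (sub_pos.2 (h.lt t x hx))
  have hzero : ∀ t, riemannDensity γ r ℓ t (powerCurve (1 + 1 / q) yB t) = 0 := fun t => by
    rw [riemannDensity, h.vacuum t, sub_self, gasDensity_zero hγ.1]
  exact
    { continuousOn_density := (h.holder_density hγ hq).continuousOn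
      continuousOn_velocity := h.holder_velocity.continuousOn
      euler := h.weakEuler hγ hq
      density_pos := hpos
      density_boundary := hzero
      kinematic := h.kinematic_velocity hq
      initial_boundary := hb
      initial_density := fun _ _ => rfl
      initial_velocity := fun _ _ => rfl
      initial_density_pos := fun x hx => hpos _ _ (hb.trans_lt hx)
      initial_density_zero := by simpa only [hb] using hzero (-T) }

/-! ### The initial velocity -/

/-- At negative times the whole flow is the simple wave. -/
lemma initial_wave {a : ℝ} (h : IsRiemannFlow a q d K yB yD r ℓ) (hq : 0 < q) {T : ℝ} (hT : 0 < T)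
    {x : ℝ} (hx : 0 ≤ x) : r (-T) x = 0 ∧ 0 ≤ ℓ (-T) x ∧
      K * ℓ (-T) x ^ (q + 1) + a * T * ℓ (-T) x = x := by
  have hδ : 0 < 1 + 1 / q := by positivity
  obtain ⟨h1, h2⟩ := h.right (-T) x
    (by rwa [powerCurve_of_nonpos hδ.ne' (by linarith)])
  exact ⟨h1, h2.nonneg, by linear_combination h2.eq⟩

lemma initial_velocity_eq {a : ℝ} (h : IsRiemannFlow a q d K yB yD r ℓ) (hq : 0 < q) (ha : 0 < a)
    {T : ℝ} (hT : 0 < T) {x : ℝ} (hx : 0 ≤ x) :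
    riemannVelocity r ℓ (-T) x = -(x / (2 * a * T)) + K / (2 * a * T) * ℓ (-T) x ^ (q + 1) := by
  obtain ⟨h1, -, h3⟩ := h.initial_wave hq hT hx
  rw [riemannVelocity, h1]
  field_simp
  linear_combination -h3

lemma tendsto_initial_div {a : ℝ} (h : IsRiemannFlow a q d K yB yD r ℓ) (hq : 0 < q) (ha : 0 < a)
    (hK : 0 < K) {T : ℝ} (hT : 0 < T) :
    Tendsto (fun x => ℓ (-T) x / x) (𝓝[>] 0) (𝓝 (1 / (a * T))) := by
  have haT : 0 < a * T := mul_pos ha hT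
  have hid : Tendsto (fun x : ℝ => x / (a * T)) (𝓝[>] 0) (𝓝 0) := by
    have : Continuous fun x : ℝ => x / (a * T) := by fun_prop
    exact (this.tendsto' 0 0 (zero_div _)).mono_left nhdsWithin_le_nhds
  have h0 : Tendsto (fun x => ℓ (-T) x) (𝓝[>] 0) (𝓝 0) := by
    refine squeeze_zero' ?_ ?_ hid
    · filter_upwards [self_mem_nhdsWithin] with x hx using (h.initial_wave hq hT (le_of_lt hx)).2.1
    · filter_upwards [self_mem_nhdsWithin] with x hx
      obtain ⟨-, h2, h3⟩ := h.initial_wave hq hT (le_of_lt hx)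
      rw [le_div_iff₀ haT]
      have : 0 ≤ K * ℓ (-T) x ^ (q + 1) := by positivity
      linarith
  have h1 : Tendsto (fun x => 1 / (K * ℓ (-T) x ^ q + a * T)) (𝓝[>] 0) (𝓝 (1 / (a * T))) := by
    have h2 := ((h0.rpow_const (p := q) (Or.inr hq.le)).const_mul K).add_const (a * T)
    rw [Real.zero_rpow hq.ne', mul_zero, zero_add] at h2
    exact tendsto_const_nhds.div h2 haT.ne'
  refine h1.congr' ?_
  filter_upwards [self_mem_nhdsWithin] with x hx
  have hx : 0 < x := hx
  obtain ⟨-, h2, h3⟩ := h.initial_wave hq hT hx.le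
  have hden : 0 < K * ℓ (-T) x ^ q + a * T := by positivity
  rw [Real.rpow_add_one' h2 (by positivity)] at h3
  rw [div_eq_div_iff hden.ne' hx.ne']
  linear_combination -h3

lemma initialExpansion {a c : ℝ} (h : IsRiemannFlow a q d K yB yD r ℓ) (hq : 0 < q) (ha : 0 < a)
    {T : ℝ} (hT : 0 < T) (hc : 0 < c) (hK : K = 2 * c * (a * T) ^ (q + 2)) :
    (fun x : ℝ => riemannVelocity r ℓ (-T) x - (-(x / (2 * a * T)) + c * x ^ (q + 1)))
      =o[𝓝[>] (0 : ℝ)] fun x : ℝ => x ^ (q + 1) := by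
  have haT : 0 < a * T := mul_pos ha hT
  have hp := Real.rpow_pos_of_pos haT (q + 1)
  have hK' : K = 2 * c * ((a * T) ^ (q + 1) * (a * T)) := by
    rw [hK, ← Real.rpow_add_one haT.ne']
    ring_nf
  have hK0 : 0 < K := by
    rw [hK']
    positivity
  rw [Asymptotics.isLittleO_iff_tendsto']
  · have h1 := (((h.tendsto_initial_div hq ha hK0 hT).rpow_const (p := q + 1)
      (Or.inr (by positivity))).const_mul (K / (2 * a * T))).sub_const c
    have e : K / (2 * a * T) * (1 / (a * T)) ^ (q + 1) - c = 0 := by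
      rw [Real.div_rpow zero_le_one haT.le, Real.one_rpow, hK']
      field_simp
      ring
    rw [e] at h1
    refine h1.congr' ?_
    filter_upwards [self_mem_nhdsWithin] with x hx
    have hx : 0 < x := hx
    have hxp := Real.rpow_pos_of_pos hx (q + 1)
    rw [h.initial_velocity_eq hq ha hT hx.le,
      Real.div_rpow (h.initial_wave hq hT hx.le).2.1 hx.le, eq_div_iff hxp.ne']
    field_simp
    ring
  · filter_upwards [self_mem_nhdsWithin] with x hx h0
    exact absurd h0 (Real.rpow_pos_of_pos hx _).ne'

end IsRiemannFlow

theorem theorem1 (γ : ℝ) (hγ : γ ∈ Set.Ioo (1 : ℝ) 3) (μ : ℝ) (hμ : μ ∈ Set.Ioo (0 : ℝ) 1)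
    (T : ℝ) (hT : 0 < T) :
    ∃ ρ u : ℝ → ℝ → ℝ → ℝ,
      -- the members of the family, indexed by `c > 0`, are pairwise distinct
      (∀ c c' : ℝ, 0 < c → 0 < c' → c ≠ c' → ∃ x, 0 < x ∧ u c (-T) x ≠ u c' (-T) x) ∧
      ∀ c : ℝ, 0 < c →
        InitialExpansion γ μ T c (u c) ∧
        ∃ yB yD : ℝ, yB < yD ∧ yD < 0 ∧
          (∃ ρ₀ u₀ : ℝ → ℝ,
            SolvesVacuumEuler γ T ρ₀ u₀ (waitingBoundary μ yB) (ρ c) (u c)) ∧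
          -- self-similarity
          SelfSimilarBefore γ (1 / μ) (ρ c) (u c) ∧
          SelfSimilarAfter γ (1 / μ) yB yD (ρ c) (u c) ∧
          -- smoothness, and the equations hold classically, off the sonic curve
          SmoothInRegions (1 / μ) yB yD (ρ c) ∧ SmoothInRegions (1 / μ) yB yD (u c) ∧
          (∀ p ∈ regionPos ∪ regionRight (1 / μ) yD ∪ regionLeft (1 / μ) yB yD,
            EulerAt γ (ρ c) (u c) p.1 p.2) ∧
          -- weak discontinuity on the sonic curve
          OnlyLipschitzAcross (1 / μ) yB yD (ρ c) ∧ OnlyLipschitzAcross (1 / μ) yB yD (u c) ∧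
          -- Hölder continuity up to the singular point
          HolderUpToOrigin (waitingBoundary μ yB) (ρ c) ∧
          HolderUpToOrigin (waitingBoundary μ yB) (u c) ∧
          -- physical vacuum
          ∀ t, 0 < t → PhysicalVacuumAt γ (waitingBoundary μ yB) (ρ c) t := by
  obtain ⟨hμ0, hμ1⟩ := hμ
  have h1μ : 0 < 1 - μ := sub_pos.2 hμ1
  obtain ⟨q, hq, hqδ, hqx⟩ : ∃ q : ℝ, 0 < q ∧ 1 / μ = 1 + 1 / q ∧ 1 / (1 - μ) = q + 1 := by
    refine ⟨μ / (1 - μ), by positivity, ?_, ?_⟩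
    · field_simp
      ring
    · field_simp
      ring
  obtain ⟨a, ha⟩ : ∃ a : ℝ, a = (γ + 1) / 4 := ⟨_, rfl⟩
  have ha2 : 1 / 2 < a := by linarith [hγ.1]
  have ha1 : a < 1 := by linarith [hγ.2]
  have ha0 : 0 < a := by linarith
  have hflow : ∀ c : ℝ, ∃ (d yB yD : ℝ) (r ℓ : ℝ → ℝ → ℝ), 0 < c →
      IsRiemannFlow a q d (2 * c * (a * T) ^ (q + 2)) yB yD r ℓ := fun c => by
    by_cases hc : 0 < c
    · obtain ⟨d, yB, yD, r, ℓ, h⟩ :=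
        exists_riemannFlow ha2 ha1 hq (K := 2 * c * (a * T) ^ (q + 2)) (by positivity)
      exact ⟨d, yB, yD, r, ℓ, fun _ => h⟩
    · exact ⟨0, 0, 0, 0, 0, fun h => absurd h hc⟩
  choose d yB yD r ℓ H using hflow
  refine ⟨fun c => riemannDensity γ (r c) (ℓ c), fun c => riemannVelocity (r c) (ℓ c),
    fun c c' hc hc' hne => ⟨1, one_pos, fun heq => hne ?_⟩, fun c hc => ?_⟩
  · obtain ⟨h1, h2, h3⟩ := (H c hc).initial_wave hq hT zero_le_one
    obtain ⟨h1', h2', h3'⟩ := (H c' hc').initial_wave hq hT zero_le_one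
    have hl : ℓ c (-T) 1 = ℓ c' (-T) 1 := by
      simp only [riemannVelocity, h1, h1'] at heq
      linarith
    have hpos : 0 < ℓ c (-T) 1 := by
      refine h2.lt_of_ne fun h0 => ?_
      rw [← h0, Real.zero_rpow (by positivity)] at h3
      linarith
    rw [← hl] at h3'
    have hp : 0 < 2 * (a * T) ^ (q + 2) * ℓ c (-T) 1 ^ (q + 1) := by positivity
    exact mul_right_cancel₀ hp.ne' (by linear_combination h3 - h3')
  · have h := H c hc
    have hb : waitingBoundary μ (yB c) = powerCurve (1 + 1 / q) (yB c) := by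
      funext t
      rw [waitingBoundary, powerCurve, hqδ]
    have hexp := h.initialExpansion hq ha0 hT hc rfl
    rw [ha] at h
    refine ⟨?_, yB c, yD c, h.yB_lt, h.yD_neg, ?_⟩
    · rw [InitialExpansion, hqx]
      refine hexp.congr_left fun x => ?_
      rw [show 2 * a = (γ + 1) / 2 by rw [ha]; ring, neg_mul]
      congr 3
      field_simp
    rw [hb, hqδ]
    exact ⟨⟨_, _, h.solvesVacuumEuler hγ hq hT⟩, h.selfSimilarBefore hγ.1 hq,
      h.selfSimilarAfter hγ hq, h.smoothInRegions fun p => h.contDiffAt_density hγ.1,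
      h.smoothInRegions fun p => h.contDiffAt_velocity,
      fun p hp => h.eulerAt hγ.1 (mem_regular h.yB_lt h.yD_neg hp).1
        (mem_regular h.yB_lt h.yD_neg hp).2,
      h.onlyLipschitz_density hγ.1, h.onlyLipschitz_velocity, h.holder_density hγ hq,
      h.holder_velocity, fun t ht => h.physicalVacuumAt hγ.1 ht⟩
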